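/- Setting. Let $A$ and $B$ be real $n\times n$ and $m\times m$ matrices, let $f:\mathbb R^n\times\mathbb R^m\to\mathbb R^n$ and $g:\mathbb R^n\times\mathbb R^m\to\mathbb R^m$ be globally Lipschitz with constants $L_f,L_g\ge 0$ with respect to $|x|+|y|$ ($|\cdot|$ Euclidean), and let $\sigma\in\mathbb R$. Assume ($H_1$) there are $\alpha\ge 0>\beta$ with $|e^{tA}x|\le e^{\alpha t}|x|$ for $t\le 0$, $x\in\mathbb R^n$, and $|e^{tB}y|\le e^{\beta t}|y|$ for $t\ge 0$, $y\in\mathbb R^m$; ($H_2$) $L_g+\beta<0$, and for every $0<\epsilon\le 1$ there is a $\lambda$ that is admissible at $\epsilon$, meaning $\lambda<\alpha$, $\beta<\epsilon\lambda<\alpha$ and $$\frac{L_f}{\alpha-\lambda}+\frac{L_g}{\epsilon\lambda-\beta}<1 .$$ Let $\Omega=\{\omega\in C(\mathbb R,\mathbb R^m):\omega(0)=0\}$ with the $\sigma$-algebra generated by the evaluations, let $\mathbb P$ be the two-sided Wiener measure, $W(t)(\omega)=\omega(t)$ and $\theta_t\omega=\omega(\cdot+t)-\omega(t)$. Fix $\epsilon\in(0,1]$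 and put $$\eta^\epsilon(\omega)=\frac{\sigma}{\sqrt\epsilon}\int_{-\infty}^0\frac1\epsilon B\,e^{-sB/\epsilon}\omega(s)\,ds$$ (read as $0$ if the integral does not converge absolutely). Consider the stochastic system $$\dot x=Ax+f(x,y),\qquad \dot y=\tfrac1\epsilon By+\tfrac1\epsilon g(x,y)+\tfrac{\sigma}{\sqrt\epsilon}\dot W, \tag{S}$$ in its pathwise integral form, and the random system $$\dot X=AX+f(X,Y+\eta^\epsilon(\theta_t\omega)),\qquad \dot Y=\tfrac1\epsilon BY+\tfrac1\epsilon g(X,Y+\eta^\epsilon(\theta_t\omega)). \tag{R}$$ For $\lambda\in\mathbb R$ let $C^-_\lambda$ be the space of continuous $u:(-\infty,0]\to\mathbb R^{n+m}$ with $\sup_{t\le0}e^{-\lambda t}|u(t)|<\infty$, and for $X_0\in\mathbb R^n$ and $u=(X,Y)\in C_\lambda^-$ put, for $t\le 0$, $$\mathcal T(X_0,\omega,u)(t)=\Big(e^{tA}X_0+\int_0^te^{(t-s)A}f\big(X(s),Y(s)+\eta^\epsilon(\theta_s\omega)\big)ds,\ \ \frac1\epsilon\int_{-\infty}^te^{(t-s)B/\epsilon}g\big(X(s),Y(s)+\eta^\epsilon(\theta_s\omega)\big)ds\Big).$$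 A Lipschitz random invariant manifold of a random dynamical system (RDS) $\varphi$ over $\theta$ on $\mathbb R^{n+m}$ is a family of non-empty closed sets $M(\omega)$, $\omega\in\Omega$, whose distance to each point is measurable in $\omega$, such that $M(\omega)=\{(X,\psi(X,\omega)):X\in\mathbb R^n\}$ with $\psi(X,\cdot)$ measurable and $\psi(\cdot,\omega)$ Lipschitz, and $\varphi(t,\omega)M(\omega)\subset M(\theta_t\omega)$ for all $t\ge0$ and all $\omega$ in a measurable $\theta$-invariant set $\Omega_0$ of full measure. Theorem. There is an admissible $\lambda<0$ at $\epsilon$, and there are a measurable set $\Omega_0\subset\Omega$ with $\mathbb P(\Omega_0)=1$ and $\theta_t^{-1}\Omega_0=\Omega_0$ for all $t\in\mathbb R$, and a map $h^\epsilon:\mathbb R^n\times\Omega\to\mathbb R^m$, such that: 1. $\eta^\epsilon$ is measurable, and for $\omega\in\Omega_0$ the path $t\mapsto\eta^\epsilon(\theta_t\omega)$, $t\in\mathbb R$, is continuous and solves $d\eta=\frac1\epsilon B\eta\,dt+\frac{\sigma}{\sqrt\epsilon}dW$. 2. For every $\omega\in\Omega$ and every initial value, (R) and (S) have unique solutions on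 $[0,\infty)$. Their solution maps $\Phi^\epsilon$ (of (R)) and $\phi^\epsilon$ (of (S)) are continuous RDSs over the metric dynamical system $(\Omega,\mathbb P,\theta)$, and $\phi^\epsilon(t,\omega)(z+(0,\eta^\epsilon(\omega)))=\Phi^\epsilon(t,\omega)z+(0,\eta^\epsilon(\theta_t\omega))$ for $\omega\in\Omega_0$, $t\ge 0$, $z\in\mathbb R^{n+m}$. 3. For every $\lambda<0$ that is admissible at $\epsilon$, every $\omega\in\Omega_0$ and every $X_0\in\mathbb R^n$, the operator $\mathcal T(X_0,\omega,\cdot)$ is well defined (the integrals over $(-\infty,t]$ converge absolutely), maps $C^-_\lambda$ into itself and has a unique fixed point $(X^{\epsilon*},Y^{\epsilon*})$ in $C^-_\lambda$, and $$h^\epsilon(X_0,\omega)=\frac1\epsilon\int_{-\infty}^0e^{-sB/\epsilon}g\big(X^{\epsilon*}(s),Y^{\epsilon*}(s)+\eta^\epsilon(\theta_s\omega)\big)\,ds .$$ 4. For every $\lambda<0$ that is admissible at $\epsilon$ and every $\omega\in\Omega$, $h^\epsilon(\cdot,\omega)$ is Lipschitz with the constant $$\frac{L_g}{(\epsilon\lambda-\beta)\big\{1-\big[\frac{L_f}{\alpha-\lambda}+\frac{L_g}{\epsilon\lambda-\beta}\big]\big\}}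 .$$ 5. $\mathcal M^\epsilon(\omega)=\{(X,h^\epsilon(X,\omega)):X\in\mathbb R^n\}$ is a Lipschitz random invariant manifold of $\Phi^\epsilon$, and $\mathcal M^\epsilon(\omega)+(0,\eta^\epsilon(\omega))$ is a Lipschitz random invariant manifold of the RDS $\phi^\epsilon$ of the original stochastic system (S), both with invariance on the above $\Omega_0$. -/

import Mathlib

open MeasureTheory ProbabilityTheory Set
open scoped NNReal

noncomputable section

namespace SlowFast

/-! ### Random dynamical systems -/

/-- A metric dynamical system `θ` on the probability space `(Ω, P)`. -/
structure IsMetricDynamicalSystem {Ω : Type*} [MeasurableSpace Ω] (P : Measure Ω)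
    (θ : ℝ → Ω → Ω) : Prop where
  zero : ∀ ω, θ 0 ω = ω
  add : ∀ s t ω, θ t (θ s ω) = θ (t + s) ω
  measurable : Measurable fun p : ℝ × Ω => θ p.1 p.2
  measurePreserving : ∀ t, MeasurePreserving (θ t) P P

/-- A continuous random dynamical system on `X` over the metric dynamical system `θ`. -/
structure IsContinuousRDS {Ω X : Type*} [MeasurableSpace Ω] [TopologicalSpace X]
    [MeasurableSpace X] (P : Measure Ω) (θ : ℝ → Ω → Ω) (φ : ℝ≥0 → Ω → X → X) : Prop where
  base : IsMetricDynamicalSystem P θ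
  measurable : Measurable fun p : ℝ≥0 × Ω × X => φ p.1 p.2.1 p.2.2
  zero : ∀ ω x, φ 0 ω x = x
  cocycle : ∀ (t τ : ℝ≥0) (ω : Ω) (x : X), φ t (θ τ ω) (φ τ ω x) = φ (t + τ) ω x
  continuous : ∀ t ω, Continuous (φ t ω)

/-- A random set: nonempty closed sets `M ω` whose distance to each point is a random variable. -/
structure IsRandomSet {Ω X : Type*} [MeasurableSpace Ω] [PseudoMetricSpace X]
    (M : Ω → Set X) : Prop where
  nonempty : ∀ ω, (M ω).Nonempty
  isClosed : ∀ ω, IsClosed (M ω)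
  measurable : ∀ x, Measurable fun ω => Metric.infDist x (M ω)

/-! ### The state space `ℝⁿ⁺ᵐ` with the norm `|x| + |y|` -/

/-- `ℝⁿ` with the Euclidean norm. -/
abbrev Eu (n : ℕ) : Type := EuclideanSpace ℝ (Fin n)

/-- `ℝⁿ × ℝᵐ` with the norm `|(x, y)| = |x| + |y|`. -/
abbrev State (n m : ℕ) : Type := WithLp 1 (Eu n × Eu m)

/-- The point `(x, y)` of the state space. -/
def pt {n m : ℕ} (x : Eu n) (y : Eu m) : State n m := WithLp.toLp 1 (x, y)

/-- `M` is a Lipschitz random invariant manifold of `φ` over `θ`, the graph of the random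
Lipschitz map `ψ`. As usual for random dynamical systems, invariance is asked for `ω` in a set
`Ω₀` (in the theorem: a measurable `θ`-invariant set of full measure). -/
structure IsLipschitzInvariantManifold {Ω : Type*} [MeasurableSpace Ω] {n m : ℕ}
    (θ : ℝ → Ω → Ω) (Ω₀ : Set Ω) (φ : ℝ≥0 → Ω → State n m → State n m)
    (M : Ω → Set (State n m)) (ψ : Eu n → Ω → Eu m) : Prop where
  randomSet : IsRandomSet M
  graph : ∀ ω, M ω = range fun x => pt x (ψ x ω)
  measurable : ∀ x, Measurable (ψ x)
  lipschitz : ∀ ω, ∃ K : ℝ≥0, LipschitzWith K fun x => ψ x ω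
  invariant : ∀ ω ∈ Ω₀, ∀ t : ℝ≥0, MapsTo (φ t ω) (M ω) (M (θ t ω))

/-! ### The canonical two-sided Wiener space -/

/-- Continuous paths `ω : ℝ → ℝᵐ` with `ω 0 = 0`. -/
def PathSpace (m : ℕ) : Type := {ω : C(ℝ, Eu m) // ω 0 = 0}

instance (m : ℕ) : CoeFun (PathSpace m) fun _ => ℝ → Eu m := ⟨fun ω t => ω.1 t⟩

/-- The σ-algebra generated by the evaluations `ω ↦ ω t`. -/
instance (m : ℕ) : MeasurableSpace (PathSpace m) :=
  MeasurableSpace.comap (fun (ω : PathSpace m) (t : ℝ) => ω t) MeasurableSpace.pi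

/-- The Wiener shift `(θ_t ω)(s) = ω (s + t) - ω t`. -/
def shift {m : ℕ} (t : ℝ) (ω : PathSpace m) : PathSpace m :=
  ⟨⟨fun s => ω (s + t) - ω t,
    (ω.1.continuous.comp (continuous_id.add continuous_const)).sub continuous_const⟩, by simp⟩

/-- `P` is the two-sided Wiener measure: independent increments, and the increment from `s` to `t`
is centred Gaussian with covariance `(t - s) I`. -/
structure IsWienerMeasure {m : ℕ} (P : Measure (PathSpace m)) : Prop where
  isProbabilityMeasure : IsProbabilityMeasure P
  indepIncrements : HasIndepIncrements (fun (t : ℝ) (ω : PathSpace m) => ω t) P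
  law : ∀ s t : ℝ, s ≤ t →
    P.map (fun ω : PathSpace m => ω t - ω s) =
      (stdGaussian (Eu m)).map fun x => Real.sqrt (t - s) • x

/-- The random variable `η^ε(ω) = (σ / √ε) ∫_{-∞}^0 e^{-sB/ε} dω(s)`; since `ω 0 = 0`, integration
by parts gives `(σ / √ε) ∫_{-∞}^0 (B/ε) e^{-sB/ε} ω(s) ds`. -/
def eta {m : ℕ} (B : Eu m →L[ℝ] Eu m) (σ ε : ℝ) (ω : PathSpace m) : Eu m :=
  (σ / Real.sqrt ε) • ∫ s in Iic (0 : ℝ), ε⁻¹ • B (NormedSpace.exp ((-(s / ε)) • B) (ω s))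

/-- On `Ω₀`, the process `t ↦ ξ (θ_t ω)`, `t ∈ ℝ`, solves the linear equation
`dξ = (1/ε) B ξ dt + (σ / √ε) dW`, where `W t ω = ω t`. If `θ` preserves the measure, this process
is stationary. -/
def SolvesLinearSDE {m : ℕ} (B : Eu m →L[ℝ] Eu m) (σ ε : ℝ) (Ω₀ : Set (PathSpace m))
    (ξ : PathSpace m → Eu m) : Prop :=
  Measurable ξ ∧ ∀ ω ∈ Ω₀, (Continuous fun t => ξ (shift t ω)) ∧ ∀ t : ℝ,
    ξ (shift t ω) =
      ξ ω + (∫ s in (0 : ℝ)..t, ε⁻¹ • B (ξ (shift s ω))) + (σ / Real.sqrt ε) • ω t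

/-! ### The slow-fast equations -/

section Equations

variable {n m : ℕ} (A : Eu n →L[ℝ] Eu n) (B : Eu m →L[ℝ] Eu m)
  (f : Eu n → Eu m → Eu n) (g : Eu n → Eu m → Eu m)

/-- `u = (X, Y)` solves, for `t ≥ 0`, the system `X' = A X + f(X, Y + ζ(t))`,
`Y' = (1/ε) (B Y + g(X, Y + ζ(t)))`. -/
def SolvesRandomSystem (ε : ℝ) (ζ : ℝ → Eu m) (u : ℝ → State n m) : Prop :=
  ∀ t, 0 ≤ t →
    HasDerivWithinAt (fun s => (u s).fst)
      (A (u t).fst + f (u t).fst ((u t).snd + ζ t)) (Ici 0) t ∧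
    HasDerivWithinAt (fun s => (u s).snd)
      (ε⁻¹ • (B (u t).snd + g (u t).fst ((u t).snd + ζ t))) (Ici 0) t

/-- `u = (x, y)` solves, for `t ≥ 0`, the system `dx = (A x + f(x, y)) dt`,
`dy = (1/ε) (B y + g(x, y)) dt + (σ / √ε) dw` driven by the path `w`. -/
def SolvesStochasticSystem (σ ε : ℝ) (w : ℝ → Eu m) (u : ℝ → State n m) : Prop :=
  ContinuousOn u (Ici 0) ∧ ∀ t, 0 ≤ t →
    (u t).fst = (u 0).fst + (∫ s in (0 : ℝ)..t, (A (u s).fst + f (u s).fst (u s).snd)) ∧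
    (u t).snd = (u 0).snd + (∫ s in (0 : ℝ)..t, ε⁻¹ • (B (u s).snd + g (u s).fst (u s).snd))
      + (σ / Real.sqrt ε) • w t

/-- `φ` is the solution map of the equation `Sol ω`: for each `ω` and `z`, the orbit
`t ↦ φ t ω z`, `t ≥ 0`, is the unique solution with initial value `z`. -/
def IsSolutionMap {Ω : Type*} (Sol : Ω → (ℝ → State n m) → Prop)
    (φ : ℝ≥0 → Ω → State n m → State n m) : Prop :=
  ∀ ω z, φ 0 ω z = z ∧ Sol ω (fun t => φ t.toNNReal ω z) ∧
    ∀ u, Sol ω u → u 0 = z → ∀ t : ℝ≥0, u t = φ t ω z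

/-! ### The Lyapunov-Perron operator -/

variable (n m) in
/-- The space `C_λ⁻` of continuous `u : (-∞, 0] → ℝⁿ⁺ᵐ` with `sup_{t ≤ 0} e^{-λ t} |u t| < ∞`. -/
def weightedSpace (lam : ℝ) : Set C(Iic (0 : ℝ), State n m) :=
  {u | BddAbove (range fun t : Iic (0 : ℝ) => Real.exp (-lam * t) * ‖u t‖)}

/-- The integrand `e^{(t-s)B/ε} g(X(s), Y(s) + ζ(s))`, for `u = (X, Y)` and `s ≤ 0`. -/
def fastIntegrand (ε : ℝ) (ζ : ℝ → Eu m) (u : C(Iic (0 : ℝ), State n m)) (t s : ℝ) : Eu m :=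
  NormedSpace.exp (((t - s) / ε) • B)
    (g (IicExtend u s).fst ((IicExtend u s).snd + ζ s))

/-- The Lyapunov-Perron operator `u = (X, Y) ↦ T(X₀, u)` on `(-∞, 0]`. -/
def lyapunovPerron (ε : ℝ) (ζ : ℝ → Eu m) (X₀ : Eu n) (u : C(Iic (0 : ℝ), State n m))
    (t : Iic (0 : ℝ)) : State n m :=
  pt
    (NormedSpace.exp ((t : ℝ) • A) X₀ +
      ∫ s in (0 : ℝ)..t, NormedSpace.exp (((t : ℝ) - s) • A)
        (f (IicExtend u s).fst ((IicExtend u s).snd + ζ s)))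
    (ε⁻¹ • ∫ s in Iic (t : ℝ), fastIntegrand B g ε ζ u t s)

end Equations

/-- `λ` is admissible for the spectral gap condition at `ε`. -/
def SpectralGap (α β Lf Lg ε lam : ℝ) : Prop :=
  lam < α ∧ β < ε * lam ∧ ε * lam < α ∧ Lf / (α - lam) + Lg / (ε * lam - β) < 1

end SlowFast

end

open SlowFast

/-!
The manifold is found by the Lyapunov-Perron method: after the noise has been absorbed into a
stationary process, it consists of the initial values of those solutions of the random system that
extend to `(-∞, 0]` with growth at most `e^{λt}`. These solutions are the fixed points of the
Lyapunov-Perron operator, and the gap condition makes that operator a contraction on the weighted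
space.

*A negative `λ`.* Admissibility for some `λ` at every `ε ∈ (0, 1]` yields a negative admissible `λ`
(`exists_neg_spectralGap`). For small `ε` this is due to `Lg + β < 0`. If it failed at some `ε`,
then `(0, 1]` would be separated into the `ε` with a negative and those with a positive admissible
value, because the gap condition is open in `ε` and convex in `λ`, and at `λ = 0` independent of `ε`.

*The noise.* For every path `ω` whose integral `∫_{-∞}^0 D e^{-sD} ω(s) ds` converges,
`D = ε⁻¹ B`, the process `t ↦ eta (shift t ω)` has an explicit form that is continuous and solves
the linear equation; for the other paths it vanishes identically. Convergence holds almost surely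
by Tonelli, since `E |ω(s)|` is of order `|s|^{1/2}`. For the Lyapunov-Perron operator no pointwise
growth bound on the noise is needed, only that `e^{-λs} |eta (shift s ω)|` is integrable on
`(-∞, 0]` for every `λ < 0`. By Tonelli again this follows almost surely from stationarity and a
first moment (`IsWienerMeasure.ae_mem_temperedSet`). Stationarity itself is a consequence of the
uniqueness of the Wiener measure (`IsWienerMeasure.unique`), as the shifted measure is again Wiener.

*The flows.* Both equations become ordinary differential equations with a globally Lipschitz field,
the stochastic one by subtracting the path of the noise. The solution is the limit of the Picard
iterates, which exhibits its joint measurability in time, path and initial value; the cocycle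
property and the conjugacy of the two flows follow from uniqueness.

*The fixed point.* The operator differs from its value at `u = 0` by a Lipschitz term with constant
`Lf / (α - λ) + Lg / (ε λ - β)`, and temperedness of the noise controls the value at `0`
(`IsGapSystem.exists_eq_lyapunovPerron`). Since the weighted spaces decrease as `λ` increases, the
fixed point is the same for all admissible `λ < 0` (`IsGapSystem.fixedPoint_eq`); hence one map `h`
satisfies the Lipschitz bounds for all of them. It is measurable as the limit of the iterates from
`0`.

*Invariance.* A forward solution starting on the graph is glued to the fixed point on `(-∞, 0]`.
The glued path is a mild solution on `ℝ`, and its translate by `τ ≥ 0` is therefore a fixed point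
for the noise shifted by `τ` (`IsGapSystem.snd_eq_manifoldMap`).
-/

open MeasureTheory ProbabilityTheory Set
open scoped NNReal

noncomputable section

namespace SlowFast

open Filter Topology

/-! ### The spectral gap condition -/

section Gap

variable {α β Lf Lg ε lam : ℝ}

/-- Convexity of `x ↦ L / x` on the positive half-line. -/
lemma div_combo_le {L x y a b : ℝ} (hL : 0 ≤ L) (hx : 0 < x) (hy : 0 < y) (ha : 0 < a)
    (hb : 0 < b) (hab : a + b = 1) : L / (a * x + b * y) ≤ a * (L / x) + b * (L / y) := by
  have key : 1 / (a * x + b * y) ≤ a / x + b / y := by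
    rw [div_add_div _ _ hx.ne' hy.ne', div_le_div_iff₀ (by positivity) (by positivity)]
    have : b = 1 - a := by linarith
    subst this
    nlinarith [mul_nonneg (mul_nonneg ha.le hb.le) (sq_nonneg (x - y))]
  calc L / (a * x + b * y) = L * (1 / (a * x + b * y)) := by ring
    _ ≤ L * (a / x + b / y) := by gcongr
    _ = _ := by ring

/-- The left-hand side of the gap condition is convex in `λ`, so admissibility of a negative and of
a positive `λ` gives admissibility of `0`. -/
lemma SpectralGap.zero_of_neg_of_pos {l₁ l₂ : ℝ} (hLf : 0 ≤ Lf) (hLg : 0 ≤ Lg) (hβ : β < 0)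
    (h₁ : SpectralGap α β Lf Lg ε l₁) (h₂ : SpectralGap α β Lf Lg ε l₂) (hl₁ : l₁ < 0)
    (hl₂ : 0 < l₂) : SpectralGap α β Lf Lg ε 0 := by
  obtain ⟨h11, h12, h13, h14⟩ := h₁
  obtain ⟨h21, h22, h23, h24⟩ := h₂
  have hd : 0 < l₂ - l₁ := by linarith
  set a := l₂ / (l₂ - l₁) with ha_def
  set b := -l₁ / (l₂ - l₁) with hb_def
  have ha : 0 < a := by positivity
  have hb : 0 < b := div_pos (by linarith) hd
  have hab : a + b = 1 := by rw [ha_def, hb_def]; field_simp; ring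
  have hz : a * l₁ + b * l₂ = 0 := by rw [ha_def, hb_def]; field_simp; ring
  refine ⟨by linarith, by linarith, by linarith, ?_⟩
  have e1 := div_combo_le hLf (sub_pos.2 h11) (sub_pos.2 h21) ha hb hab
  have e2 := div_combo_le hLg (sub_pos.2 h12) (sub_pos.2 h22) ha hb hab
  have q1 : a * (α - l₁) + b * (α - l₂) = α - 0 := by linear_combination α * hab - hz
  have q2 : a * (ε * l₁ - β) + b * (ε * l₂ - β) = ε * 0 - β := by
    linear_combination -β * hab + ε * hz
  rw [q1] at e1
  rw [q2] at e2
  have m1 := mul_lt_mul_of_pos_left h14 ha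
  have m2 := mul_lt_mul_of_pos_left h24 hb
  nlinarith

lemma isOpen_setOf_spectralGap : IsOpen {ε | SpectralGap α β Lf Lg ε lam} := by
  by_cases h : lam < α
  · have : {ε | SpectralGap α β Lf Lg ε lam} =
        {ε | β < ε * lam} ∩ {ε | ε * lam < α} ∩
          {ε | Lg < (1 - Lf / (α - lam)) * (ε * lam - β)} := by
      ext ε
      simp only [SpectralGap, mem_ofPred_eq, mem_inter_iff, h, true_and, and_assoc]
      refine and_congr_right fun h1 => and_congr_right fun _ => ?_
      rw [← div_lt_iff₀ (sub_pos.2 h1), lt_sub_iff_add_lt, add_comm]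
    rw [this]
    refine (IsOpen.inter ?_ ?_).inter ?_ <;> exact isOpen_lt (by fun_prop) (by fun_prop)
  · convert isOpen_empty
    ext ε
    simp [SpectralGap, h]

/-- If `0` is admissible at some `ε'`, then it is so at every `ε`, since the condition at `λ = 0`
does not see `ε`, and then small negative `λ` are admissible as well. -/
lemma SpectralGap.exists_neg_of_zero {ε' : ℝ} (h : SpectralGap α β Lf Lg ε' 0) :
    ∃ lam < 0, SpectralGap α β Lf Lg ε lam := by
  obtain ⟨h1, h2, h3, h4⟩ := h
  rw [mul_zero] at h2 h3 h4
  have c1 : Tendsto (fun l : ℝ => α - l) (𝓝 0) (𝓝 (α - 0)) :=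
    (by fun_prop : Continuous fun l : ℝ => α - l).tendsto 0
  have c2 : Tendsto (fun l : ℝ => ε * l - β) (𝓝 0) (𝓝 (0 - β)) := by
    have := (by fun_prop : Continuous fun l : ℝ => ε * l - β).tendsto 0
    simpa using this
  have c3 : Tendsto (fun l : ℝ => ε * l) (𝓝 0) (𝓝 0) := by
    have := (by fun_prop : Continuous fun l : ℝ => ε * l).tendsto 0
    simpa using this
  have c4 := (tendsto_const_nhds (x := Lf)).div c1 (by linarith : α - 0 ≠ 0)|>.add
    ((tendsto_const_nhds (x := Lg)).div c2 (by linarith : 0 - β ≠ 0))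
  have ev : ∀ᶠ l in 𝓝 (0 : ℝ), SpectralGap α β Lf Lg ε l := by
    filter_upwards [eventually_lt_nhds h1, c3.eventually (eventually_gt_nhds h2),
      c3.eventually (eventually_lt_nhds h3), c4.eventually (eventually_lt_nhds h4)]
      with l a b c d using ⟨a, b, c, d⟩
  have ev' : ∀ᶠ l in 𝓝[<] (0 : ℝ), SpectralGap α β Lf Lg ε l := ev.filter_mono nhdsWithin_le_nhds
  obtain ⟨l, hl, hl'⟩ := (ev'.and self_mem_nhdsWithin).exists
  exact ⟨l, hl', hl⟩

/-- For small `ε` the condition `Lg + β < 0` provides a negative admissible value: keep `ε λ` fixed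
in `(β + Lg, 0)` and let `λ → -∞`. -/
lemma exists_small_neg_spectralGap (hLf : 0 ≤ Lf) (hα : 0 ≤ α) (hLg : 0 ≤ Lg)
    (hLgβ : Lg + β < 0) : ∃ ε ∈ Ioc (0 : ℝ) 1, ∃ lam < 0, SpectralGap α β Lf Lg ε lam := by
  set μ := (β + Lg) / 2 with hμ
  have hμ0 : μ < 0 := by linarith
  have hμβ : Lg < μ - β := by linarith
  set d := 1 - Lg / (μ - β) with hd
  have hd0 : 0 < d := by
    rw [hd, sub_pos, div_lt_one (by linarith)]
    exact hμβ
  have hq : 0 < d * -μ / (Lf + 1) := by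
    have : 0 < d * -μ := mul_pos hd0 (by linarith)
    positivity
  set e := min 1 (d * -μ / (Lf + 1)) with he
  have he0 : 0 < e := lt_min one_pos hq
  have hμe : μ / e < 0 := div_neg_of_neg_of_pos hμ0 he0
  have hcancel : e * (μ / e) = μ := by field_simp
  refine ⟨e, ⟨he0, min_le_left _ _⟩, μ / e, hμe, by linarith, by rw [hcancel]; linarith,
    by rw [hcancel]; linarith, ?_⟩
  rw [hcancel]
  have h1 : Lf / (α - μ / e) < d := by
    rw [div_lt_iff₀ (by linarith)]
    have h2 : e * (Lf + 1) ≤ d * -μ := by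
      rw [← le_div_iff₀ (by positivity)]; exact min_le_right _ _
    have h3 : Lf * e < d * -μ := by nlinarith
    have h4 : Lf < d * -(μ / e) := by
      have : d * -(μ / e) = d * -μ / e := by ring
      rw [this, lt_div_iff₀ he0]
      exact h3
    nlinarith
  linarith

/-- A negative admissible `λ` exists at every `ε`. If `0` is never admissible, the sets of `ε`
with a negative, respectively a positive, admissible value are open, disjoint and cover `(0, 1]`,
and the first one is non-empty. -/
lemma exists_neg_spectralGap (hLf : 0 ≤ Lf) (hLg : 0 ≤ Lg) (hα : 0 ≤ α) (hβ : β < 0)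
    (hgap : ∀ ε : ℝ, 0 < ε → ε ≤ 1 → ∃ lam, SpectralGap α β Lf Lg ε lam)
    (hLgβ : Lg + β < 0) (hε : 0 < ε) (hε1 : ε ≤ 1) :
    ∃ lam < 0, SpectralGap α β Lf Lg ε lam := by
  by_cases h0 : ∃ e, SpectralGap α β Lf Lg e 0
  · obtain ⟨e, he⟩ := h0
    exact he.exists_neg_of_zero
  push Not at h0
  set U := {e | ∃ lam < 0, SpectralGap α β Lf Lg e lam} with hU
  set V := {e | ∃ lam > 0, SpectralGap α β Lf Lg e lam} with hV
  have hUo : IsOpen U := by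
    have : U = ⋃ lam ∈ Iio (0 : ℝ), {e | SpectralGap α β Lf Lg e lam} := by
      ext; simp [hU]
    rw [this]
    exact isOpen_biUnion fun _ _ => isOpen_setOf_spectralGap
  have hVo : IsOpen V := by
    have : V = ⋃ lam ∈ Ioi (0 : ℝ), {e | SpectralGap α β Lf Lg e lam} := by
      ext; simp [hV]
    rw [this]
    exact isOpen_biUnion fun _ _ => isOpen_setOf_spectralGap
  have hcov : Ioc (0 : ℝ) 1 ⊆ U ∪ V := by
    intro e he
    obtain ⟨l, hl⟩ := hgap e he.1 he.2
    rcases lt_trichotomy l 0 with h | h | h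
    · exact Or.inl ⟨l, h, hl⟩
    · exact absurd (h ▸ hl) (h0 e)
    · exact Or.inr ⟨l, h, hl⟩
  rcases hcov ⟨hε, hε1⟩ with h | h
  · exact h
  · obtain ⟨e, he, hl⟩ := exists_small_neg_spectralGap hLf hα hLg hLgβ
    obtain ⟨e', -, ⟨l₁, hl₁, h₁⟩, l₂, hl₂, h₂⟩ :=
      isPreconnected_Ioc U V hUo hVo hcov ⟨e, he, hl⟩ ⟨ε, ⟨hε, hε1⟩, h⟩
    exact absurd (h₁.zero_of_neg_of_pos hLf hLg hβ h₂ hl₁ hl₂) (h0 e')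

end Gap

/-! ### One-parameter groups of operators -/

section Semigroup

variable {E : Type*} [NormedAddCommGroup E] [NormedSpace ℝ E] (D : E →L[ℝ] E)

@[simp] lemma exp_zero_smul_apply (x : E) : NormedSpace.exp ((0 : ℝ) • D) x = x := by
  rw [zero_smul, NormedSpace.exp_zero]; rfl

variable [CompleteSpace E]

lemma exp_add_smul (s t : ℝ) :
    NormedSpace.exp ((s + t) • D) = NormedSpace.exp (s • D) * NormedSpace.exp (t • D) := by
  let : NormedAlgebra ℚ (E →L[ℝ] E) := NormedAlgebra.restrictScalars ℚ ℝ _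
  rw [add_smul]
  exact NormedSpace.exp_add_of_commute (((Commute.refl D).smul_left s).smul_right t)

lemma exp_add_smul_apply (s t : ℝ) (x : E) :
    NormedSpace.exp ((s + t) • D) x = NormedSpace.exp (s • D) (NormedSpace.exp (t • D) x) := by
  rw [exp_add_smul]; rfl

lemma continuous_exp_smul : Continuous fun t : ℝ => NormedSpace.exp (t • D) :=
  continuous_iff_continuousAt.2 fun t => (hasDerivAt_exp_smul_const (𝕂 := ℝ) D t).continuousAt

lemma hasDerivAt_exp_smul_apply (x : E) (t : ℝ) :
    HasDerivAt (fun t : ℝ => NormedSpace.exp (t • D) x) (D (NormedSpace.exp (t • D) x)) t := by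
  simpa using (hasDerivAt_exp_smul_const' (𝕂 := ℝ) D t).clm_apply (hasDerivAt_const t x)

lemma exp_smul_apply_comm (t : ℝ) (x : E) :
    NormedSpace.exp (t • D) (D x) = D (NormedSpace.exp (t • D) x) := by
  have h1 := hasDerivAt_exp_smul_const (𝕂 := ℝ) D t
  have h2 := hasDerivAt_exp_smul_const' (𝕂 := ℝ) D t
  have := h1.unique h2
  exact congrArg (fun L : E →L[ℝ] E => L x) this

lemma _root_.Continuous.exp_smul_apply {X : Type*} [TopologicalSpace X] {r : X → ℝ} {p : X → E}
    (hr : Continuous r) (hp : Continuous p) :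
    Continuous fun x => NormedSpace.exp (r x • D) (p x) :=
  ((continuous_exp_smul D).comp hr).clm_apply hp

lemma measurable_exp_smul_apply {X : Type*} [MeasurableSpace X] [MeasurableSpace E] [BorelSpace E]
    [SecondCountableTopology E] {r : X → ℝ} {p : X → E} (hr : Measurable r) (hp : Measurable p) :
    Measurable fun x => NormedSpace.exp (r x • D) (p x) :=
  ((continuous_fst.exp_smul_apply D continuous_snd).measurable (α := ℝ × E)).comp
    (hr.prodMk hp)

/-- Variation of constants. -/
lemma eq_exp_smul_add_integral {v p : ℝ → E} (hp : ContinuousOn p (Ici 0))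
    (hv : ∀ t, 0 ≤ t → HasDerivWithinAt v (D (v t) + p t) (Ici 0) t) {t : ℝ} (ht : 0 ≤ t) :
    v t = NormedSpace.exp (t • D) (v 0) +
      ∫ s in (0 : ℝ)..t, NormedSpace.exp ((t - s) • D) (p s) := by
  have hc : ContinuousOn v (Ici 0) := fun s hs => (hv s hs).continuousWithinAt
  have hexp : Continuous fun s : ℝ => NormedSpace.exp ((t - s) • D) :=
    (continuous_exp_smul D).comp (by fun_prop)
  have hd : ∀ s ∈ Ioo 0 t, HasDerivWithinAt (fun s => NormedSpace.exp ((t - s) • D) (v s))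
      (NormedSpace.exp ((t - s) • D) (p s)) (Ioi s) s := by
    intro s hs
    have h1 : HasDerivAt (fun s : ℝ => NormedSpace.exp ((t - s) • D))
        (-(NormedSpace.exp ((t - s) • D) * D)) s := by
      have := (hasDerivAt_exp_smul_const (𝕂 := ℝ) D (t - s)).scomp s
        ((hasDerivAt_id s).const_sub t)
      convert! this using 1
      simp
    have h2 : HasDerivWithinAt v (D (v s) + p s) (Ioi s) s :=
      (hv s hs.1.le).mono fun r hr => hs.1.le.trans (le_of_lt hr)
    convert h1.hasDerivWithinAt.clm_apply h2 using 1
    simp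
  have := intervalIntegral.integral_eq_sub_of_hasDeriv_right_of_le ht
    ((hexp.continuousOn.clm_apply hc).mono fun s hs => hs.1) hd
    (ContinuousOn.intervalIntegrable_of_Icc ht
      ((hexp.continuousOn.clm_apply hp).mono fun s hs => hs.1))
  rw [this]
  simp

end Semigroup

/-! ### Wiener measure and the Wiener shift -/

section Wiener

variable {m : ℕ}

lemma PathSpace.continuous (ω : PathSpace m) : Continuous fun t => ω t := ω.1.continuous

@[simp] lemma PathSpace.apply_zero (ω : PathSpace m) : ω 0 = 0 := ω.2

lemma PathSpace.ext {ω ω' : PathSpace m} (h : ∀ t, ω t = ω' t) : ω = ω' :=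
  Subtype.ext (ContinuousMap.ext h)

@[simp] lemma shift_apply (t : ℝ) (ω : PathSpace m) (s : ℝ) : shift t ω s = ω (s + t) - ω t := rfl

lemma shift_zero (ω : PathSpace m) : shift 0 ω = ω := PathSpace.ext fun t => by simp

lemma shift_shift (s t : ℝ) (ω : PathSpace m) : shift t (shift s ω) = shift (t + s) ω :=
  PathSpace.ext fun r => by simp [add_assoc]

lemma measurable_coe_pathSpace :
    Measurable fun (ω : PathSpace m) (t : ℝ) => ω t := comap_measurable _

lemma measurable_eval (t : ℝ) : Measurable fun ω : PathSpace m => ω t :=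
  (measurable_pi_apply t).comp measurable_coe_pathSpace

lemma measurable_increment (s t : ℝ) : Measurable fun ω : PathSpace m => ω t - ω s :=
  (measurable_eval t).sub (measurable_eval s)

lemma measurable_pathSpace_iff {X : Type*} [MeasurableSpace X] {F : X → PathSpace m} :
    Measurable F ↔ ∀ t, Measurable fun x => F x t := by
  rw [measurable_comap_iff, measurable_pi_iff]; rfl

lemma measurable_eval_uncurry : Measurable fun p : ℝ × PathSpace m => p.2 p.1 :=
  measurable_uncurry_of_continuous_of_measurable (u := fun (t : ℝ) (ω : PathSpace m) => ω t)
    (fun ω => ω.continuous) measurable_eval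

lemma measurable_shift_uncurry : Measurable fun p : ℝ × PathSpace m => shift p.1 p.2 := by
  refine measurable_pathSpace_iff.2 fun t => ?_
  simp only [shift_apply]
  exact (measurable_eval_uncurry.comp
    ((measurable_const.add measurable_fst).prodMk measurable_snd)).sub measurable_eval_uncurry

lemma measurable_shift (t : ℝ) : Measurable (shift t : PathSpace m → PathSpace m) :=
  measurable_shift_uncurry.comp measurable_prodMk_left

/-- The values of a path at `k + 1` increasing times, one of which is `0`, recovered from its
`k` increments. -/
lemma eval_eq_sum_increments {k : ℕ} (e : Fin (k + 1) → ℝ) {j₀ : Fin (k + 1)} (hj₀ : e j₀ = 0)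
    (ω : PathSpace m) (j : Fin (k + 1)) :
    ω (e j) = (∑ i : Fin k, if i.castSucc < j then ω (e i.succ) - ω (e i.castSucc) else 0) -
      ∑ i : Fin k, if i.castSucc < j₀ then ω (e i.succ) - ω (e i.castSucc) else 0 := by
  have key : ∀ j : Fin (k + 1), (∑ i : Fin k,
      if i.castSucc < j then ω (e i.succ) - ω (e i.castSucc) else 0) = ω (e j) - ω (e 0) := by
    intro j
    induction j using Fin.induction with
    | zero => simp
    | succ j ih =>
      have : ∀ i : Fin k, (if i.castSucc < j.succ then ω (e i.succ) - ω (e i.castSucc) else 0) =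
          (if i.castSucc < j.castSucc then ω (e i.succ) - ω (e i.castSucc) else 0) +
            if i = j then ω (e i.succ) - ω (e i.castSucc) else 0 := by
        intro i
        rcases lt_trichotomy i j with h | h | h
        · have h1 : i.castSucc < j.succ := by simpa using h.le
          have h2 : i.castSucc < j.castSucc := by simpa using h
          simp [h1, h2, h.ne]
        · subst h; simp
        · have h1 : ¬ i.castSucc < j.succ := by simpa using h
          have h2 : ¬ i.castSucc < j.castSucc := by simpa using h.le
          simp [h1, h2, h.ne']
      simp_rw [this, Finset.sum_add_distrib, ih]
      simp
  rw [key, key, hj₀]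
  simp

/-- There is at most one Wiener measure: the increments over a finite set of times containing `0`
determine the values there. -/
lemma IsWienerMeasure.unique {P Q : Measure (PathSpace m)} (hP : IsWienerMeasure P)
    (hQ : IsWienerMeasure Q) : P = Q := by
  have := hP.isProbabilityMeasure
  have := hQ.isProbabilityMeasure
  have hmap : P.map (fun (ω : PathSpace m) (t : ℝ) => ω t) =
      Q.map (fun (ω : PathSpace m) (t : ℝ) => ω t) := by
    have hpm : IsProbabilityMeasure (Q.map (fun (ω : PathSpace m) (t : ℝ) => ω t)) :=
      Measure.isProbabilityMeasure_map measurable_coe_pathSpace.aemeasurable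
    refine IsProjectiveLimit.unique (P := fun I =>
      (Q.map (fun (ω : PathSpace m) (t : ℝ) => ω t)).map I.restrict) (fun I => ?_) fun I => rfl
    change Measure.map I.restrict (P.map _) = Measure.map I.restrict (Q.map _)
    rw [Measure.map_map (by fun_prop) measurable_coe_pathSpace,
      Measure.map_map (by fun_prop) measurable_coe_pathSpace]
    -- The law of the increments determines only differences of values; the time `0`, where paths
    -- vanish, fixes the constant.
    set J := insert 0 I with hJ
    obtain ⟨k, hk⟩ : ∃ k, J.card = k + 1 :=
      Nat.exists_eq_succ_of_ne_zero (Finset.card_ne_zero.2 (Finset.insert_nonempty _ _))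
    set e := J.orderEmbOfFin hk with he
    have hsurj : ∀ t ∈ J, ∃ j, e j = t := fun t ht => by
      have : t ∈ Set.range e := by rw [he, Finset.range_orderEmbOfFin]; exact ht
      exact this
    obtain ⟨j₀, hj₀⟩ := hsurj 0 (by simp [hJ])
    choose! idx hidx using hsurj
    set inc : PathSpace m → Fin k → Eu m :=
      fun ω i => ω (e i.succ) - ω (e i.castSucc) with hinc
    have hincm : Measurable inc :=
      measurable_pi_iff.2 fun i => measurable_increment _ _
    set R : (Fin k → Eu m) → (I → Eu m) := fun y t =>
      (∑ i : Fin k, if i.castSucc < idx t then y i else 0) -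
        ∑ i : Fin k, if i.castSucc < j₀ then y i else 0 with hR
    have hRm : Measurable R := by
      refine measurable_pi_iff.2 fun t => ?_
      refine Measurable.sub (Finset.measurable_sum _ fun i _ => ?_)
        (Finset.measurable_sum _ fun i _ => ?_) <;> split_ifs <;> fun_prop
    have hfac : (I.restrict ∘ fun (ω : PathSpace m) (t : ℝ) => ω t) = R ∘ inc := by
      funext ω t
      have ht : e (idx t) = t := hidx t (by simp [hJ])
      have := eval_eq_sum_increments e hj₀ ω (idx t)
      rw [ht] at this
      exact this
    have hlaw : ∀ {P : Measure (PathSpace m)}, IsWienerMeasure P → P.map inc =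
        Measure.pi fun i : Fin k => (stdGaussian (Eu m)).map
          fun x => Real.sqrt (e i.succ - e i.castSucc) • x := by
      intro P hP
      have := hP.isProbabilityMeasure
      have h1 := (iIndepFun_iff_map_fun_eq_pi_map fun i =>
        (measurable_increment _ _).aemeasurable).1
        (hP.indepIncrements k e e.monotone)
      rw [hinc, h1]
      congr 1
      funext i
      exact hP.law _ _ (e.monotone (Fin.castSucc_lt_succ).le)
    rw [hfac, ← Measure.map_map hRm hincm, ← Measure.map_map hRm hincm, hlaw hP, hlaw hQ]
  ext s hs
  obtain ⟨s', hs', rfl⟩ := hs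
  rw [← Measure.map_apply measurable_coe_pathSpace hs', hmap,
    Measure.map_apply measurable_coe_pathSpace hs']

lemma IsWienerMeasure.map_shift {P : Measure (PathSpace m)} (hP : IsWienerMeasure P) (τ : ℝ) :
    IsWienerMeasure (P.map (shift τ)) := by
  have := hP.isProbabilityMeasure
  have hpm : IsProbabilityMeasure (P.map (shift τ)) :=
    Measure.isProbabilityMeasure_map (measurable_shift τ).aemeasurable
  have hlaw : ∀ s t : ℝ, s ≤ t → (P.map (shift τ)).map (fun ω : PathSpace m => ω t - ω s) =
      (stdGaussian (Eu m)).map fun x => Real.sqrt (t - s) • x := by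
    intro s t hst
    rw [Measure.map_map (measurable_increment _ _) (measurable_shift τ)]
    have := hP.law (s + τ) (t + τ) (by linarith)
    rw [show t - s = t + τ - (s + τ) by ring, ← this]
    congr 1
    funext ω
    simp
  refine ⟨hpm, fun k t ht => ?_, hlaw⟩
  have hm : ∀ i : Fin k, Measurable fun ω : PathSpace m => ω (t i.succ) - ω (t i.castSucc) :=
    fun i => measurable_increment _ _
  have hm' : ∀ i : Fin k,
      Measurable fun ω : PathSpace m => ω (t i.succ + τ) - ω (t i.castSucc + τ) :=
    fun i => measurable_increment _ _
  have h1 := (iIndepFun_iff_map_fun_eq_pi_map fun i => (hm' i).aemeasurable).1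
    (hP.indepIncrements k (fun i => t i + τ) fun i j hij => by simpa using ht hij)
  rw [iIndepFun_iff_map_fun_eq_pi_map fun i => (hm i).aemeasurable,
    Measure.map_map (measurable_pi_iff.2 hm) (measurable_shift τ)]
  have hcomp : ((fun (ω : PathSpace m) (i : Fin k) => ω (t i.succ) - ω (t i.castSucc)) ∘ shift τ) =
      fun ω i => ω (t i.succ + τ) - ω (t i.castSucc + τ) := by
    funext ω i; simp
  rw [hcomp, h1]
  congr 1
  funext i
  have hle : t i.castSucc ≤ t i.succ := ht (Fin.castSucc_lt_succ).le
  rw [hlaw _ _ hle, hP.law _ _ (by linarith), add_sub_add_right_eq_sub]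

lemma IsWienerMeasure.measurePreserving_shift {P : Measure (PathSpace m)}
    (hP : IsWienerMeasure P) (τ : ℝ) : MeasurePreserving (shift τ) P P :=
  ⟨measurable_shift τ, (hP.map_shift τ).unique hP⟩

lemma IsWienerMeasure.isMetricDynamicalSystem {P : Measure (PathSpace m)}
    (hP : IsWienerMeasure P) : IsMetricDynamicalSystem P (shift (m := m)) :=
  ⟨shift_zero, shift_shift, measurable_shift_uncurry, hP.measurePreserving_shift⟩

lemma lintegral_enorm_stdGaussian_lt_top : ∫⁻ x, ‖x‖ₑ ∂(stdGaussian (Eu m)) < ⊤ :=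
  (IsGaussian.integrable_id (μ := stdGaussian (Eu m))).hasFiniteIntegral

/-- The first absolute moment at time `s` is `|s|^{1/2}` times that of the standard Gaussian. -/
lemma IsWienerMeasure.lintegral_enorm_eval {P : Measure (PathSpace m)} (hP : IsWienerMeasure P)
    {s : ℝ} (hs : s ≤ 0) : ∫⁻ ω : PathSpace m, ‖ω s‖ₑ ∂P =
      ENNReal.ofReal (Real.sqrt (-s)) * ∫⁻ x, ‖x‖ₑ ∂(stdGaussian (Eu m)) := by
  have h1 : ∫⁻ ω : PathSpace m, ‖ω s‖ₑ ∂P =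
      ∫⁻ x, ‖x‖ₑ ∂(P.map fun ω : PathSpace m => ω 0 - ω s) := by
    rw [lintegral_map measurable_enorm (measurable_increment _ _)]
    simp
  rw [h1, hP.law s 0 hs, lintegral_map measurable_enorm (measurable_const_smul _),
    ← lintegral_const_mul _ measurable_enorm]
  congr 1
  funext x
  rw [enorm_smul, zero_sub, Real.enorm_of_nonneg (Real.sqrt_nonneg _)]

end Wiener

/-! ### The stationary solution of the linear equation -/

section HalfLine

variable {E : Type*} [NormedAddCommGroup E]

lemma integrableOn_Iic_comp_add_right_iff {q : ℝ → E} (a t : ℝ) :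
    IntegrableOn (fun s => q (s + t)) (Iic a) ↔ IntegrableOn q (Iic (a + t)) := by
  have := (measurePreserving_add_right volume t).integrableOn_comp_preimage
    (MeasurableEquiv.addRight t).measurableEmbedding (f := q) (s := Iic (a + t))
  rwa [show (fun x : ℝ => x + t) ⁻¹' Iic (a + t) = Iic a by ext; simp] at this

lemma integral_Iic_comp_add_right [NormedSpace ℝ E] (q : ℝ → E) (a t : ℝ) :
    ∫ s in Iic a, q (s + t) = ∫ s in Iic (a + t), q s := by
  have := (measurePreserving_add_right volume t).setIntegral_preimage_emb
    (MeasurableEquiv.addRight t).measurableEmbedding q (Iic (a + t))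
  rwa [show (fun x : ℝ => x + t) ⁻¹' Iic (a + t) = Iic a by ext; simp] at this

lemma _root_.Continuous.integrableOn_Iic_iff {q : ℝ → E} (hq : Continuous q) (a b : ℝ) :
    IntegrableOn q (Iic a) ↔ IntegrableOn q (Iic b) := by
  have key : ∀ a b : ℝ, IntegrableOn q (Iic a) → IntegrableOn q (Iic b) := fun a b h =>
    (h.union (hq.integrableOn_Icc (a := a) (b := b))).mono_set fun x hx => by
      rcases le_total x a with h | h
      · exact Or.inl h
      · exact Or.inr ⟨h, hx⟩
  exact ⟨key a b, key b a⟩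

end HalfLine

section LinearEquation

variable {E : Type*} [NormedAddCommGroup E] [NormedSpace ℝ E] [CompleteSpace E] {D : E →L[ℝ] E}
  {γ : ℝ}

lemma integrableOn_exp_neg_smul (hγ : γ < 0)
    (hD : ∀ t : ℝ, 0 ≤ t → ∀ y, ‖NormedSpace.exp (t • D) y‖ ≤ Real.exp (γ * t) * ‖y‖) (y : E) :
    IntegrableOn (fun s : ℝ => D (NormedSpace.exp ((-s) • D) y)) (Iic 0) := by
  have hexp : IntegrableOn (fun s : ℝ => Real.exp (-γ * s)) (Iic 0) :=
    integrableOn_exp_mul_Iic (by linarith) 0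
  refine Integrable.mono' (hexp.const_mul ‖D‖ |>.mul_const ‖y‖)
    (D.continuous.comp (continuous_neg.exp_smul_apply D
      continuous_const)).aestronglyMeasurable ?_
  refine (ae_restrict_iff' measurableSet_Iic).2 (ae_of_all _ fun s hs => ?_)
  rw [mul_assoc]
  refine (D.le_opNorm _).trans ?_
  gcongr
  have := hD (-s) (neg_nonneg.2 hs) y
  rwa [mul_neg, ← neg_mul] at this

lemma integral_exp_neg_smul (hγ : γ < 0)
    (hD : ∀ t : ℝ, 0 ≤ t → ∀ y, ‖NormedSpace.exp (t • D) y‖ ≤ Real.exp (γ * t) * ‖y‖) (y : E) :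
    ∫ s in Iic (0 : ℝ), D (NormedSpace.exp ((-s) • D) y) = -y := by
  have hder : ∀ s : ℝ, HasDerivAt (fun s : ℝ => -NormedSpace.exp ((-s) • D) y)
      (D (NormedSpace.exp ((-s) • D) y)) s := by
    intro s
    have := ((hasDerivAt_exp_smul_apply D y (-s)).scomp s (hasDerivAt_neg s)).neg
    convert! this using 1
    simp
  have hlim : Tendsto (fun s : ℝ => -NormedSpace.exp ((-s) • D) y) atBot (𝓝 0) := by
    rw [← neg_zero]
    refine Tendsto.neg (squeeze_zero_norm' (a := fun s => Real.exp (γ * -s) * ‖y‖) ?_ ?_)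
    · filter_upwards [eventually_le_atBot 0] with s hs using hD (-s) (neg_nonneg.2 hs) y
    · rw [← zero_mul ‖y‖]
      refine Tendsto.mul_const _ (Real.tendsto_exp_atBot.comp ?_)
      exact tendsto_neg_atBot_atTop.const_mul_atTop_of_neg hγ
  have := integral_Iic_of_hasDerivAt_of_tendsto (hder 0).continuousAt.continuousWithinAt
    (fun s _ => hder s) (integrableOn_exp_neg_smul hγ hD y) hlim
  rw [this]
  simp

variable (D) in
/-- The integrand `D e^{-sD} k(s)` of the stationary solution of `dη = D η dt + dk`. -/
def convIntegrand (k : ℝ → E) (s : ℝ) : E := D (NormedSpace.exp ((-s) • D) (k s))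

lemma continuous_convIntegrand {k : ℝ → E} (hk : Continuous k) : Continuous (convIntegrand D k) :=
  D.continuous.comp (continuous_neg.exp_smul_apply D hk)

/-- The integrand for the increments `k(· + t) - k(t)`. The subtracted term has the integral
`-k(t)` over `(-∞, 0]`, which becomes the noise term of the linear equation. -/
lemma convIntegrand_shift (k : ℝ → E) (t s : ℝ) :
    convIntegrand D (fun s => k (s + t) - k t) s =
      NormedSpace.exp (t • D) (convIntegrand D k (s + t)) -
        D (NormedSpace.exp ((-s) • D) (k t)) := by
  have : NormedSpace.exp ((-s) • D) (k (s + t)) =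
      NormedSpace.exp (t • D) (NormedSpace.exp ((-(s + t)) • D) (k (s + t))) := by
    rw [← exp_add_smul_apply]; congr 3; ring
  rw [convIntegrand, map_sub, map_sub, this, convIntegrand, exp_smul_apply_comm]

lemma integrable_exp_smul_apply_iff {X : Type*} [MeasurableSpace X] {μ : Measure X} {q : X → E}
    (t : ℝ) : Integrable (fun x => NormedSpace.exp (t • D) (q x)) μ ↔ Integrable q μ := by
  refine ⟨fun h => ?_, fun h => (NormedSpace.exp (t • D)).integrable_comp h⟩
  have := (NormedSpace.exp ((-t) • D)).integrable_comp h
  simpa only [← exp_add_smul_apply, neg_add_cancel, exp_zero_smul_apply] using this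

lemma integrableOn_convIntegrand_shift (hγ : γ < 0)
    (hD : ∀ t : ℝ, 0 ≤ t → ∀ y, ‖NormedSpace.exp (t • D) y‖ ≤ Real.exp (γ * t) * ‖y‖)
    {k : ℝ → E} (hk : Continuous k) (t : ℝ) :
    IntegrableOn (convIntegrand D fun s => k (s + t) - k t) (Iic 0) ↔
      IntegrableOn (convIntegrand D k) (Iic 0) := by
  rw [show (convIntegrand D fun s => k (s + t) - k t) = fun s =>
    NormedSpace.exp (t • D) (convIntegrand D k (s + t)) - D (NormedSpace.exp ((-s) • D) (k t)) from
    funext (convIntegrand_shift k t), IntegrableOn]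
  have hy := integrableOn_exp_neg_smul hγ hD (k t)
  have hsub : ∀ p : ℝ → E, Integrable (fun s => p s - D (NormedSpace.exp ((-s) • D) (k t)))
      (volume.restrict (Iic 0)) ↔ Integrable p (volume.restrict (Iic 0)) := fun p =>
    ⟨fun h => (h.add hy).congr (ae_of_all _ fun s => by simp), fun h => h.sub hy⟩
  rw [hsub, integrable_exp_smul_apply_iff, ← IntegrableOn, integrableOn_Iic_comp_add_right_iff,
    zero_add, (continuous_convIntegrand hk).integrableOn_Iic_iff t 0]

lemma integral_convIntegrand_shift (hγ : γ < 0)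
    (hD : ∀ t : ℝ, 0 ≤ t → ∀ y, ‖NormedSpace.exp (t • D) y‖ ≤ Real.exp (γ * t) * ‖y‖)
    {k : ℝ → E} (hk : Continuous k) (hint : IntegrableOn (convIntegrand D k) (Iic 0)) (t : ℝ) :
    ∫ s in Iic (0 : ℝ), convIntegrand D (fun s => k (s + t) - k t) s =
      NormedSpace.exp (t • D) ((∫ s in Iic (0 : ℝ), convIntegrand D k s) +
        ∫ s in (0 : ℝ)..t, convIntegrand D k s) + k t := by
  have hint' := ((continuous_convIntegrand (D := D) hk).integrableOn_Iic_iff t 0).2 hint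
  simp_rw [convIntegrand_shift]
  rw [integral_sub, integral_exp_neg_smul hγ hD, sub_neg_eq_add,
    ContinuousLinearMap.integral_comp_comm, integral_Iic_comp_add_right, zero_add,
    ← intervalIntegral.integral_Iic_sub_Iic hint hint']
  · simp
  · rw [← IntegrableOn, integrableOn_Iic_comp_add_right_iff, zero_add]
    exact hint'
  · rw [integrable_exp_smul_apply_iff, ← IntegrableOn, integrableOn_Iic_comp_add_right_iff,
      zero_add]
    exact hint'
  · exact integrableOn_exp_neg_smul hγ hD (k t)

/-- `z(t) = e^{tD} (z₀ + ∫_0^t D e^{-sD} k(s) ds) + k(t)` solves `dz = D z dt + dk`. -/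
lemma conv_eq_add_integral {k : ℝ → E} (hk : Continuous k) (z₀ : E) :
    (Continuous fun t : ℝ =>
      NormedSpace.exp (t • D) (z₀ + ∫ s in (0 : ℝ)..t, convIntegrand D k s) + k t) ∧
    ∀ t : ℝ, NormedSpace.exp (t • D) (z₀ + ∫ s in (0 : ℝ)..t, convIntegrand D k s) + k t =
      z₀ + (∫ r in (0 : ℝ)..t, D (NormedSpace.exp (r • D)
        (z₀ + ∫ s in (0 : ℝ)..r, convIntegrand D k s) + k r)) + k t := by
  have hq := continuous_convIntegrand (D := D) hk
  have hder : ∀ t, HasDerivAt (fun t : ℝ =>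
      NormedSpace.exp (t • D) (z₀ + ∫ s in (0 : ℝ)..t, convIntegrand D k s))
      (D (NormedSpace.exp (t • D) (z₀ + ∫ s in (0 : ℝ)..t, convIntegrand D k s) + k t)) t := by
    intro t
    have h1 : HasDerivAt (fun t => z₀ + ∫ s in (0 : ℝ)..t, convIntegrand D k s)
        (convIntegrand D k t) t :=
      (intervalIntegral.integral_hasDerivAt_right (hq.intervalIntegrable _ _)
        (hq.stronglyMeasurableAtFilter _ _) hq.continuousAt).const_add _
    convert! (hasDerivAt_exp_smul_const' (𝕂 := ℝ) D t).clm_apply h1 using 1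
    rw [map_add, convIntegrand, exp_smul_apply_comm, ← exp_add_smul_apply]
    simp
  have hc : Continuous fun t : ℝ =>
      NormedSpace.exp (t • D) (z₀ + ∫ s in (0 : ℝ)..t, convIntegrand D k s) :=
    continuous_iff_continuousAt.2 fun t => (hder t).continuousAt
  refine ⟨hc.add hk, fun t => ?_⟩
  rw [intervalIntegral.integral_eq_sub_of_hasDerivAt (fun s _ => hder s)
    ((D.continuous.comp (hc.add hk)).intervalIntegrable _ _)]
  simp

end LinearEquation

section Eta

variable {m : ℕ} {B : Eu m →L[ℝ] Eu m} {σ ε γ : ℝ}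

lemma eta_eq (B : Eu m →L[ℝ] Eu m) (σ ε : ℝ) (ω : PathSpace m) : eta B σ ε ω =
    (σ / Real.sqrt ε) • ∫ s in Iic (0 : ℝ), convIntegrand (ε⁻¹ • B) (fun s => ω s) s := by
  unfold eta convIntegrand
  congr 2
  funext s
  rw [smul_smul, show -(s / ε) = -s * ε⁻¹ by ring]
  rfl

/-- The paths for which the integral defining the stationary solution of `dη = D η dt + dω`
converges absolutely. -/
def convergenceSet (D : Eu m →L[ℝ] Eu m) : Set (PathSpace m) :=
  {ω | IntegrableOn (convIntegrand D fun s => ω s) (Iic 0)}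

lemma shift_mem_convergenceSet {D : Eu m →L[ℝ] Eu m} (hγ : γ < 0)
    (hD : ∀ t : ℝ, 0 ≤ t → ∀ y, ‖NormedSpace.exp (t • D) y‖ ≤ Real.exp (γ * t) * ‖y‖)
    (t : ℝ) (ω : PathSpace m) : shift t ω ∈ convergenceSet D ↔ ω ∈ convergenceSet D :=
  integrableOn_convIntegrand_shift hγ hD ω.continuous t

/-- Off the convergence set `eta` is `0`, the value of an undefined integral. -/
lemma eta_shift_of_notMem (hγ : γ < 0) (hD : ∀ t : ℝ, 0 ≤ t → ∀ y,
      ‖NormedSpace.exp (t • ε⁻¹ • B) y‖ ≤ Real.exp (γ * t) * ‖y‖)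
    {ω : PathSpace m} (hω : ω ∉ convergenceSet (ε⁻¹ • B)) (t : ℝ) :
    eta B σ ε (shift t ω) = 0 := by
  rw [eta_eq, integral_undef, smul_zero]
  exact fun h => hω ((shift_mem_convergenceSet hγ hD t ω).1 h)

lemma eta_shift_of_mem (hγ : γ < 0) (hD : ∀ t : ℝ, 0 ≤ t → ∀ y,
      ‖NormedSpace.exp (t • ε⁻¹ • B) y‖ ≤ Real.exp (γ * t) * ‖y‖)
    {ω : PathSpace m} (hω : ω ∈ convergenceSet (ε⁻¹ • B)) (t : ℝ) :
    eta B σ ε (shift t ω) = (σ / Real.sqrt ε) • (NormedSpace.exp (t • ε⁻¹ • B)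
      ((∫ s in Iic (0 : ℝ), convIntegrand (ε⁻¹ • B) (fun s => ω s) s) +
        ∫ s in (0 : ℝ)..t, convIntegrand (ε⁻¹ • B) (fun s => ω s) s) + ω t) := by
  rw [eta_eq, ← integral_convIntegrand_shift hγ hD ω.continuous hω t]
  rfl

lemma continuous_eta_shift (hγ : γ < 0) (hD : ∀ t : ℝ, 0 ≤ t → ∀ y,
      ‖NormedSpace.exp (t • ε⁻¹ • B) y‖ ≤ Real.exp (γ * t) * ‖y‖) (ω : PathSpace m) :
    Continuous fun t => eta B σ ε (shift t ω) := by
  by_cases hω : ω ∈ convergenceSet (ε⁻¹ • B)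
  · simp_rw [eta_shift_of_mem hγ hD hω]
    exact (conv_eq_add_integral ω.continuous _).1.const_smul (σ / Real.sqrt ε)
  · simp_rw [eta_shift_of_notMem hγ hD hω]
    exact continuous_const

lemma eta_shift_eq_add_integral (hγ : γ < 0) (hD : ∀ t : ℝ, 0 ≤ t → ∀ y,
      ‖NormedSpace.exp (t • ε⁻¹ • B) y‖ ≤ Real.exp (γ * t) * ‖y‖)
    {ω : PathSpace m} (hω : ω ∈ convergenceSet (ε⁻¹ • B)) (t : ℝ) :
    eta B σ ε (shift t ω) = eta B σ ε ω + (∫ s in (0 : ℝ)..t, ε⁻¹ • B (eta B σ ε (shift s ω))) +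
      (σ / Real.sqrt ε) • ω t := by
  have h : ∀ s, ε⁻¹ • B (eta B σ ε (shift s ω)) =
      (σ / Real.sqrt ε) • (ε⁻¹ • B) (NormedSpace.exp (s • ε⁻¹ • B)
      ((∫ s in Iic (0 : ℝ), convIntegrand (ε⁻¹ • B) (fun s => ω s) s) +
        ∫ s in (0 : ℝ)..s, convIntegrand (ε⁻¹ • B) (fun s => ω s) s) + ω s) := by
    intro s
    rw [eta_shift_of_mem hγ hD hω]
    change (ε⁻¹ • B) ((σ / Real.sqrt ε) • _) = _
    rw [map_smul]
  simp_rw [h]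
  rw [eta_shift_of_mem hγ hD hω, (conv_eq_add_integral ω.continuous _).2 t,
    intervalIntegral.integral_smul, eta_eq, ← smul_add, ← smul_add]

lemma measurable_convIntegrand (D : Eu m →L[ℝ] Eu m) :
    Measurable fun p : PathSpace m × ℝ => convIntegrand D (fun s => p.1 s) p.2 :=
  D.continuous.measurable.comp (measurable_exp_smul_apply D measurable_snd.neg
    (measurable_eval_uncurry.comp measurable_swap))

lemma measurableSet_convergenceSet (D : Eu m →L[ℝ] Eu m) : MeasurableSet (convergenceSet D) :=
  measurableSet_integrable (μ := volume.restrict (Iic (0 : ℝ)))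
    (measurable_convIntegrand D).stronglyMeasurable

lemma measurable_eta (B : Eu m →L[ℝ] Eu m) (σ ε : ℝ) : Measurable (eta B σ ε) := by
  simp_rw [funext (eta_eq B σ ε)]
  exact ((measurable_convIntegrand (ε⁻¹ • B)).stronglyMeasurable.integral_prod_right'
    (ν := volume.restrict (Iic (0 : ℝ)))).measurable.const_smul (σ / Real.sqrt ε)

lemma measurable_eta_shift (B : Eu m →L[ℝ] Eu m) (σ ε : ℝ) :
    Measurable fun p : PathSpace m × ℝ => eta B σ ε (shift p.2 p.1) :=
  (measurable_eta B σ ε).comp (measurable_shift_uncurry.comp measurable_swap)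

lemma sqrt_le_const_mul_exp {a : ℝ} (ha : 0 < a) {x : ℝ} (hx : 0 ≤ x) :
    Real.sqrt x ≤ (1 + a⁻¹) * Real.exp (a * x) := by
  have h1 : Real.sqrt x ≤ 1 + x := by
    rw [Real.sqrt_le_left (by linarith)]
    nlinarith
  have h2 : 1 + x ≤ (1 + a⁻¹) * (a * x + 1) := by
    have : (1 + a⁻¹) * (a * x + 1) = 1 + x + a * x + a⁻¹ := by field_simp; ring
    rw [this]
    have : 0 ≤ a * x + a⁻¹ := by positivity
    linarith
  exact (h1.trans h2).trans (by gcongr; exact Real.add_one_le_exp _)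

/-- The first absolute moment of the integral defining `η`. Here `E |ω(s)|` grows like `|s|^{1/2}`,
and the exponential decay of the semigroup wins. -/
lemma IsWienerMeasure.lintegral_convIntegrand_lt_top {P : Measure (PathSpace m)}
    (hP : IsWienerMeasure P) {D : Eu m →L[ℝ] Eu m} (hγ : γ < 0)
    (hD : ∀ t : ℝ, 0 ≤ t → ∀ y, ‖NormedSpace.exp (t • D) y‖ ≤ Real.exp (γ * t) * ‖y‖) :
    ∫⁻ ω, (∫⁻ s in Iic (0 : ℝ), ‖convIntegrand D (fun s => ω s) s‖ₑ) ∂P < ⊤ := by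
  have := hP.isProbabilityMeasure
  set G := ∫⁻ x, ‖x‖ₑ ∂(stdGaussian (Eu m)) with hG
  set a := -γ / 2 with ha
  have ha0 : 0 < a := by linarith
  have hint : IntegrableOn (fun s : ℝ => ‖D‖ * (1 + a⁻¹) * Real.exp (a * s)) (Iic 0) :=
    (integrableOn_exp_mul_Iic ha0 0).const_mul _
  rw [lintegral_lintegral_swap (measurable_convIntegrand D).enorm.aemeasurable]
  calc ∫⁻ s in Iic (0 : ℝ), ∫⁻ ω, ‖convIntegrand D (fun s => ω s) s‖ₑ ∂P
      ≤ ∫⁻ s in Iic (0 : ℝ), ‖‖D‖ * (1 + a⁻¹) * Real.exp (a * s)‖ₑ * G := by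
        refine setLIntegral_mono' measurableSet_Iic fun s hs => ?_
        have hs' : 0 ≤ -s := neg_nonneg.2 hs
        calc ∫⁻ ω, ‖convIntegrand D (fun s => ω s) s‖ₑ ∂P
            ≤ ∫⁻ ω, ENNReal.ofReal (‖D‖ * Real.exp (γ * -s)) * ‖ω s‖ₑ ∂P := by
              refine lintegral_mono fun ω => ?_
              rw [← ofReal_norm, ← ofReal_norm, ← ENNReal.ofReal_mul (by positivity)]
              refine ENNReal.ofReal_le_ofReal ((D.le_opNorm _).trans ?_)
              rw [mul_assoc]
              gcongr
              exact hD _ hs' _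
          _ = ENNReal.ofReal (‖D‖ * Real.exp (γ * -s)) *
                (ENNReal.ofReal (Real.sqrt (-s)) * G) := by
              rw [lintegral_const_mul _ (measurable_eval s).enorm, hP.lintegral_enorm_eval hs]
          _ ≤ ‖‖D‖ * (1 + a⁻¹) * Real.exp (a * s)‖ₑ * G := by
              rw [← mul_assoc, ← ENNReal.ofReal_mul (by positivity),
                Real.enorm_of_nonneg (by positivity)]
              gcongr ENNReal.ofReal ?_ * _
              have h1 := sqrt_le_const_mul_exp ha0 hs'
              have h2 : Real.exp (a * s) = Real.exp (γ * -s) * Real.exp (a * -s) := by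
                rw [← Real.exp_add, ha]; congr 1; ring
              calc ‖D‖ * Real.exp (γ * -s) * Real.sqrt (-s)
                  ≤ ‖D‖ * Real.exp (γ * -s) * ((1 + a⁻¹) * Real.exp (a * -s)) := by gcongr
                _ = _ := by rw [h2]; ring
    _ = (∫⁻ s in Iic (0 : ℝ), ‖‖D‖ * (1 + a⁻¹) * Real.exp (a * s)‖ₑ) * G :=
        lintegral_mul_const _ (by fun_prop)
    _ < ⊤ := ENNReal.mul_lt_top hint.hasFiniteIntegral lintegral_enorm_stdGaussian_lt_top

lemma IsWienerMeasure.ae_mem_convergenceSet {P : Measure (PathSpace m)}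
    (hP : IsWienerMeasure P) {D : Eu m →L[ℝ] Eu m} (hγ : γ < 0)
    (hD : ∀ t : ℝ, 0 ≤ t → ∀ y, ‖NormedSpace.exp (t • D) y‖ ≤ Real.exp (γ * t) * ‖y‖) :
    ∀ᵐ ω ∂P, ω ∈ convergenceSet D := by
  filter_upwards [ae_lt_top' ((measurable_convIntegrand D).enorm.lintegral_prod_right').aemeasurable
    (hP.lintegral_convIntegrand_lt_top hγ hD).ne] with ω hω
  exact ⟨(continuous_convIntegrand ω.continuous).aestronglyMeasurable, hω⟩

lemma IsWienerMeasure.lintegral_enorm_eta_lt_top {P : Measure (PathSpace m)}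
    (hP : IsWienerMeasure P) (hγ : γ < 0) (hD : ∀ t : ℝ, 0 ≤ t → ∀ y,
      ‖NormedSpace.exp (t • ε⁻¹ • B) y‖ ≤ Real.exp (γ * t) * ‖y‖) :
    ∫⁻ ω, ‖eta B σ ε ω‖ₑ ∂P < ⊤ := by
  calc ∫⁻ ω, ‖eta B σ ε ω‖ₑ ∂P
      ≤ ∫⁻ ω, (‖σ / Real.sqrt ε‖ₑ *
          ∫⁻ s in Iic (0 : ℝ), ‖convIntegrand (ε⁻¹ • B) (fun s => ω s) s‖ₑ) ∂P := by
        refine lintegral_mono fun ω => ?_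
        rw [eta_eq, enorm_smul]
        gcongr
        exact enorm_integral_le_lintegral_enorm _
    _ = ‖σ / Real.sqrt ε‖ₑ *
          ∫⁻ ω, (∫⁻ s in Iic (0 : ℝ), ‖convIntegrand (ε⁻¹ • B) (fun s => ω s) s‖ₑ) ∂P :=
        lintegral_const_mul _ (measurable_convIntegrand _).enorm.lintegral_prod_right'
    _ < ⊤ := ENNReal.mul_lt_top enorm_lt_top (hP.lintegral_convIntegrand_lt_top hγ hD)

/-- The paths `ω` along which `ξ (shift s ω)` is subexponential as `s → -∞`, in an averaged sense.
The countably many rates `1 / (k + 1)` make the set measurable. -/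
def temperedSet (ξ : PathSpace m → Eu m) : Set (PathSpace m) :=
  {ω | ∀ k : ℕ, IntegrableOn (fun s : ℝ => Real.exp ((k + 1 : ℝ)⁻¹ * s) • ξ (shift s ω)) (Iic 0)}

lemma measurableSet_temperedSet (B : Eu m →L[ℝ] Eu m) (σ ε : ℝ) :
    MeasurableSet (temperedSet (eta B σ ε)) := by
  rw [temperedSet, ofPred_forall]
  refine MeasurableSet.iInter fun k => ?_
  refine measurableSet_integrable (μ := volume.restrict (Iic (0 : ℝ)))
    (f := fun (ω : PathSpace m) (s : ℝ) =>
      Real.exp ((k + 1 : ℝ)⁻¹ * s) • eta B σ ε (shift s ω)) ?_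
  refine Measurable.stronglyMeasurable ?_
  exact (Real.measurable_exp.comp (measurable_snd.const_mul _)).smul (measurable_eta_shift B σ ε)

lemma shift_mem_temperedSet {ξ : PathSpace m → Eu m} {ω : PathSpace m}
    (hc : Continuous fun t => ξ (shift t ω)) (hω : ω ∈ temperedSet ξ) (t : ℝ) :
    shift t ω ∈ temperedSet ξ := by
  intro k
  set q : ℝ → Eu m := fun s => Real.exp ((k + 1 : ℝ)⁻¹ * s) • ξ (shift s ω) with hq
  have hqc : Continuous q := (by fun_prop : Continuous fun s : ℝ =>
    Real.exp ((k + 1 : ℝ)⁻¹ * s)).smul hc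
  have h1 : IntegrableOn (fun s => q (s + t)) (Iic 0) := by
    rw [integrableOn_Iic_comp_add_right_iff, hqc.integrableOn_Iic_iff _ 0]
    exact hω k
  refine (h1.smul (Real.exp ((k + 1 : ℝ)⁻¹ * -t))).congr (ae_of_all _ fun s => ?_)
  simp only [hq, Pi.smul_apply, shift_shift, smul_smul, ← Real.exp_add]
  congr 2
  ring

/-- Under the shift-invariant measure the first moment of `eta (shift s ω)` does not depend on `s`,
so that Tonelli applies against the integrable weight. -/
lemma IsWienerMeasure.ae_mem_temperedSet {P : Measure (PathSpace m)}
    (hP : IsWienerMeasure P) (hγ : γ < 0) (hD : ∀ t : ℝ, 0 ≤ t → ∀ y,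
      ‖NormedSpace.exp (t • ε⁻¹ • B) y‖ ≤ Real.exp (γ * t) * ‖y‖) :
    ∀ᵐ ω ∂P, ω ∈ temperedSet (eta B σ ε) := by
  have := hP.isProbabilityMeasure
  refine ae_all_iff.2 fun k => ?_
  have hm : Measurable fun p : PathSpace m × ℝ =>
      Real.exp ((k + 1 : ℝ)⁻¹ * p.2) • eta B σ ε (shift p.2 p.1) :=
    (Real.measurable_exp.comp (measurable_snd.const_mul _)).smul (measurable_eta_shift B σ ε)
  have hexp : IntegrableOn (fun s : ℝ => Real.exp ((k + 1 : ℝ)⁻¹ * s)) (Iic 0) :=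
    integrableOn_exp_mul_Iic (by positivity) 0
  have hfin : ∫⁻ ω, (∫⁻ s in Iic (0 : ℝ),
      ‖Real.exp ((k + 1 : ℝ)⁻¹ * s) • eta B σ ε (shift s ω)‖ₑ) ∂P < ⊤ := by
    rw [lintegral_lintegral_swap hm.enorm.aemeasurable]
    simp_rw [enorm_smul]
    calc ∫⁻ s in Iic (0 : ℝ), ∫⁻ ω,
          ‖Real.exp ((k + 1 : ℝ)⁻¹ * s)‖ₑ * ‖eta B σ ε (shift s ω)‖ₑ ∂P
        = ∫⁻ s in Iic (0 : ℝ), ‖Real.exp ((k + 1 : ℝ)⁻¹ * s)‖ₑ * ∫⁻ ω, ‖eta B σ ε ω‖ₑ ∂P := by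
          congr 1
          funext s
          have hms : Measurable fun ω => ‖eta B σ ε (shift s ω)‖ₑ :=
            ((measurable_eta B σ ε).comp (measurable_shift s)).enorm
          rw [lintegral_const_mul _ hms,
            (hP.measurePreserving_shift s).lintegral_comp (measurable_eta B σ ε).enorm]
      _ = (∫⁻ s in Iic (0 : ℝ), ‖Real.exp ((k + 1 : ℝ)⁻¹ * s)‖ₑ) * ∫⁻ ω, ‖eta B σ ε ω‖ₑ ∂P :=
          lintegral_mul_const _ (by fun_prop)
      _ < ⊤ := ENNReal.mul_lt_top hexp.hasFiniteIntegral (hP.lintegral_enorm_eta_lt_top hγ hD)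
  filter_upwards [ae_lt_top' hm.enorm.lintegral_prod_right'.aemeasurable hfin.ne] with ω hω
  exact ⟨(hm.comp measurable_prodMk_left).aestronglyMeasurable, hω⟩

lemma integrableOn_exp_smul_of_mem_temperedSet {ξ : PathSpace m → Eu m} {ω : PathSpace m}
    (hc : Continuous fun t => ξ (shift t ω)) (hω : ω ∈ temperedSet ξ) {lam : ℝ} (hlam : lam < 0) :
    IntegrableOn (fun s : ℝ => Real.exp (-lam * s) * ‖ξ (shift s ω)‖) (Iic 0) := by
  obtain ⟨k, hk⟩ := exists_nat_one_div_lt (neg_pos.2 hlam)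
  refine Integrable.mono' (hω k).norm
    ((by fun_prop : Continuous fun s : ℝ => Real.exp (-lam * s)).mul
      hc.norm).aestronglyMeasurable ?_
  refine (ae_restrict_iff' measurableSet_Iic).2 (ae_of_all _ fun s hs => ?_)
  have hs' : s ≤ 0 := hs
  rw [norm_mul, norm_smul, norm_norm, Real.norm_of_nonneg (Real.exp_nonneg _),
    Real.norm_of_nonneg (Real.exp_nonneg _)]
  rw [one_div] at hk
  gcongr ?_ * _
  exact Real.exp_le_exp.2 (by nlinarith)

end Eta

/-! ### Global solutions of Lipschitz equations depending on a parameter -/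

section ODE

variable {E : Type*} [NormedAddCommGroup E] [NormedSpace ℝ E]

/-- `v` solves `v' = F(t, v)` for `t ≥ 0`. -/
def IsForwardSolution (F : ℝ → E → E) (v : ℝ → E) : Prop :=
  ∀ t, 0 ≤ t → HasDerivWithinAt v (F t (v t)) (Ici 0) t

lemma IsForwardSolution.continuousOn {F : ℝ → E → E} {v : ℝ → E} (hv : IsForwardSolution F v) :
    ContinuousOn v (Ici 0) := fun t ht => (hv t ht).continuousWithinAt

/-- Gronwall's inequality. -/
lemma IsForwardSolution.dist_le {F : ℝ → E → E} {K : ℝ≥0} (hK : ∀ t, LipschitzWith K (F t))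
    {v w : ℝ → E} (hv : IsForwardSolution F v) (hw : IsForwardSolution F w) {t : ℝ} (ht : 0 ≤ t) :
    dist (v t) (w t) ≤ dist (v 0) (w 0) * Real.exp (K * t) := by
  have := dist_le_of_trajectories_ODE (a := 0) (b := t) hK
    (hv.continuousOn.mono fun s hs => hs.1)
    (fun s hs => (hv s hs.1).mono fun r hr => hs.1.trans hr)
    (hw.continuousOn.mono fun s hs => hs.1)
    (fun s hs => (hw s hs.1).mono fun r hr => hs.1.trans hr) le_rfl t ⟨ht, le_rfl⟩
  simpa using this

lemma IsForwardSolution.eq {F : ℝ → E → E} {K : ℝ≥0} (hK : ∀ t, LipschitzWith K (F t))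
    {v w : ℝ → E} (hv : IsForwardSolution F v) (hw : IsForwardSolution F w) (h0 : v 0 = w 0)
    {t : ℝ} (ht : 0 ≤ t) : v t = w t := by
  have := hv.dist_le hK hw ht
  rw [h0, dist_self, zero_mul] at this
  exact dist_le_zero.1 this

variable [CompleteSpace E]

/-- A one-sided fundamental theorem of calculus at all points of `[0, ∞)`, obtained by extending
`w` constantly to the left of `0`. -/
lemma hasDerivWithinAt_of_eq_add_integral {v w : ℝ → E} {z : E} (hw : ContinuousOn w (Ici 0))
    (hv : ∀ t, 0 ≤ t → v t = z + ∫ s in (0 : ℝ)..t, w s) {t : ℝ} (ht : 0 ≤ t) :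
    HasDerivWithinAt v (w t) (Ici 0) t := by
  have hc : Continuous fun s => w (max s 0) :=
    hw.comp_continuous (by fun_prop) fun s => le_max_right s 0
  have h1 : HasDerivAt (fun t => z + ∫ s in (0 : ℝ)..t, w (max s 0)) (w (max t 0)) t :=
    (intervalIntegral.integral_hasDerivAt_right (hc.intervalIntegrable _ _)
      (hc.stronglyMeasurableAtFilter _ _) hc.continuousAt).const_add _
  rw [max_eq_left ht] at h1
  have heq : ∀ r ∈ Ici (0 : ℝ), v r = z + ∫ s in (0 : ℝ)..r, w (max s 0) := by
    intro r hr
    rw [hv r hr]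
    congr 1
    refine intervalIntegral.integral_congr fun s hs => ?_
    rw [uIcc_of_le hr] at hs
    simp [max_eq_left hs.1]
  exact h1.hasDerivWithinAt.congr heq (heq t ht)

lemma IsForwardSolution.eq_add_integral {F : ℝ → E → E} (hF : Continuous (Function.uncurry F))
    {v : ℝ → E} (hv : IsForwardSolution F v) {t : ℝ} (ht : 0 ≤ t) :
    v t = v 0 + ∫ s in (0 : ℝ)..t, F s (v s) := by
  have hc : ContinuousOn (fun s => F s (v s)) (Ici 0) :=
    hF.comp_continuousOn (continuousOn_id.prodMk hv.continuousOn)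
  rw [intervalIntegral.integral_eq_sub_of_hasDeriv_right_of_le ht
    (hv.continuousOn.mono fun s hs => hs.1)
    (fun s hs => (hv s hs.1.le).mono fun r hr => hs.1.le.trans (le_of_lt hr))
    (ContinuousOn.intervalIntegrable_of_Icc ht (hc.mono fun s hs => hs.1))]
  simp

/-- The Picard iterates of `v' = F(t, v)`, `v(0) = z`. -/
def picardIterate (F : ℝ → E → E) (z : E) : ℕ → ℝ → E
  | 0 => fun _ => z
  | k + 1 => fun t => z + ∫ s in (0 : ℝ)..t, F s (picardIterate F z k s)

omit [CompleteSpace E] in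
lemma picardIterate_succ (F : ℝ → E → E) (z : E) (k : ℕ) (t : ℝ) :
    picardIterate F z (k + 1) t = z + ∫ s in (0 : ℝ)..t, F s (picardIterate F z k s) := rfl

variable {F : ℝ → E → E} {K : ℝ≥0}

omit [CompleteSpace E] in
lemma continuous_picardIterate (hF : Continuous (Function.uncurry F)) (z : E) (k : ℕ) :
    Continuous (picardIterate F z k) := by
  induction k with
  | zero => exact continuous_const
  | succ k ih =>
    have hc : Continuous fun s => F s (picardIterate F z k s) := hF.comp (continuous_id.prodMk ih)
    exact continuous_const.add
      (intervalIntegral.continuous_primitive (fun a b => hc.intervalIntegrable a b) 0)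

omit [CompleteSpace E] in
/-- In the weighted norm with weight `e^{-2Kt}`, the Picard map is a contraction with constant
`1/2`. -/
lemma exists_picardIterate_dist_le (hF : Continuous (Function.uncurry F))
    (hK : ∀ t, LipschitzWith K (F t)) (z : E) (T : ℝ) :
    ∃ C, ∀ t ∈ Icc 0 T, ∀ k, dist (picardIterate F z k t) (picardIterate F z (k + 1) t) ≤
      C * Real.exp (2 * K * t) * (1 / 2) ^ k := by
  obtain ⟨C, hC⟩ := isCompact_Icc.exists_bound_of_continuousOn (s := Icc 0 T)
    ((continuous_picardIterate hF z 1).sub (continuous_picardIterate hF z 0)).continuousOn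
  refine ⟨max C 0, fun t ht k => ?_⟩
  have hC0 : 0 ≤ max C 0 := le_max_right _ _
  induction k generalizing t with
  | zero =>
    rw [dist_comm, dist_eq_norm, pow_zero, mul_one]
    refine ((hC t ht).trans (le_max_left C 0)).trans (le_mul_of_one_le_right hC0 ?_)
    exact Real.one_le_exp (mul_nonneg (by positivity) ht.1)
  | succ k ih =>
    have hcont : ∀ k, Continuous fun s => F s (picardIterate F z k s) := fun k =>
      hF.comp (continuous_id.prodMk (continuous_picardIterate hF z k))
    have hder : ∀ s : ℝ, HasDerivAt (fun s => max C 0 * (1 / 2) ^ (k + 1) * Real.exp (2 * K * s))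
        (K * (max C 0 * Real.exp (2 * K * s) * (1 / 2) ^ k)) s := by
      intro s
      have := (((hasDerivAt_id s).const_mul (2 * (K : ℝ))).exp).const_mul
        (max C 0 * (1 / 2) ^ (k + 1))
      convert! this using 1
      simp only [id, mul_one, pow_succ]
      ring
    have hint := intervalIntegral.integral_eq_sub_of_hasDerivAt (a := 0) (b := t)
      (fun s _ => hder s) (Continuous.intervalIntegrable (by fun_prop) _ _)
    rw [dist_eq_norm, picardIterate_succ F z k, picardIterate_succ F z (k + 1),
      add_sub_add_left_eq_sub, ← intervalIntegral.integral_sub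
      ((hcont _).intervalIntegrable _ _) ((hcont _).intervalIntegrable _ _)]
    calc ‖∫ s in (0 : ℝ)..t, (F s (picardIterate F z k s) - F s (picardIterate F z (k + 1) s))‖
        ≤ ∫ s in (0 : ℝ)..t, K * (max C 0 * Real.exp (2 * K * s) * (1 / 2) ^ k) := by
          refine intervalIntegral.norm_integral_le_of_norm_le ht.1 (ae_of_all _ fun s hs => ?_)
            (Continuous.intervalIntegrable (by fun_prop) _ _)
          rw [← dist_eq_norm]
          refine ((hK s).dist_le_mul _ _).trans ?_
          gcongr
          exact ih s ⟨hs.1.le, hs.2.trans ht.2⟩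
      _ ≤ max C 0 * Real.exp (2 * K * t) * (1 / 2) ^ (k + 1) := by
          rw [hint]
          have : 0 ≤ max C 0 * (1 / 2) ^ (k + 1) * Real.exp (2 * K * 0) := by positivity
          linarith

/-- The limit of the Picard iterates; for `t < 0` it may be a junk value. -/
def picardLimit (F : ℝ → E → E) (z : E) (t : ℝ) : E :=
  @limUnder _ _ _ ⟨z⟩ atTop fun k => picardIterate F z k t

lemma tendsto_picardLimit (hF : Continuous (Function.uncurry F))
    (hK : ∀ t, LipschitzWith K (F t)) (z : E) {t : ℝ} (ht : 0 ≤ t) :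
    Tendsto (fun k => picardIterate F z k t) atTop (𝓝 (picardLimit F z t)) := by
  obtain ⟨C, hC⟩ := exists_picardIterate_dist_le hF hK z t
  exact (cauchySeq_of_le_geometric _ _ (by norm_num) (hC t ⟨ht, le_rfl⟩)).tendsto_limUnder

lemma exists_dist_picardLimit_le (hF : Continuous (Function.uncurry F))
    (hK : ∀ t, LipschitzWith K (F t)) (z : E) (T : ℝ) :
    ∃ C, ∀ t ∈ Icc 0 T, ∀ k, dist (picardIterate F z k t) (picardLimit F z t) ≤
      C * (1 / 2) ^ k := by
  obtain ⟨C, hC⟩ := exists_picardIterate_dist_le hF hK z T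
  have hC0 : ∀ t ∈ Icc 0 T, 0 ≤ C := fun t ht => by
    have := dist_nonneg.trans (hC t ht 0)
    rw [pow_zero, mul_one] at this
    exact nonneg_of_mul_nonneg_left this (Real.exp_pos _)
  refine ⟨C * Real.exp (2 * K * T) * 2, fun t ht k => ?_⟩
  have h0 := hC0 t ht
  have := dist_le_of_le_geometric_of_tendsto (1 / 2) _ (by norm_num) (hC t ht)
    (tendsto_picardLimit hF hK z ht.1) k
  refine this.trans ?_
  have h2 : Real.exp (2 * K * t) ≤ Real.exp (2 * K * T) :=
    Real.exp_le_exp.2 (mul_le_mul_of_nonneg_left ht.2 (by positivity))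
  calc C * Real.exp (2 * K * t) * (1 / 2) ^ k / (1 - 1 / 2)
      = C * Real.exp (2 * K * t) * 2 * (1 / 2) ^ k := by ring
    _ ≤ _ := by gcongr

lemma picardLimit_zero (hF : Continuous (Function.uncurry F)) (hK : ∀ t, LipschitzWith K (F t))
    (z : E) : picardLimit F z 0 = z := by
  refine tendsto_nhds_unique (tendsto_picardLimit hF hK z le_rfl) ?_
  have : ∀ k, picardIterate F z k 0 = z := fun k => by cases k <;> simp [picardIterate]
  simp_rw [this]
  exact tendsto_const_nhds

lemma continuousOn_picardLimit (hF : Continuous (Function.uncurry F))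
    (hK : ∀ t, LipschitzWith K (F t)) (z : E) : ContinuousOn (picardLimit F z) (Ici 0) := by
  have hIcc : ∀ T, ContinuousOn (picardLimit F z) (Icc 0 T) := by
    intro T
    obtain ⟨C, hC⟩ := exists_dist_picardLimit_le hF hK z T
    have hlim : Tendsto (fun k : ℕ => C * (1 / 2 : ℝ) ^ k) atTop (𝓝 0) := by
      simpa using (tendsto_pow_atTop_nhds_zero_of_lt_one (r := (1 / 2 : ℝ)) (by norm_num)
        (by norm_num)).const_mul C
    refine TendstoUniformlyOn.continuousOn (F := picardIterate F z) (p := atTop) ?_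
      (Frequently.of_forall fun k => (continuous_picardIterate hF z k).continuousOn)
    refine Metric.tendstoUniformlyOn_iff.2 fun e he => ?_
    filter_upwards [hlim.eventually (gt_mem_nhds he)] with k hk t ht
    rw [dist_comm]
    exact (hC t ht k).trans_lt hk
  intro t ht
  refine ((hIcc (t + 1)) t ⟨ht, by linarith⟩).mono_of_mem_nhdsWithin ?_
  rw [← Ici_inter_Iic]
  exact inter_mem_nhdsWithin _ (Iic_mem_nhds (by linarith))

lemma isForwardSolution_picardLimit (hF : Continuous (Function.uncurry F))
    (hK : ∀ t, LipschitzWith K (F t)) (z : E) : IsForwardSolution F (picardLimit F z) := by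
  have hc : ContinuousOn (fun s => F s (picardLimit F z s)) (Ici 0) :=
    hF.comp_continuousOn (continuousOn_id.prodMk (continuousOn_picardLimit hF hK z))
  refine fun t ht => hasDerivWithinAt_of_eq_add_integral (z := z) hc (fun t ht => ?_) ht
  obtain ⟨C, hC⟩ := exists_dist_picardLimit_le hF hK z t
  refine tendsto_nhds_unique ((tendsto_picardLimit hF hK z ht).comp (tendsto_add_atTop_nat 1)) ?_
  simp only [Function.comp_def, picardIterate]
  refine tendsto_const_nhds.add (tendsto_iff_dist_tendsto_zero.2 ?_)
  refine squeeze_zero (fun _ => dist_nonneg)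
    (g := fun k => K * (C * (1 / 2) ^ k) * |t - 0|) (fun k => ?_) ?_
  · have hk : Continuous fun s => F s (picardIterate F z k s) :=
      hF.comp (continuous_id.prodMk (continuous_picardIterate hF z k))
    rw [dist_eq_norm, ← intervalIntegral.integral_sub (hk.intervalIntegrable _ _)
      (ContinuousOn.intervalIntegrable_of_Icc ht (hc.mono fun s hs => hs.1))]
    refine intervalIntegral.norm_integral_le_of_norm_le_const fun s hs => ?_
    rw [uIoc_of_le ht] at hs
    rw [← dist_eq_norm]
    refine ((hK s).dist_le_mul _ _).trans ?_
    gcongr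
    exact hC s ⟨hs.1.le, hs.2⟩ k
  · have := ((tendsto_pow_atTop_nhds_zero_of_lt_one (r := (1 / 2 : ℝ)) (by norm_num)
      (by norm_num)).const_mul C).const_mul (K : ℝ) |>.mul_const |t - 0|
    simpa using this

variable {Ω : Type*} [MeasurableSpace Ω] [MeasurableSpace E] [BorelSpace E]
  [SecondCountableTopology E]

omit [CompleteSpace E] in
lemma measurable_picardIterate {F : Ω → ℝ → E → E}
    (hF : Measurable fun q : Ω × ℝ × E => F q.1 q.2.1 q.2.2) (k : ℕ) :
    Measurable fun q : ℝ × Ω × E => picardIterate (F q.2.1) q.2.2 k q.1 := by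
  induction k with
  | zero => exact measurable_snd.snd
  | succ k ih =>
    -- The substitution `s = t r` makes the domain of integration independent of `t`.
    have heq : (fun q : ℝ × Ω × E => picardIterate (F q.2.1) q.2.2 (k + 1) q.1) = fun q =>
        q.2.2 + q.1 • ∫ r in Ioc (0 : ℝ) 1,
          F q.2.1 (q.1 * r) (picardIterate (F q.2.1) q.2.2 k (q.1 * r)) := by
      funext q
      have := intervalIntegral.smul_integral_comp_mul_left (a := 0) (b := 1)
        (fun s => F q.2.1 s (picardIterate (F q.2.1) q.2.2 k s)) q.1
      rw [mul_zero, mul_one] at this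
      rw [← intervalIntegral.integral_of_le zero_le_one, this]
      rfl
    rw [heq]
    have hm : Measurable fun p : (ℝ × Ω × E) × ℝ =>
        F p.1.2.1 (p.1.1 * p.2) (picardIterate (F p.1.2.1) p.1.2.2 k (p.1.1 * p.2)) := by
      have ht : Measurable fun p : (ℝ × Ω × E) × ℝ => p.1.1 * p.2 := by fun_prop
      exact hF.comp (measurable_fst.snd.fst.prodMk (ht.prodMk (ih.comp
        (ht.prodMk measurable_fst.snd))))
    exact measurable_snd.snd.add (measurable_fst.smul
      (hm.stronglyMeasurable.integral_prod_right'
        (ν := volume.restrict (Ioc (0 : ℝ) 1))).measurable)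

lemma measurable_picardLimit {F : Ω → ℝ → E → E}
    (hFm : Measurable fun q : Ω × ℝ × E => F q.1 q.2.1 q.2.2)
    (hF : ∀ ω, Continuous (Function.uncurry (F ω))) (hK : ∀ ω t, LipschitzWith K (F ω t)) :
    Measurable fun q : ℝ≥0 × Ω × E => picardLimit (F q.2.1) q.2.2 q.1 :=
  measurable_of_tendsto_metrizable
    (f := fun k (q : ℝ≥0 × Ω × E) => picardIterate (F q.2.1) q.2.2 k q.1)
    (fun k => (measurable_picardIterate hFm k).comp
      ((measurable_coe_nnreal_real.comp measurable_fst).prodMk measurable_snd))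
    (tendsto_pi_nhds.2 fun q => tendsto_picardLimit (hF q.2.1) (hK q.2.1) q.2.2 q.1.2)

end ODE

/-! ### The random dynamical systems generated by the two equations -/

/-- A solution is one in each of two complementary sets of coordinates. -/
lemma isForwardSolution_iff_of_coordinates {E E₁ E₂ : Type*} [NormedAddCommGroup E]
    [NormedSpace ℝ E] [NormedAddCommGroup E₁] [NormedSpace ℝ E₁] [NormedAddCommGroup E₂]
    [NormedSpace ℝ E₂] (p : E →L[ℝ] E₁) (q : E →L[ℝ] E₂) (r : E₁ × E₂ →L[ℝ] E)
    (hr : ∀ z, r (p z, q z) = z) {F : ℝ → E → E} {u : ℝ → E} :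
    IsForwardSolution F u ↔ ∀ t, 0 ≤ t →
      HasDerivWithinAt (fun s => p (u s)) (p (F t (u t))) (Ici 0) t ∧
      HasDerivWithinAt (fun s => q (u s)) (q (F t (u t))) (Ici 0) t := by
  refine forall₂_congr fun t _ => ⟨fun h => ⟨?_, ?_⟩, fun h => ?_⟩
  · exact p.hasFDerivAt.comp_hasDerivWithinAt t h
  · exact q.hasFDerivAt.comp_hasDerivWithinAt t h
  · have := (r.hasFDerivAt (x := (p (u t), q (u t)))).comp_hasDerivWithinAt t (h.1.prodMk h.2)
    simpa only [Function.comp_def, hr] using this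

section Noise

variable {E Y Ω : Type*} [NormedAddCommGroup E] [NormedSpace ℝ E] [TopologicalSpace Y]
  {K : ℝ≥0}

omit [NormedSpace ℝ E] in
lemma _root_.LipschitzWith.comp_add_const {G : E → E} (hG : LipschitzWith K G) (c : E) :
    LipschitzWith K fun z => G (z + c) :=
  LipschitzWith.of_dist_le_mul fun z w => by simpa using hG.dist_le_mul (z + c) (w + c)

omit [NormedSpace ℝ E] in
lemma continuous_uncurry_comp_add {G : E → E} (hG : Continuous G) {κ : ℝ → E}
    (hκ : Continuous κ) : Continuous (Function.uncurry fun s z => G (z + κ s)) :=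
  hG.comp (continuous_snd.add (hκ.comp continuous_fst))

variable [CompleteSpace E]

lemma continuous_picardLimit {F : ℝ → E → E} (hF : Continuous (Function.uncurry F))
    (hK : ∀ t, LipschitzWith K (F t)) {t : ℝ} (ht : 0 ≤ t) :
    Continuous fun z => picardLimit F z t := by
  refine LipschitzWith.continuous (K := ⟨Real.exp (K * t), (Real.exp_pos _).le⟩) ?_
  refine LipschitzWith.of_dist_le_mul fun z w => ?_
  have := (isForwardSolution_picardLimit hF hK z).dist_le hK
    (isForwardSolution_picardLimit hF hK w) ht
  rwa [picardLimit_zero hF hK, picardLimit_zero hF hK, mul_comm] at this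

variable [MeasurableSpace Ω] [MeasurableSpace E] [BorelSpace E] [SecondCountableTopology E]

lemma measurable_picardLimit_comp [MeasurableSpace Y] [BorelSpace Y] [SecondCountableTopology Y]
    {G : Y → E → E} (hG : Continuous fun q : Y × E => G q.1 q.2)
    (hK : ∀ y, LipschitzWith K (G y)) {ζ : Ω → ℝ → Y}
    (hζm : Measurable fun q : Ω × ℝ => ζ q.1 q.2) (hζ : ∀ ω, Continuous (ζ ω)) :
    Measurable fun q : ℝ≥0 × Ω × E => picardLimit (fun s => G (ζ q.2.1 s)) q.2.2 q.1 :=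
  measurable_picardLimit (F := fun ω s => G (ζ ω s))
    (hG.measurable.comp ((hζm.comp (measurable_fst.prodMk measurable_snd.fst)).prodMk
      measurable_snd.snd))
    (fun ω => hG.comp (((hζ ω).comp continuous_fst).prodMk continuous_snd)) fun _ _ => hK _

lemma measurable_picardLimit_add {G : E → E} (hG : Continuous G) (hK : LipschitzWith K G)
    {κ : Ω → ℝ → E} (hκm : Measurable fun q : Ω × ℝ => κ q.1 q.2) (hκ : ∀ ω, Continuous (κ ω)) :
    Measurable fun q : ℝ≥0 × Ω × E =>
      picardLimit (fun s z => G (z + κ q.2.1 s)) q.2.2 q.1 + κ q.2.1 q.1 := by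
  refine Measurable.add (measurable_picardLimit (F := fun ω s z => G (z + κ ω s)) ?_
    (fun ω => continuous_uncurry_comp_add hG (hκ ω)) fun _ _ => hK.comp_add_const _) ?_
  · exact hG.measurable.comp
      (measurable_snd.snd.add (hκm.comp (measurable_fst.prodMk measurable_snd.fst)))
  · exact hκm.comp (measurable_snd.fst.prodMk (measurable_coe_nnreal_real.comp measurable_fst))

end Noise

section State

variable {n m : ℕ}

@[simp] lemma pt_fst (x : Eu n) (y : Eu m) : (pt x y).fst = x := rfl

@[simp] lemma pt_snd (x : Eu n) (y : Eu m) : (pt x y).snd = y := rfl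

lemma pt_fst_snd (z : State n m) : pt z.fst z.snd = z := rfl

lemma State.ext {z w : State n m} (h1 : z.fst = w.fst) (h2 : z.snd = w.snd) : z = w := by
  rw [← pt_fst_snd z, ← pt_fst_snd w, h1, h2]

lemma norm_state (z : State n m) : ‖z‖ = ‖z.fst‖ + ‖z.snd‖ := WithLp.prod_norm_eq_of_L1 z

lemma norm_fst_le (z : State n m) : ‖z.fst‖ ≤ ‖z‖ := by
  rw [norm_state]; linarith [norm_nonneg z.snd]

lemma norm_snd_le (z : State n m) : ‖z.snd‖ ≤ ‖z‖ := by
  rw [norm_state]; linarith [norm_nonneg z.fst]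

/-- The projection to the slow variable. -/
def fstCLM (n m : ℕ) : State n m →L[ℝ] Eu n :=
  LinearMap.mkContinuous
    { toFun := fun z => z.fst, map_add' := fun _ _ => rfl, map_smul' := fun _ _ => rfl } 1
    fun z => by rw [one_mul]; exact norm_fst_le z

/-- The projection to the fast variable. -/
def sndCLM (n m : ℕ) : State n m →L[ℝ] Eu m :=
  LinearMap.mkContinuous
    { toFun := fun z => z.snd, map_add' := fun _ _ => rfl, map_smul' := fun _ _ => rfl } 1
    fun z => by rw [one_mul]; exact norm_snd_le z

/-- The map `(x, y) ↦ pt x y`. -/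
def ptCLM (n m : ℕ) : Eu n × Eu m →L[ℝ] State n m :=
  LinearMap.mkContinuous
    { toFun := fun p => pt p.1 p.2, map_add' := fun _ _ => rfl, map_smul' := fun _ _ => rfl } 2
    fun p => by
      have h := norm_state (pt p.1 p.2)
      have h1 := _root_.norm_fst_le p
      have h2 := _root_.norm_snd_le p
      simp only [pt_fst, pt_snd] at h
      change ‖pt p.1 p.2‖ ≤ _
      linarith

lemma continuous_fst_state : Continuous fun z : State n m => z.fst := (fstCLM n m).continuous

lemma continuous_snd_state : Continuous fun z : State n m => z.snd := (sndCLM n m).continuous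

lemma continuous_pt : Continuous fun p : Eu n × Eu m => pt p.1 p.2 := (ptCLM n m).continuous

lemma fst_intervalIntegral {w : ℝ → State n m} {a b : ℝ} (hw : IntervalIntegrable w volume a b) :
    (∫ s in a..b, w s).fst = ∫ s in a..b, (w s).fst :=
  ((fstCLM n m).intervalIntegral_comp_comm hw).symm

lemma snd_intervalIntegral {w : ℝ → State n m} {a b : ℝ} (hw : IntervalIntegrable w volume a b) :
    (∫ s in a..b, w s).snd = ∫ s in a..b, (w s).snd :=
  ((sndCLM n m).intervalIntegral_comp_comm hw).symm

end State

section Field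

variable {n m : ℕ} (A : Eu n →L[ℝ] Eu n) (B : Eu m →L[ℝ] Eu m)
  (f : Eu n → Eu m → Eu n) (g : Eu n → Eu m → Eu m) (ε : ℝ)

/-- The vector field of the random system, at the value `y` of the noise. -/
def field (y : Eu m) (z : State n m) : State n m :=
  pt (A z.fst + f z.fst (z.snd + y)) (ε⁻¹ • (B z.snd + g z.fst (z.snd + y)))

variable {A B f g ε}

lemma continuous_uncurry_of_lipschitz {p : ℕ} {k : Eu n → Eu m → Eu p} {L : ℝ}
    (hk : ∀ x x' y y', ‖k x y - k x' y'‖ ≤ L * (‖x - x'‖ + ‖y - y'‖)) :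
    Continuous fun q : Eu n × Eu m => k q.1 q.2 := by
  refine continuous_iff_continuousAt.2 fun q => tendsto_iff_norm_sub_tendsto_zero.2 ?_
  refine squeeze_zero (fun _ => norm_nonneg _) (fun r => hk r.1 q.1 r.2 q.2) ?_
  have : Continuous fun r : Eu n × Eu m => L * (‖r.1 - q.1‖ + ‖r.2 - q.2‖) := by fun_prop
  simpa using this.tendsto q

lemma continuous_field (hf : Continuous fun q : Eu n × Eu m => f q.1 q.2)
    (hg : Continuous fun q : Eu n × Eu m => g q.1 q.2) :
    Continuous fun q : Eu m × State n m => field A B f g ε q.1 q.2 := by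
  have h1 : Continuous fun q : Eu m × State n m => q.2.fst :=
    continuous_fst_state.comp continuous_snd
  have h2 : Continuous fun q : Eu m × State n m => q.2.snd :=
    continuous_snd_state.comp continuous_snd
  have h3 := h1.prodMk (h2.add continuous_fst)
  exact continuous_pt.comp (((A.continuous.comp h1).add (hf.comp h3)).prodMk
    (((B.continuous.comp h2).add (hg.comp h3)).const_smul ε⁻¹))

lemma continuous_field_zero (hf : Continuous fun q : Eu n × Eu m => f q.1 q.2)
    (hg : Continuous fun q : Eu n × Eu m => g q.1 q.2) : Continuous (field A B f g ε 0) :=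
  (continuous_field hf hg).comp (continuous_const.prodMk continuous_id)

lemma exists_lipschitzWith_field {Lf Lg : ℝ} (hLf : 0 ≤ Lf)
    (hf : ∀ x x' y y', ‖f x y - f x' y'‖ ≤ Lf * (‖x - x'‖ + ‖y - y'‖)) (hLg : 0 ≤ Lg)
    (hg : ∀ x x' y y', ‖g x y - g x' y'‖ ≤ Lg * (‖x - x'‖ + ‖y - y'‖)) :
    ∃ K : ℝ≥0, ∀ y, LipschitzWith K (field A B f g ε y) := by
  refine ⟨⟨(‖A‖ + Lf) + |ε⁻¹| * (‖B‖ + Lg), by positivity⟩, fun y => ?_⟩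
  refine LipschitzWith.of_dist_le_mul fun z w => ?_
  rw [dist_eq_norm, dist_eq_norm, norm_state]
  have hz : ‖z - w‖ = ‖z.fst - w.fst‖ + ‖z.snd - w.snd‖ := norm_state (z - w)
  have h1 : ‖A z.fst + f z.fst (z.snd + y) - (A w.fst + f w.fst (w.snd + y))‖ ≤
      (‖A‖ + Lf) * ‖z - w‖ := by
    rw [add_sub_add_comm, ← map_sub, add_mul]
    refine (norm_add_le _ _).trans (add_le_add ?_ ?_)
    · exact (A.le_opNorm _).trans (by gcongr; exact norm_fst_le (z - w))
    · have := hf z.fst w.fst (z.snd + y) (w.snd + y)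
      rwa [add_sub_add_right_eq_sub, ← hz] at this
  have h2 : ‖ε⁻¹ • (B z.snd + g z.fst (z.snd + y)) - ε⁻¹ • (B w.snd + g w.fst (w.snd + y))‖ ≤
      |ε⁻¹| * (‖B‖ + Lg) * ‖z - w‖ := by
    rw [← smul_sub, norm_smul, Real.norm_eq_abs, mul_assoc]
    gcongr
    rw [add_sub_add_comm, ← map_sub, add_mul]
    refine (norm_add_le _ _).trans (add_le_add ?_ ?_)
    · exact (B.le_opNorm _).trans (by gcongr; exact norm_snd_le (z - w))
    · have := hg z.fst w.fst (z.snd + y) (w.snd + y)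
      rwa [add_sub_add_right_eq_sub, ← hz] at this
  calc _ ≤ (‖A‖ + Lf) * ‖z - w‖ + |ε⁻¹| * (‖B‖ + Lg) * ‖z - w‖ := add_le_add h1 h2
    _ = ((‖A‖ + Lf) + |ε⁻¹| * (‖B‖ + Lg)) * ‖z - w‖ := by ring

lemma solvesRandomSystem_iff {ζ : ℝ → Eu m} {u : ℝ → State n m} :
    SolvesRandomSystem A B f g ε ζ u ↔ IsForwardSolution (fun t => field A B f g ε (ζ t)) u :=
  (isForwardSolution_iff_of_coordinates (fstCLM n m) (sndCLM n m) (ptCLM n m) pt_fst_snd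
    (F := fun t => field A B f g ε (ζ t)) (u := u)).symm

lemma solvesStochasticSystem_iff {σ : ℝ} (hf : Continuous fun q : Eu n × Eu m => f q.1 q.2)
    (hg : Continuous fun q : Eu n × Eu m => g q.1 q.2) {w : ℝ → Eu m} {u : ℝ → State n m} :
    SolvesStochasticSystem A B f g σ ε w u ↔ ContinuousOn u (Ici 0) ∧ ∀ t, 0 ≤ t →
      u t = u 0 + (∫ s in (0 : ℝ)..t, field A B f g ε 0 (u s)) +
        pt 0 ((σ / Real.sqrt ε) • w t) := by
  refine and_congr_right fun hu => forall₂_congr fun t ht => ?_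
  have hint : IntervalIntegrable (fun s => field A B f g ε 0 (u s)) volume 0 t :=
    ContinuousOn.intervalIntegrable_of_Icc ht
      (((continuous_field_zero hf hg).comp_continuousOn hu).mono fun s hs => hs.1)
  have h1 := fst_intervalIntegral hint
  have h2 := snd_intervalIntegral hint
  simp only [field, pt_fst, pt_snd, add_zero] at h1 h2
  rw [← h1, ← h2]
  constructor
  · rintro ⟨e1, e2⟩
    refine State.ext (e1.trans ?_) (e2.trans ?_)
    · simp [field]
    · simp [field]
  · intro e
    refine ⟨(congrArg (fun z : State n m => z.fst) e).trans ?_,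
      (congrArg (fun z : State n m => z.snd) e).trans ?_⟩
    · simp [field]
    · simp [field]

/-- Subtracting the noise turns the stochastic system into an ordinary differential equation. -/
lemma solvesStochasticSystem_iff_isForwardSolution {σ : ℝ}
    (hf : Continuous fun q : Eu n × Eu m => f q.1 q.2)
    (hg : Continuous fun q : Eu n × Eu m => g q.1 q.2) {w : ℝ → Eu m} (hw : Continuous w)
    (hw0 : w 0 = 0) {u : ℝ → State n m} :
    SolvesStochasticSystem A B f g σ ε w u ↔
      IsForwardSolution (fun t z => field A B f g ε 0 (z + pt 0 ((σ / Real.sqrt ε) • w t)))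
        fun t => u t - pt 0 ((σ / Real.sqrt ε) • w t) := by
  have hk : Continuous fun t => (pt 0 ((σ / Real.sqrt ε) • w t) : State n m) :=
    continuous_pt.comp (continuous_const.prodMk (hw.const_smul (σ / Real.sqrt ε)))
  have hk0 : (pt 0 ((σ / Real.sqrt ε) • w 0) : State n m) = 0 := by
    rw [hw0, smul_zero]; rfl
  have hG : Continuous (field A B f g ε 0) := continuous_field_zero hf hg
  rw [solvesStochasticSystem_iff hf hg]
  constructor
  · rintro ⟨hu, h⟩ t ht
    refine hasDerivWithinAt_of_eq_add_integral (z := u 0)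
      (w := fun s => field A B f g ε 0 (u s - pt 0 ((σ / Real.sqrt ε) • w s) +
        pt 0 ((σ / Real.sqrt ε) • w s))) ?_ (fun t ht => ?_) ht
    · simp only [sub_add_cancel]
      exact hG.comp_continuousOn hu
    · simp only [sub_add_cancel]
      rw [h t ht]
      abel
  · intro h
    have hu : ContinuousOn u (Ici 0) := by
      exact (h.continuousOn.add hk.continuousOn).congr fun t _ => (sub_add_cancel _ _).symm
    refine ⟨hu, fun t ht => ?_⟩
    have hF : Continuous (Function.uncurry fun (t : ℝ) (z : State n m) =>
        field A B f g ε 0 (z + pt 0 ((σ / Real.sqrt ε) • w t))) :=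
      hG.comp (continuous_snd.add (hk.comp continuous_fst))
    have := h.eq_add_integral hF ht
    simp only [sub_add_cancel, hk0, sub_zero] at this
    rw [← this]
    abel

end Field

section SolutionMap

variable {n m : ℕ} {Ω : Type*} {Sol : Ω → (ℝ → State n m) → Prop}
  {φ : ℝ≥0 → Ω → State n m → State n m}

/-- Uniqueness of solutions gives the cocycle property. -/
lemma IsSolutionMap.cocycle (hφ : IsSolutionMap Sol φ) {θ : ℝ → Ω → Ω}
    (hshift : ∀ ω u (τ : ℝ), 0 ≤ τ → Sol ω u → Sol (θ τ ω) fun s => u (s + τ))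
    (t τ : ℝ≥0) (ω : Ω) (x : State n m) : φ t (θ τ ω) (φ τ ω x) = φ (t + τ) ω x := by
  have h := (hφ (θ τ ω) (φ τ ω x)).2.2 _ (hshift ω _ τ τ.2 (hφ ω x).2.1) (by simp) t
  rw [← h]
  simp [← NNReal.coe_add]

lemma solvesRandomSystem_shift {A : Eu n →L[ℝ] Eu n} {B : Eu m →L[ℝ] Eu m}
    {f : Eu n → Eu m → Eu n} {g : Eu n → Eu m → Eu m} {ε : ℝ} {ζ : ℝ → Eu m}
    {u : ℝ → State n m} {τ : ℝ} (hτ : 0 ≤ τ) (hu : SolvesRandomSystem A B f g ε ζ u) :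
    SolvesRandomSystem A B f g ε (fun s => ζ (s + τ)) fun s => u (s + τ) := by
  rw [solvesRandomSystem_iff] at hu ⊢
  intro t ht
  have h1 := hu (t + τ) (by positivity)
  have h2 : HasDerivWithinAt (fun s : ℝ => s + τ) 1 (Ici 0) t :=
    ((hasDerivAt_id t).add_const τ).hasDerivWithinAt
  have := h1.scomp t h2 fun s hs => add_nonneg (mem_Ici.1 hs) hτ
  rwa [one_smul] at this

/-- The shift of the path, `ω(· + τ) - ω(τ)`, is the one that the integral equation restarted at
time `τ` calls for. -/
lemma solvesStochasticSystem_shift {A : Eu n →L[ℝ] Eu n} {B : Eu m →L[ℝ] Eu m}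
    {f : Eu n → Eu m → Eu n} {g : Eu n → Eu m → Eu m} {σ ε : ℝ}
    (hf : Continuous fun q : Eu n × Eu m => f q.1 q.2)
    (hg : Continuous fun q : Eu n × Eu m => g q.1 q.2) {ω : PathSpace m}
    {u : ℝ → State n m} {τ : ℝ} (hτ : 0 ≤ τ)
    (hu : SolvesStochasticSystem A B f g σ ε (fun t => ω t) u) :
    SolvesStochasticSystem A B f g σ ε (fun t => shift τ ω t) fun s => u (s + τ) := by
  rw [solvesStochasticSystem_iff hf hg] at hu ⊢
  obtain ⟨hc, h⟩ := hu
  have hcont : ContinuousOn (fun s => field A B f g ε 0 (u s)) (Ici 0) :=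
    (continuous_field_zero hf hg).comp_continuousOn hc
  have hint : ∀ a b : ℝ, 0 ≤ a → 0 ≤ b →
      IntervalIntegrable (fun s => field A B f g ε 0 (u s)) volume a b := fun a b ha hb =>
    ContinuousOn.intervalIntegrable (hcont.mono fun s hs => (le_min ha hb).trans hs.1)
  have hadd : ContinuousOn (fun s : ℝ => s + τ) (Ici 0) := by fun_prop
  have hmaps : MapsTo (fun s : ℝ => s + τ) (Ici 0) (Ici 0) := fun s hs =>
    add_nonneg (mem_Ici.1 hs) hτ
  refine ⟨ContinuousOn.comp (g := u) hc hadd hmaps, fun t ht => ?_⟩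
  have hsplit := intervalIntegral.integral_add_adjacent_intervals (hint 0 τ le_rfl hτ)
    (hint τ (t + τ) hτ (by positivity))
  have hpt : (pt 0 ((σ / Real.sqrt ε) • shift τ ω t) : State n m) =
      pt 0 ((σ / Real.sqrt ε) • ω (t + τ)) - pt 0 ((σ / Real.sqrt ε) • ω τ) :=
    State.ext (by simp) (by simp [smul_sub])
  rw [intervalIntegral.integral_comp_add_right (fun s => field A B f g ε 0 (u s)), zero_add, hpt,
    h (t + τ) (by positivity), h τ hτ, ← hsplit]
  abel

end SolutionMap

section Systems

variable {n m : ℕ} (A : Eu n →L[ℝ] Eu n) (B : Eu m →L[ℝ] Eu m)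
  (f : Eu n → Eu m → Eu n) (g : Eu n → Eu m → Eu m) (σ ε : ℝ)

/-- The solution map of the random system. -/
def randomFlow (t : ℝ≥0) (ω : PathSpace m) (z : State n m) : State n m :=
  picardLimit (fun s => field A B f g ε (eta B σ ε (shift s ω))) z t

/-- The solution map of the stochastic system, obtained after subtracting the noise. -/
def stochasticFlow (t : ℝ≥0) (ω : PathSpace m) (z : State n m) : State n m :=
  picardLimit (fun s z => field A B f g ε 0 (z + pt 0 ((σ / Real.sqrt ε) • ω s))) z t +
    pt 0 ((σ / Real.sqrt ε) • ω t)

variable {A B f g σ ε}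

lemma IsForwardSolution.congr {E : Type*} [NormedAddCommGroup E] [NormedSpace ℝ E]
    {F : ℝ → E → E} {v w : ℝ → E} (hv : IsForwardSolution F v) (h : ∀ t, 0 ≤ t → w t = v t) :
    IsForwardSolution F w := by
  intro t ht
  rw [h t ht]
  exact (hv t ht).congr (fun s hs => h s hs) (h t ht)

lemma isSolutionMap_randomFlow (hf : Continuous fun q : Eu n × Eu m => f q.1 q.2)
    (hg : Continuous fun q : Eu n × Eu m => g q.1 q.2)
    {K : ℝ≥0} (hK : ∀ y, LipschitzWith K (field A B f g ε y))
    (hη : ∀ ω, Continuous fun t => eta B σ ε (shift t ω)) :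
    IsSolutionMap (fun ω => SolvesRandomSystem A B f g ε fun t => eta B σ ε (shift t ω))
      (randomFlow A B f g σ ε) := by
  intro ω z
  have hF : Continuous (Function.uncurry fun s => field A B f g ε (eta B σ ε (shift s ω))) :=
    (continuous_field hf hg).comp (((hη ω).comp continuous_fst).prodMk continuous_snd)
  have hsol := isForwardSolution_picardLimit hF (fun s => hK _) z
  have h0 := picardLimit_zero hF (fun s => hK _) z
  refine ⟨h0, ?_, fun u hu hu0 t => ?_⟩
  · refine solvesRandomSystem_iff.2 ?_
    exact hsol.congr fun t ht => by simp [randomFlow, Real.coe_toNNReal t ht]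
  · replace hu := solvesRandomSystem_iff.1 hu
    exact hu.eq (fun s => hK _) hsol (hu0.trans h0.symm) t.2

lemma isContinuousRDS_randomFlow {P : Measure (PathSpace m)} (hP : IsWienerMeasure P)
    (hf : Continuous fun q : Eu n × Eu m => f q.1 q.2)
    (hg : Continuous fun q : Eu n × Eu m => g q.1 q.2)
    {K : ℝ≥0} (hK : ∀ y, LipschitzWith K (field A B f g ε y))
    (hη : ∀ ω, Continuous fun t => eta B σ ε (shift t ω)) :
    IsContinuousRDS P shift (randomFlow A B f g σ ε) := by
  have hmap := isSolutionMap_randomFlow hf hg hK hη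
  have hF : ∀ ω, Continuous (Function.uncurry fun s =>
      field A B f g ε (eta B σ ε (shift s ω))) := fun ω =>
    (continuous_field hf hg).comp (((hη ω).comp continuous_fst).prodMk continuous_snd)
  refine ⟨hP.isMetricDynamicalSystem, ?_, fun ω x => (hmap ω x).1,
    hmap.cocycle fun ω u τ hτ hu => ?_, fun t ω =>
      continuous_picardLimit (hF ω) (fun s => hK _) t.2⟩
  · have h := continuous_field (A := A) (B := B) (ε := ε) hf hg
    have := measurable_picardLimit_comp (G := field A B f g ε)
      (ζ := fun ω s => eta B σ ε (shift s ω)) h hK (measurable_eta_shift B σ ε) hη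
    exact this
  · have := solvesRandomSystem_shift hτ hu
    simpa only [shift_shift] using this

lemma continuous_noise (σ ε : ℝ) (ω : PathSpace m) :
    Continuous fun s => (pt 0 ((σ / Real.sqrt ε) • ω s) : State n m) :=
  continuous_pt.comp (continuous_const.prodMk (ω.continuous.const_smul (σ / Real.sqrt ε)))

lemma measurable_noise (σ ε : ℝ) : Measurable fun q : PathSpace m × ℝ =>
    (pt 0 ((σ / Real.sqrt ε) • q.1 q.2) : State n m) :=
  continuous_pt.measurable.comp (measurable_const.prodMk
    ((measurable_eval_uncurry.comp measurable_swap).const_smul (σ / Real.sqrt ε)))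

lemma isSolutionMap_stochasticFlow (hf : Continuous fun q : Eu n × Eu m => f q.1 q.2)
    (hg : Continuous fun q : Eu n × Eu m => g q.1 q.2)
    {K : ℝ≥0} (hK : ∀ y, LipschitzWith K (field A B f g ε y)) :
    IsSolutionMap (fun ω => SolvesStochasticSystem A B f g σ ε fun t => ω t)
      (stochasticFlow A B f g σ ε) := by
  intro ω z
  have hF := continuous_uncurry_comp_add (continuous_field_zero (A := A) (B := B) (ε := ε) hf hg)
    (continuous_noise σ ε ω)
  have hL := fun s => (hK 0).comp_add_const (pt 0 ((σ / Real.sqrt ε) • ω s))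
  have hsol := isForwardSolution_picardLimit hF hL z
  have h0 := picardLimit_zero hF hL z
  have hk0 : (pt 0 ((σ / Real.sqrt ε) • ω 0) : State n m) = 0 := by
    rw [PathSpace.apply_zero, smul_zero]; rfl
  refine ⟨?_, ?_, fun u hu hu0 t => ?_⟩
  · rw [stochasticFlow, NNReal.coe_zero, h0, hk0, add_zero]
  · refine (solvesStochasticSystem_iff_isForwardSolution hf hg ω.continuous ω.apply_zero).2 ?_
    exact hsol.congr fun t ht => by simp [stochasticFlow, Real.coe_toNNReal t ht]
  · replace hu :=
      (solvesStochasticSystem_iff_isForwardSolution hf hg ω.continuous ω.apply_zero).1 hu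
    rw [stochasticFlow, ← sub_eq_iff_eq_add]
    exact hu.eq hL hsol (by simp only [hk0, sub_zero, hu0, h0]) t.2

lemma isContinuousRDS_stochasticFlow {P : Measure (PathSpace m)} (hP : IsWienerMeasure P)
    (hf : Continuous fun q : Eu n × Eu m => f q.1 q.2)
    (hg : Continuous fun q : Eu n × Eu m => g q.1 q.2)
    {K : ℝ≥0} (hK : ∀ y, LipschitzWith K (field A B f g ε y)) :
    IsContinuousRDS P shift (stochasticFlow A B f g σ ε) := by
  have hmap := isSolutionMap_stochasticFlow (σ := σ) hf hg hK
  have hG := continuous_field_zero (A := A) (B := B) (ε := ε) hf hg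
  refine ⟨hP.isMetricDynamicalSystem, ?_, fun ω x => (hmap ω x).1,
    hmap.cocycle fun ω u τ hτ hu => solvesStochasticSystem_shift hf hg hτ hu, fun t ω => ?_⟩
  · have := measurable_picardLimit_add (G := field A B f g ε 0)
      (κ := fun (ω : PathSpace m) s => pt 0 ((σ / Real.sqrt ε) • ω s)) hG (hK 0)
      (measurable_noise σ ε) (continuous_noise σ ε)
    exact this
  · exact (continuous_picardLimit (continuous_uncurry_comp_add hG (continuous_noise σ ε ω))
      (fun s => (hK 0).comp_add_const _) t.2).add continuous_const

/-- Adding a solution of the linear stochastic equation to a solution of the random system gives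
a solution of the stochastic system. -/
lemma SolvesRandomSystem.add_noise (hf : Continuous fun q : Eu n × Eu m => f q.1 q.2)
    (hg : Continuous fun q : Eu n × Eu m => g q.1 q.2) {ζ w : ℝ → Eu m} (hζ : Continuous ζ)
    (hζw : ∀ t, ζ t = ζ 0 + (∫ s in (0 : ℝ)..t, ε⁻¹ • B (ζ s)) + (σ / Real.sqrt ε) • w t)
    {u : ℝ → State n m} (hu : SolvesRandomSystem A B f g ε ζ u) :
    SolvesStochasticSystem A B f g σ ε w fun t => u t + pt 0 (ζ t) := by
  rw [solvesRandomSystem_iff] at hu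
  have hF : Continuous (Function.uncurry fun s => field A B f g ε (ζ s)) :=
    (continuous_field hf hg).comp ((hζ.comp continuous_fst).prodMk continuous_snd)
  have hζ' : Continuous fun t => (pt 0 (ζ t) : State n m) :=
    continuous_pt.comp (continuous_const.prodMk hζ)
  have hB : Continuous fun s => (pt 0 (ε⁻¹ • B (ζ s)) : State n m) :=
    continuous_pt.comp (continuous_const.prodMk ((B.continuous.comp hζ).const_smul ε⁻¹))
  -- Both nonlinearities are evaluated at the same point; the fields differ by the linear term.
  have hpt : ∀ s, field A B f g ε 0 (u s + pt 0 (ζ s)) =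
      field A B f g ε (ζ s) (u s) + pt 0 (ε⁻¹ • B (ζ s)) := fun s =>
    State.ext (by simp [field]) (by simp [field, smul_add]; abel)
  rw [solvesStochasticSystem_iff hf hg]
  refine ⟨hu.continuousOn.add hζ'.continuousOn, fun t ht => ?_⟩
  have hFi : IntervalIntegrable (fun s => field A B f g ε (ζ s) (u s)) volume 0 t :=
    ContinuousOn.intervalIntegrable_of_Icc ht
      ((hF.comp_continuousOn (continuousOn_id.prodMk hu.continuousOn)).mono fun s hs => hs.1)
  have hBi := hB.intervalIntegrable (μ := volume) 0 t
  have hBint : (∫ s in (0 : ℝ)..t, (pt 0 (ε⁻¹ • B (ζ s)) : State n m)) =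
      pt 0 (∫ s in (0 : ℝ)..t, ε⁻¹ • B (ζ s)) :=
    State.ext (by simp [fst_intervalIntegral hBi]) (by simp [snd_intervalIntegral hBi])
  simp_rw [hpt]
  rw [intervalIntegral.integral_add hFi hBi, hBint, hu.eq_add_integral hF ht]
  have hz : (pt 0 (ζ t) : State n m) = pt 0 (ζ 0) + pt 0 (∫ s in (0 : ℝ)..t, ε⁻¹ • B (ζ s)) +
      pt 0 ((σ / Real.sqrt ε) • w t) :=
    State.ext (by simp) (by simpa using hζw t)
  rw [hz]
  abel

end Systems

/-! ### Mild solutions and weighted estimates -/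

section Mild

variable {E : Type*} [NormedAddCommGroup E] [NormedSpace ℝ E] [CompleteSpace E] (D : E →L[ℝ] E)

/-- The mild solution `e^{tD} (z + ∫_0^t e^{-sD} p(s) ds)` of `v' = D v + p`, `v(0) = z`. -/
def mild (z : E) (p : ℝ → E) (t : ℝ) : E :=
  NormedSpace.exp (t • D) (z + ∫ s in (0 : ℝ)..t, NormedSpace.exp ((-s) • D) (p s))

lemma exp_sub_smul_apply (t s : ℝ) (x : E) : NormedSpace.exp ((t - s) • D) x =
    NormedSpace.exp (t • D) (NormedSpace.exp ((-s) • D) x) := by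
  rw [sub_eq_add_neg, exp_add_smul_apply]

variable {D}

lemma continuous_exp_neg_smul {p : ℝ → E} (hp : Continuous p) :
    Continuous fun s : ℝ => NormedSpace.exp ((-s) • D) (p s) :=
  continuous_neg.exp_smul_apply D hp

lemma intervalIntegral_exp_sub_smul {p : ℝ → E} {a b t : ℝ}
    (hp : IntervalIntegrable (fun s : ℝ => NormedSpace.exp ((-s) • D) (p s)) volume a b) :
    ∫ s in a..b, NormedSpace.exp ((t - s) • D) (p s) =
      NormedSpace.exp (t • D) (∫ s in a..b, NormedSpace.exp ((-s) • D) (p s)) := by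
  simp_rw [exp_sub_smul_apply D t]
  exact (NormedSpace.exp (t • D)).intervalIntegral_comp_comm hp

lemma mild_eq {p : ℝ → E} (hp : Continuous p) (z : E) (t : ℝ) : mild D z p t =
    NormedSpace.exp (t • D) z + ∫ s in (0 : ℝ)..t, NormedSpace.exp ((t - s) • D) (p s) := by
  rw [intervalIntegral_exp_sub_smul ((continuous_exp_neg_smul hp).intervalIntegrable _ _), mild,
    map_add]

omit [CompleteSpace E] in
lemma mild_congr {p p' : ℝ → E} {z : E} {t : ℝ} (h : ∀ s ∈ uIcc 0 t, p s = p' s) :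
    mild D z p t = mild D z p' t := by
  rw [mild, mild]
  congr 2
  exact intervalIntegral.integral_congr fun s hs => by simp only [h s hs]

lemma continuous_mild {p : ℝ → E} (hp : Continuous p) (z : E) : Continuous (mild D z p) :=
  continuous_id.exp_smul_apply D (continuous_const.add (intervalIntegral.continuous_primitive
    (fun a b => (continuous_exp_neg_smul hp).intervalIntegrable a b) 0))

omit [CompleteSpace E] in
@[simp] lemma mild_zero (z : E) (p : ℝ → E) : mild D z p 0 = z := by simp [mild]

lemma exp_smul_comp_shift (p : ℝ → E) (τ s : ℝ) : NormedSpace.exp ((-s) • D) (p (s + τ)) =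
    NormedSpace.exp (τ • D) (NormedSpace.exp ((-(s + τ)) • D) (p (s + τ))) := by
  rw [← exp_add_smul_apply]
  congr 3
  ring

/-- A mild solution can be restarted at time `τ`. -/
lemma mild_shift {p : ℝ → E} (hp : Continuous p) (z : E) (τ t : ℝ) :
    mild D z p (t + τ) = mild D (mild D z p τ) (fun s => p (s + τ)) t := by
  have hq := continuous_exp_neg_smul (D := D) hp
  have hsub := intervalIntegral.integral_comp_add_right (a := 0) (b := t)
    (fun s => NormedSpace.exp ((-s) • D) (p s)) τ
  rw [zero_add] at hsub
  have hcomm : ∫ s in (0 : ℝ)..t, NormedSpace.exp ((-s) • D) (p (s + τ)) =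
      NormedSpace.exp (τ • D) (∫ s in τ..t + τ, NormedSpace.exp ((-s) • D) (p s)) := by
    simp_rw [exp_smul_comp_shift p τ]
    rw [← hsub]
    exact (NormedSpace.exp (τ • D)).intervalIntegral_comp_comm
      ((hq.comp (continuous_id.add continuous_const)).intervalIntegrable _ _)
  rw [mild, mild, mild, hcomm, ← map_add, ← exp_add_smul_apply, add_assoc,
    intervalIntegral.integral_add_adjacent_intervals (hq.intervalIntegrable _ _)
      (hq.intervalIntegrable _ _)]

omit [CompleteSpace E] in
lemma integral_Iic_exp_sub_smul (p : ℝ → E) (t : ℝ) :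
    ∫ s in Iic t, NormedSpace.exp ((t - s) • D) (p s) =
      ∫ s in Iic (0 : ℝ), NormedSpace.exp ((-s) • D) (p (s + t)) := by
  have := integral_Iic_comp_add_right (fun s => NormedSpace.exp ((t - s) • D) (p s)) 0 t
  rw [zero_add] at this
  rw [← this]
  simp only [sub_add_cancel_right]

/-- If the integral over the past converges, it is a mild solution on the whole line. -/
lemma integral_Iic_eq_mild {p : ℝ → E} (hp : Continuous p)
    (hint : IntegrableOn (fun s : ℝ => NormedSpace.exp ((-s) • D) (p s)) (Iic 0)) (t : ℝ) :
    ∫ s in Iic t, NormedSpace.exp ((t - s) • D) (p s) =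
      mild D (∫ s in Iic (0 : ℝ), NormedSpace.exp ((-s) • D) (p s)) p t := by
  have hint' := ((continuous_exp_neg_smul (D := D) hp).integrableOn_Iic_iff t 0).2 hint
  simp_rw [exp_sub_smul_apply D t]
  rw [mild, ← intervalIntegral.integral_Iic_sub_Iic hint hint', add_sub_cancel]
  exact (NormedSpace.exp (t • D)).integral_comp_comm hint'

end Mild

section Estimates

variable {E : Type*} [NormedAddCommGroup E] [NormedSpace ℝ E] {D : E →L[ℝ] E}
  {α γ lam C t : ℝ} {p : ℝ → E}

/-- A forcing bounded by `C e^{λs}` gives a backward integral bounded by `C e^{λt} / (α - λ)`. -/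
lemma norm_backward_le_of_le (hD : ∀ t : ℝ, t ≤ 0 → ∀ x,
      ‖NormedSpace.exp (t • D) x‖ ≤ Real.exp (α * t) * ‖x‖) (hlam : lam < α) (ht : t ≤ 0)
    (hC : 0 ≤ C) (hp : ∀ s ≤ 0, ‖p s‖ ≤ C * Real.exp (lam * s)) :
    ‖∫ s in (0 : ℝ)..t, NormedSpace.exp ((t - s) • D) (p s)‖ ≤
      C / (α - lam) * Real.exp (lam * t) := by
  have hpos : 0 < α - lam := sub_pos.2 hlam
  have hder : ∀ s : ℝ, HasDerivAt
      (fun s => -(C / (α - lam)) * Real.exp (α * t + (lam - α) * s))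
      (C * Real.exp (α * t + (lam - α) * s)) s := by
    intro s
    have := ((((hasDerivAt_id s).const_mul (lam - α)).const_add (α * t)).exp).const_mul
      (-(C / (α - lam)))
    convert! this using 1
    simp only [id]
    field_simp
    ring
  have hint := intervalIntegral.integral_eq_sub_of_hasDerivAt (a := t) (b := 0)
    (fun s _ => hder s) (Continuous.intervalIntegrable (by fun_prop) _ _)
  rw [intervalIntegral.integral_symm, norm_neg]
  refine (intervalIntegral.norm_integral_le_of_norm_le ht
    (g := fun s => C * Real.exp (α * t + (lam - α) * s)) (ae_of_all _ fun s hs => ?_)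
    (Continuous.intervalIntegrable (by fun_prop) _ _)).trans ?_
  · refine (hD (t - s) (by linarith [hs.1]) _).trans ?_
    calc Real.exp (α * (t - s)) * ‖p s‖ ≤ Real.exp (α * (t - s)) * (C * Real.exp (lam * s)) := by
          gcongr; exact hp s hs.2
      _ = C * Real.exp (α * t + (lam - α) * s) := by
          rw [mul_left_comm, ← Real.exp_add]; congr 2; ring
  · rw [hint]
    have h1 : α * t + (lam - α) * t = lam * t := by ring
    rw [h1]
    have : 0 ≤ C / (α - lam) * Real.exp (α * t + (lam - α) * 0) := by positivity
    linarith

/-- The counterpart of `norm_backward_le_of_le` for a forcing that is bounded only in an averaged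
sense, as the noise is. -/
lemma norm_backward_le_of_integrable (hD : ∀ t : ℝ, t ≤ 0 → ∀ x,
      ‖NormedSpace.exp (t • D) x‖ ≤ Real.exp (α * t) * ‖x‖) (hlam : lam < α) (ht : t ≤ 0)
    (hp : IntegrableOn (fun s => Real.exp (-lam * s) * ‖p s‖) (Iic 0)) :
    ‖∫ s in (0 : ℝ)..t, NormedSpace.exp ((t - s) • D) (p s)‖ ≤
      (∫ s in Iic (0 : ℝ), Real.exp (-lam * s) * ‖p s‖) * Real.exp (lam * t) := by
  have hsub : Ioc t 0 ⊆ Iic 0 := fun s hs => hs.2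
  rw [intervalIntegral.integral_symm, norm_neg, intervalIntegral.integral_of_le ht, mul_comm,
    ← integral_const_mul]
  have h1 : ‖∫ s in Ioc t 0, NormedSpace.exp ((t - s) • D) (p s)‖ ≤
      ∫ s in Ioc t 0, Real.exp (lam * t) * (Real.exp (-lam * s) * ‖p s‖) := by
    refine norm_integral_le_of_norm_le ((hp.mono_set hsub).const_mul _)
      ((ae_restrict_iff' measurableSet_Ioc).2 (ae_of_all _ fun s hs => ?_))
    refine (hD (t - s) (by linarith [hs.1]) _).trans ?_
    rw [← mul_assoc, ← Real.exp_add]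
    gcongr ?_ * _
    refine Real.exp_le_exp.2 ?_
    nlinarith [hs.1]
  exact h1.trans (setIntegral_mono_set (hp.const_mul _)
    (ae_of_all _ fun s => by positivity) (ae_of_all _ hsub))

variable (hD : ∀ t : ℝ, 0 ≤ t → ∀ y, ‖NormedSpace.exp (t • D) y‖ ≤ Real.exp (γ * t) * ‖y‖)
include hD

lemma norm_exp_sub_smul_le_of_le (hC : ∀ s ≤ 0, ‖p s‖ ≤ C * Real.exp (lam * s)) (ht : t ≤ 0)
    {s : ℝ} (hs : s ≤ t) : ‖NormedSpace.exp ((t - s) • D) (p s)‖ ≤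
      C * Real.exp (γ * t) * Real.exp ((lam - γ) * s) := by
  refine (hD (t - s) (by linarith) _).trans ?_
  calc Real.exp (γ * (t - s)) * ‖p s‖ ≤ Real.exp (γ * (t - s)) * (C * Real.exp (lam * s)) := by
        gcongr; exact hC s (hs.trans ht)
    _ = C * Real.exp (γ * t) * Real.exp ((lam - γ) * s) := by
        rw [mul_left_comm, mul_assoc, ← Real.exp_add, ← Real.exp_add]; congr 2; ring

/-- A forcing bounded by `C e^{λs}` gives an integral over the past bounded by
`C e^{λt} / (λ - γ)`. -/
lemma norm_past_le_of_le (hlam : γ < lam) (ht : t ≤ 0)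
    (hC : ∀ s ≤ 0, ‖p s‖ ≤ C * Real.exp (lam * s)) :
    ‖∫ s in Iic t, NormedSpace.exp ((t - s) • D) (p s)‖ ≤
      C / (lam - γ) * Real.exp (lam * t) := by
  have hpos : 0 < lam - γ := sub_pos.2 hlam
  refine (norm_integral_le_of_norm_le ((integrableOn_exp_mul_Iic hpos t).const_mul
    (C * Real.exp (γ * t))) ((ae_restrict_iff' measurableSet_Iic).2 (ae_of_all _ fun _ hs =>
      norm_exp_sub_smul_le_of_le hD hC ht hs))).trans (le_of_eq ?_)
  rw [integral_const_mul, integral_exp_mul_Iic hpos]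
  have : Real.exp (lam * t) = Real.exp (γ * t) * Real.exp ((lam - γ) * t) := by
    rw [← Real.exp_add]; congr 1; ring
  rw [this]
  ring

lemma integrableOn_past_of_le [CompleteSpace E] (hp : Continuous p) (hlam : γ < lam) (ht : t ≤ 0)
    (hC : ∀ s ≤ 0, ‖p s‖ ≤ C * Real.exp (lam * s)) :
    IntegrableOn (fun s => NormedSpace.exp ((t - s) • D) (p s)) (Iic t) :=
  Integrable.mono' ((integrableOn_exp_mul_Iic (sub_pos.2 hlam) t).const_mul (C * Real.exp (γ * t)))
    ((continuous_const.sub continuous_id).exp_smul_apply D hp).aestronglyMeasurable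
    ((ae_restrict_iff' measurableSet_Iic).2 (ae_of_all _ fun _ hs =>
      norm_exp_sub_smul_le_of_le hD hC ht hs))

lemma norm_exp_sub_smul_le (hlam : γ < lam) {s : ℝ} (hs : s ≤ t) :
    ‖NormedSpace.exp ((t - s) • D) (p s)‖ ≤
      Real.exp (lam * t) * (Real.exp (-lam * s) * ‖p s‖) := by
  refine (hD (t - s) (by linarith) _).trans ?_
  rw [← mul_assoc, ← Real.exp_add]
  gcongr ?_ * _
  refine Real.exp_le_exp.2 ?_
  nlinarith

/-- The counterpart of `norm_past_le_of_le` for a forcing that is bounded only in an averaged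
sense. -/
lemma norm_past_le_of_integrable (hlam : γ < lam) (ht : t ≤ 0)
    (hp : IntegrableOn (fun s => Real.exp (-lam * s) * ‖p s‖) (Iic 0)) :
    ‖∫ s in Iic t, NormedSpace.exp ((t - s) • D) (p s)‖ ≤
      (∫ s in Iic (0 : ℝ), Real.exp (-lam * s) * ‖p s‖) * Real.exp (lam * t) := by
  have hsub : Iic t ⊆ Iic 0 := Iic_subset_Iic.2 ht
  rw [mul_comm, ← integral_const_mul]
  refine (norm_integral_le_of_norm_le ((hp.mono_set hsub).const_mul (Real.exp (lam * t)))
    ((ae_restrict_iff' measurableSet_Iic).2 (ae_of_all _ fun _ hs =>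
      norm_exp_sub_smul_le hD hlam hs))).trans ?_
  exact setIntegral_mono_set (hp.const_mul _) (ae_of_all _ fun s => by positivity)
    (ae_of_all _ hsub)

lemma integrableOn_past_of_integrable [CompleteSpace E] (hpc : Continuous p) (hlam : γ < lam)
    (ht : t ≤ 0) (hp : IntegrableOn (fun s => Real.exp (-lam * s) * ‖p s‖) (Iic 0)) :
    IntegrableOn (fun s => NormedSpace.exp ((t - s) • D) (p s)) (Iic t) :=
  Integrable.mono' ((hp.mono_set (Iic_subset_Iic.2 ht)).const_mul (Real.exp (lam * t)))
    ((continuous_const.sub continuous_id).exp_smul_apply D hpc).aestronglyMeasurable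
    ((ae_restrict_iff' measurableSet_Iic).2 (ae_of_all _ fun _ hs =>
      norm_exp_sub_smul_le hD hlam hs))

end Estimates

/-! ### The Lyapunov-Perron fixed point -/

section LyapunovPerron

variable {n m : ℕ}

/-- The standing assumptions on the linear parts and the nonlinearities at a fixed `ε`; the gap
condition on `λ` is kept apart, as `SpectralGap`. -/
structure IsGapSystem (A : Eu n →L[ℝ] Eu n) (B : Eu m →L[ℝ] Eu m) (f : Eu n → Eu m → Eu n)
    (g : Eu n → Eu m → Eu m) (α β Lf Lg ε : ℝ) : Prop where
  Lf_nonneg : 0 ≤ Lf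
  lip_f : ∀ x x' y y', ‖f x y - f x' y'‖ ≤ Lf * (‖x - x'‖ + ‖y - y'‖)
  Lg_nonneg : 0 ≤ Lg
  lip_g : ∀ x x' y y', ‖g x y - g x' y'‖ ≤ Lg * (‖x - x'‖ + ‖y - y'‖)
  exp_A : ∀ t : ℝ, t ≤ 0 → ∀ x, ‖NormedSpace.exp (t • A) x‖ ≤ Real.exp (α * t) * ‖x‖
  exp_B : ∀ t : ℝ, 0 ≤ t → ∀ y, ‖NormedSpace.exp (t • B) y‖ ≤ Real.exp (β * t) * ‖y‖
  ε_pos : 0 < ε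

/-- A continuous noise path whose growth at `-∞` is subexponential, in an averaged sense. -/
structure IsTempered (ζ : ℝ → Eu m) : Prop where
  continuous : Continuous ζ
  integrable : ∀ lam : ℝ, lam < 0 →
    IntegrableOn (fun s : ℝ => Real.exp (-lam * s) * ‖ζ s‖) (Iic 0)

/-- The nonlinearity `k` along the path `U`, with the noise `ζ` added to the fast variable. -/
def forcing {p : ℕ} (k : Eu n → Eu m → Eu p) (ζ : ℝ → Eu m) (U : ℝ → State n m) (s : ℝ) : Eu p :=
  k (U s).fst ((U s).snd + ζ s)

section Forcing

variable {p : ℕ} {k : Eu n → Eu m → Eu p} {L : ℝ} {ζ : ℝ → Eu m}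

lemma continuous_forcing (hk : ∀ x x' y y', ‖k x y - k x' y'‖ ≤ L * (‖x - x'‖ + ‖y - y'‖))
    (hζ : Continuous ζ) {U : ℝ → State n m} (hU : Continuous U) : Continuous (forcing k ζ U) :=
  (continuous_uncurry_of_lipschitz hk).comp ((continuous_fst_state.comp hU).prodMk
    ((continuous_snd_state.comp hU).add hζ))

lemma norm_forcing_sub_le (hk : ∀ x x' y y', ‖k x y - k x' y'‖ ≤ L * (‖x - x'‖ + ‖y - y'‖))
    (U V : ℝ → State n m) (s : ℝ) :
    ‖forcing k ζ U s - forcing k ζ V s‖ ≤ L * ‖U s - V s‖ := by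
  have h := hk (U s).fst (V s).fst ((U s).snd + ζ s) ((V s).snd + ζ s)
  rw [add_sub_add_right_eq_sub] at h
  exact h.trans (le_of_eq (by rw [norm_state (U s - V s)]; rfl))

lemma integrableOn_forcing_zero
    (hk : ∀ x x' y y', ‖k x y - k x' y'‖ ≤ L * (‖x - x'‖ + ‖y - y'‖)) (hζ : IsTempered ζ)
    {lam : ℝ} (hlam : lam < 0) :
    IntegrableOn (fun s => Real.exp (-lam * s) * ‖forcing k ζ (0 : ℝ → State n m) s‖) (Iic 0) := by
  have hexp : IntegrableOn (fun s : ℝ => Real.exp (-lam * s)) (Iic 0) :=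
    integrableOn_exp_mul_Iic (by linarith) 0
  have hc : Continuous (forcing k ζ (0 : ℝ → State n m)) :=
    continuous_forcing hk hζ.continuous continuous_const
  refine Integrable.mono' ((hexp.mul_const ‖k 0 0‖).add ((hζ.integrable lam hlam).const_mul L))
    ((by fun_prop : Continuous fun s : ℝ => Real.exp (-lam * s)).mul hc.norm).aestronglyMeasurable
    (ae_of_all _ fun s => ?_)
  rw [Real.norm_of_nonneg (by positivity)]
  have h1 : ‖forcing k ζ (0 : ℝ → State n m) s‖ ≤ ‖k 0 0‖ + L * ‖ζ s‖ := by
    have h2 : forcing k ζ (0 : ℝ → State n m) s = k 0 (ζ s) := by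
      simp [forcing]
    have h3 := hk 0 0 (ζ s) 0
    rw [sub_zero, norm_zero, zero_add, sub_zero] at h3
    rw [h2]
    have := norm_le_norm_add_norm_sub' (k 0 (ζ s)) (k 0 0)
    linarith
  calc Real.exp (-lam * s) * ‖forcing k ζ (0 : ℝ → State n m) s‖
      ≤ Real.exp (-lam * s) * (‖k 0 0‖ + L * ‖ζ s‖) := by gcongr
    _ = _ := by simp only [Pi.add_apply]; ring

end Forcing

lemma mem_weightedSpace_iff {lam : ℝ} {u : C(Iic (0 : ℝ), State n m)} :
    u ∈ weightedSpace n m lam ↔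
      ∃ M, ∀ s ≤ (0 : ℝ), ‖IicExtend u s‖ ≤ M * Real.exp (lam * s) := by
  have key : ∀ (M s : ℝ) (r : ℝ), Real.exp (-lam * s) * r ≤ M ↔ r ≤ M * Real.exp (lam * s) := by
    intro M s r
    rw [neg_mul, Real.exp_neg, ← le_div_iff₀' (by positivity), div_inv_eq_mul]
  constructor
  · rintro ⟨M, hM⟩
    refine ⟨M, fun s hs => ?_⟩
    rw [IicExtend_of_mem _ (mem_Iic.2 hs)]
    exact (key M s _).1 (hM ⟨⟨s, hs⟩, rfl⟩)
  · rintro ⟨M, hM⟩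
    refine ⟨M, ?_⟩
    rintro _ ⟨t, rfl⟩
    have := hM t t.2
    rw [IicExtend_of_mem _ t.2] at this
    exact (key M t _).2 this

lemma weightedSpace_mono {l₁ l₂ : ℝ} (h : l₁ ≤ l₂) :
    weightedSpace n m l₂ ⊆ weightedSpace n m l₁ := by
  intro u hu
  obtain ⟨M, hM⟩ := mem_weightedSpace_iff.1 hu
  refine mem_weightedSpace_iff.2 ⟨M, fun s hs => (hM s hs).trans ?_⟩
  have hM0 : 0 ≤ M := nonneg_of_mul_nonneg_left ((norm_nonneg _).trans (hM s hs)) (Real.exp_pos _)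
  gcongr ?_ * ?_
  exact Real.exp_le_exp.2 (mul_le_mul_of_nonpos_right h hs)

lemma continuous_IicExtend_state (u : C(Iic (0 : ℝ), State n m)) : Continuous (IicExtend u) :=
  u.continuous.comp ((continuous_const.min continuous_id).subtype_mk _)

variable {A : Eu n →L[ℝ] Eu n} {B : Eu m →L[ℝ] Eu m} {f : Eu n → Eu m → Eu n}
  {g : Eu n → Eu m → Eu m} {α β Lf Lg ε : ℝ}

lemma smul_fastIntegrand (ζ : ℝ → Eu m) (u : C(Iic (0 : ℝ), State n m)) (t s : ℝ) :
    ε⁻¹ • fastIntegrand B g ε ζ u t s = NormedSpace.exp ((t - s) • ε⁻¹ • B)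
      (ε⁻¹ • forcing g ζ (IicExtend u) s) := by
  rw [map_smul, smul_smul, ← div_eq_mul_inv]
  rfl

lemma lyapunovPerron_eq (ζ : ℝ → Eu m) (X₀ : Eu n) (u : C(Iic (0 : ℝ), State n m))
    (t : Iic (0 : ℝ)) : lyapunovPerron A B f g ε ζ X₀ u t =
      pt (NormedSpace.exp ((t : ℝ) • A) X₀ + ∫ s in (0 : ℝ)..t,
          NormedSpace.exp (((t : ℝ) - s) • A) (forcing f ζ (IicExtend u) s))
        (∫ s in Iic (t : ℝ), NormedSpace.exp (((t : ℝ) - s) • ε⁻¹ • B)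
          (ε⁻¹ • forcing g ζ (IicExtend u) s)) := by
  rw [lyapunovPerron, ← integral_smul]
  simp_rw [smul_fastIntegrand]
  rfl

namespace IsGapSystem

variable (h : IsGapSystem A B f g α β Lf Lg ε)
include h

lemma exp_smul_B (t : ℝ) (ht : 0 ≤ t) (y : Eu m) :
    ‖NormedSpace.exp (t • ε⁻¹ • B) y‖ ≤ Real.exp (β / ε * t) * ‖y‖ := by
  have := h.exp_B (t / ε) (div_nonneg ht h.ε_pos.le) y
  rwa [smul_smul, ← div_eq_mul_inv, div_mul_eq_mul_div, mul_div_assoc]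

lemma div_lt_of_gap {lam : ℝ} (hgap : SpectralGap α β Lf Lg ε lam) : β / ε < lam := by
  rw [div_lt_iff₀' h.ε_pos]
  exact hgap.2.1

lemma smul_div_eq {lam : ℝ} : ε⁻¹ * Lg / (lam - β / ε) = Lg / (ε * lam - β) := by
  have hε := h.ε_pos
  rw [show ε * lam - β = ε * (lam - β / ε) by field_simp, ← div_div, inv_mul_eq_div]

variable {ζ : ℝ → Eu m} {lam : ℝ}

lemma continuous_slow (hζ : IsTempered ζ) {U : ℝ → State n m} (hU : Continuous U) :
    Continuous (forcing f ζ U) := continuous_forcing h.lip_f hζ.continuous hU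

lemma continuous_fast (hζ : IsTempered ζ) {U : ℝ → State n m} (hU : Continuous U) :
    Continuous fun s => ε⁻¹ • forcing g ζ U s :=
  (continuous_forcing h.lip_g hζ.continuous hU).const_smul ε⁻¹

lemma norm_fast_sub_le {U V : ℝ → State n m} {M s : ℝ}
    (hUV : ‖U s - V s‖ ≤ M * Real.exp (lam * s)) :
    ‖ε⁻¹ • forcing g ζ U s - ε⁻¹ • forcing g ζ V s‖ ≤ ε⁻¹ * Lg * M * Real.exp (lam * s) := by
  have hε := h.ε_pos
  have hLg := h.Lg_nonneg
  rw [← smul_sub, norm_smul, Real.norm_of_nonneg (by positivity), mul_assoc, mul_assoc]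
  gcongr
  exact (norm_forcing_sub_le h.lip_g U V s).trans (by gcongr)

lemma norm_slow_sub_le {U V : ℝ → State n m} {M s : ℝ}
    (hUV : ‖U s - V s‖ ≤ M * Real.exp (lam * s)) :
    ‖forcing f ζ U s - forcing f ζ V s‖ ≤ Lf * M * Real.exp (lam * s) := by
  have hLf := h.Lf_nonneg
  rw [mul_assoc]
  exact (norm_forcing_sub_le h.lip_f U V s).trans (by gcongr)

lemma integrableOn_fast_zero (hζ : IsTempered ζ) (hlam : lam < 0) :
    IntegrableOn (fun s => Real.exp (-lam * s) * ‖ε⁻¹ • forcing g ζ (0 : ℝ → State n m) s‖)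
      (Iic 0) := by
  have := (integrableOn_forcing_zero (n := n) h.lip_g hζ hlam).const_mul ‖ε⁻¹‖
  refine this.congr (ae_of_all _ fun s => ?_)
  simp only [norm_smul]
  ring

/-- The integral over the past converges absolutely: the forcing along `u` is the one along `0`,
which is integrable against the weight, up to an error of order `e^{λs}`. -/
lemma integrableOn_past (hζ : IsTempered ζ) (hlam : lam < 0)
    (hgap : SpectralGap α β Lf Lg ε lam) {u : C(Iic (0 : ℝ), State n m)}
    (hu : u ∈ weightedSpace n m lam) {t : ℝ} (ht : t ≤ 0) :
    IntegrableOn (fun s => NormedSpace.exp ((t - s) • ε⁻¹ • B)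
      (ε⁻¹ • forcing g ζ (IicExtend u) s)) (Iic t) := by
  obtain ⟨M, hM⟩ := mem_weightedSpace_iff.1 hu
  have hU := continuous_IicExtend_state u
  have h0 := integrableOn_past_of_integrable h.exp_smul_B
    (h.continuous_fast hζ (continuous_const : Continuous (0 : ℝ → State n m)))
    (h.div_lt_of_gap hgap) ht (h.integrableOn_fast_zero hζ hlam)
  have h1 := integrableOn_past_of_le h.exp_smul_B
    ((h.continuous_fast hζ hU).sub
      (h.continuous_fast hζ (continuous_const : Continuous (0 : ℝ → State n m))))
    (h.div_lt_of_gap hgap) ht (C := ε⁻¹ * Lg * M)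
    fun s hs => h.norm_fast_sub_le (V := 0) (by simpa using hM s hs)
  refine (h1.add h0).congr (ae_of_all _ fun s => ?_)
  simp

lemma norm_snd_lyapunovPerron_sub_le (hζ : IsTempered ζ) (hlam : lam < 0)
    (hgap : SpectralGap α β Lf Lg ε lam) {u v : C(Iic (0 : ℝ), State n m)}
    (hu : u ∈ weightedSpace n m lam) (hv : v ∈ weightedSpace n m lam) {M : ℝ}
    (hM : ∀ s ≤ (0 : ℝ), ‖IicExtend u s - IicExtend v s‖ ≤ M * Real.exp (lam * s))
    (X X' : Eu n) (t : Iic (0 : ℝ)) :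
    ‖(lyapunovPerron A B f g ε ζ X u t).snd - (lyapunovPerron A B f g ε ζ X' v t).snd‖ ≤
      Lg / (ε * lam - β) * M * Real.exp (lam * t) := by
  rw [lyapunovPerron_eq, lyapunovPerron_eq, pt_snd, pt_snd,
    ← integral_sub (h.integrableOn_past hζ hlam hgap hu t.2)
      (h.integrableOn_past hζ hlam hgap hv t.2)]
  simp_rw [← map_sub]
  refine (norm_past_le_of_le h.exp_smul_B (h.div_lt_of_gap hgap) t.2
    (C := ε⁻¹ * Lg * M) fun s hs => h.norm_fast_sub_le (hM s hs)).trans (le_of_eq ?_)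
  rw [← h.smul_div_eq]
  ring

lemma norm_fst_lyapunovPerron_sub_le (hζ : IsTempered ζ)
    (hgap : SpectralGap α β Lf Lg ε lam) {u v : C(Iic (0 : ℝ), State n m)} {M : ℝ}
    (hM : ∀ s ≤ (0 : ℝ), ‖IicExtend u s - IicExtend v s‖ ≤ M * Real.exp (lam * s))
    (X X' : Eu n) (t : Iic (0 : ℝ)) :
    ‖(lyapunovPerron A B f g ε ζ X u t).fst - (lyapunovPerron A B f g ε ζ X' v t).fst‖ ≤
      (‖X - X'‖ + Lf / (α - lam) * M) * Real.exp (lam * t) := by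
  have hM0 : 0 ≤ M := by simpa using (norm_nonneg _).trans (hM 0 le_rfl)
  have hc : ∀ w : C(Iic (0 : ℝ), State n m), Continuous fun s =>
      NormedSpace.exp (((t : ℝ) - s) • A) (forcing f ζ (IicExtend w) s) := fun w =>
    (continuous_const.sub continuous_id).exp_smul_apply A
      (h.continuous_slow hζ (continuous_IicExtend_state w))
  rw [lyapunovPerron_eq, lyapunovPerron_eq, pt_fst, pt_fst, add_sub_add_comm, ← map_sub,
    ← intervalIntegral.integral_sub ((hc u).intervalIntegrable _ _)
      ((hc v).intervalIntegrable _ _), add_mul]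
  simp_rw [← map_sub]
  refine (norm_add_le _ _).trans (add_le_add ?_ ?_)
  · refine (h.exp_A t t.2 _).trans ?_
    rw [mul_comm]
    gcongr ?_ * ?_
    exact Real.exp_le_exp.2 (mul_le_mul_of_nonpos_right hgap.1.le t.2)
  · refine (norm_backward_le_of_le h.exp_A hgap.1 t.2 (C := Lf * M)
      (mul_nonneg h.Lf_nonneg hM0) fun s hs => h.norm_slow_sub_le (hM s hs)).trans (le_of_eq ?_)
    ring

/-- The basic estimate: for `X = X'` it is the contraction property, and for two fixed points it
gives Lipschitz dependence on `X`. -/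
lemma norm_lyapunovPerron_sub_le (hζ : IsTempered ζ) (hlam : lam < 0)
    (hgap : SpectralGap α β Lf Lg ε lam) {u v : C(Iic (0 : ℝ), State n m)}
    (hu : u ∈ weightedSpace n m lam) (hv : v ∈ weightedSpace n m lam) {M : ℝ}
    (hM : ∀ s ≤ (0 : ℝ), ‖IicExtend u s - IicExtend v s‖ ≤ M * Real.exp (lam * s))
    (X X' : Eu n) (t : Iic (0 : ℝ)) :
    ‖lyapunovPerron A B f g ε ζ X u t - lyapunovPerron A B f g ε ζ X' v t‖ ≤
      (‖X - X'‖ + (Lf / (α - lam) + Lg / (ε * lam - β)) * M) * Real.exp (lam * t) := by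
  have h1 := h.norm_fst_lyapunovPerron_sub_le hζ hgap hM X X' t
  have h2 := h.norm_snd_lyapunovPerron_sub_le hζ hlam hgap hu hv hM X X' t
  have h3 := norm_state
    (lyapunovPerron A B f g ε ζ X u t - lyapunovPerron A B f g ε ζ X' v t)
  calc _ = _ := h3
    _ ≤ _ := add_le_add h1 h2
    _ = _ := by ring

/-- The image of `u = 0`, where the noise enters: it is finite in the weighted norm by
temperedness. -/
lemma exists_norm_lyapunovPerron_zero_le (hζ : IsTempered ζ) (hlam : lam < 0)
    (hgap : SpectralGap α β Lf Lg ε lam) (X : Eu n) :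
    ∃ C, ∀ t : Iic (0 : ℝ), ‖lyapunovPerron A B f g ε ζ X 0 t‖ ≤ C * Real.exp (lam * t) := by
  have h0 : IicExtend (⇑(0 : C(Iic (0 : ℝ), State n m))) = (0 : ℝ → State n m) := rfl
  refine ⟨‖X‖ + (∫ s in Iic (0 : ℝ), Real.exp (-lam * s) * ‖forcing f ζ (0 : ℝ → State n m) s‖) +
    ∫ s in Iic (0 : ℝ), Real.exp (-lam * s) * ‖ε⁻¹ • forcing g ζ (0 : ℝ → State n m) s‖,
    fun t => ?_⟩
  rw [lyapunovPerron_eq, norm_state, pt_fst, pt_snd, h0, add_mul, add_mul]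
  refine add_le_add ((norm_add_le _ _).trans (add_le_add ?_ ?_)) ?_
  · refine (h.exp_A t t.2 _).trans ?_
    rw [mul_comm]
    gcongr ?_ * ?_
    exact Real.exp_le_exp.2 (mul_le_mul_of_nonpos_right hgap.1.le t.2)
  · exact norm_backward_le_of_integrable h.exp_A hgap.1 t.2
      (integrableOn_forcing_zero h.lip_f hζ hlam)
  · exact norm_past_le_of_integrable h.exp_smul_B (h.div_lt_of_gap hgap) t.2
      (h.integrableOn_fast_zero hζ hlam)

/-- The value of the operator is a mild solution whose fast component starts at the integral over
the past. -/
lemma lyapunovPerron_eq_mild (hζ : IsTempered ζ) (hlam : lam < 0)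
    (hgap : SpectralGap α β Lf Lg ε lam) {u : C(Iic (0 : ℝ), State n m)}
    (hu : u ∈ weightedSpace n m lam) (X : Eu n) (t : Iic (0 : ℝ)) :
    lyapunovPerron A B f g ε ζ X u t = pt (mild A X (forcing f ζ (IicExtend u)) t)
      (mild (ε⁻¹ • B) (∫ s in Iic (0 : ℝ), NormedSpace.exp ((-s) • ε⁻¹ • B)
        (ε⁻¹ • forcing g ζ (IicExtend u) s)) (fun s => ε⁻¹ • forcing g ζ (IicExtend u) s) t) := by
  have hU := continuous_IicExtend_state u
  have hint := h.integrableOn_past hζ hlam hgap hu (t := 0) le_rfl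
  simp only [zero_sub] at hint
  rw [lyapunovPerron_eq, mild_eq (h.continuous_slow hζ hU),
    integral_Iic_eq_mild (h.continuous_fast hζ hU) hint]

/-- The Lyapunov-Perron operator maps the weighted space into itself. -/
lemma exists_eq_lyapunovPerron (hζ : IsTempered ζ) (hlam : lam < 0)
    (hgap : SpectralGap α β Lf Lg ε lam) {u : C(Iic (0 : ℝ), State n m)}
    (hu : u ∈ weightedSpace n m lam) (X : Eu n) :
    ∃ v ∈ weightedSpace n m lam, ⇑v = lyapunovPerron A B f g ε ζ X u := by
  have hU := continuous_IicExtend_state u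
  have hcont : Continuous (lyapunovPerron A B f g ε ζ X u) := by
    rw [funext (h.lyapunovPerron_eq_mild hζ hlam hgap hu X)]
    exact continuous_pt.comp
      (((continuous_mild (h.continuous_slow hζ hU) X).comp continuous_subtype_val).prodMk
        ((continuous_mild (h.continuous_fast hζ hU) _).comp continuous_subtype_val))
  refine ⟨⟨_, hcont⟩, mem_weightedSpace_iff.2 ?_, rfl⟩
  obtain ⟨M, hM⟩ := mem_weightedSpace_iff.1 hu
  obtain ⟨C, hC⟩ := h.exists_norm_lyapunovPerron_zero_le hζ hlam hgap X
  have h0 : (0 : C(Iic (0 : ℝ), State n m)) ∈ weightedSpace n m lam :=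
    mem_weightedSpace_iff.2 ⟨0, fun s _ => by simp [IicExtend]⟩
  refine ⟨(Lf / (α - lam) + Lg / (ε * lam - β)) * M + C, fun s hs => ?_⟩
  rw [IicExtend_of_mem _ (mem_Iic.2 hs)]
  have h1 := h.norm_lyapunovPerron_sub_le hζ hlam hgap hu h0 (M := M)
    (fun s hs => by simpa [IicExtend] using hM s hs) X X ⟨s, hs⟩
  rw [sub_self, norm_zero, zero_add] at h1
  have h2 := norm_le_norm_add_norm_sub' (lyapunovPerron A B f g ε ζ X u ⟨s, hs⟩)
    (lyapunovPerron A B f g ε ζ X 0 ⟨s, hs⟩)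
  have h3 := hC ⟨s, hs⟩
  calc ‖lyapunovPerron A B f g ε ζ X u ⟨s, hs⟩‖ ≤ C * Real.exp (lam * s) +
        (Lf / (α - lam) + Lg / (ε * lam - β)) * M * Real.exp (lam * s) :=
        h2.trans (add_le_add h3 h1)
    _ = _ := by ring

end IsGapSystem

end LyapunovPerron

section FixedPoint

open scoped BoundedContinuousFunction

variable {n m : ℕ}

/-- The isometry `w ↦ e^{λ·} w` from bounded continuous functions onto the weighted space. It
transports completeness to the weighted space, which is only a set. -/
def unweight (lam : ℝ) (w : Iic (0 : ℝ) →ᵇ State n m) : C(Iic (0 : ℝ), State n m) :=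
  ⟨fun t => Real.exp (lam * t) • w t,
    (by fun_prop : Continuous fun t : Iic (0 : ℝ) => Real.exp (lam * t)).smul w.continuous⟩

lemma norm_unweight_sub_le {lam : ℝ} (w w' : Iic (0 : ℝ) →ᵇ State n m) (s : ℝ) (hs : s ≤ 0) :
    ‖IicExtend (unweight lam w) s - IicExtend (unweight lam w') s‖ ≤
      dist w w' * Real.exp (lam * s) := by
  rw [IicExtend_of_mem _ (mem_Iic.2 hs), IicExtend_of_mem _ (mem_Iic.2 hs)]
  change ‖Real.exp (lam * s) • w _ - Real.exp (lam * s) • w' _‖ ≤ _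
  rw [← smul_sub, norm_smul, Real.norm_of_nonneg (Real.exp_nonneg _), mul_comm, ← dist_eq_norm]
  gcongr
  exact BoundedContinuousFunction.dist_coe_le_dist _

lemma dist_le_of_norm_unweight_sub_le {lam : ℝ} {w w' : Iic (0 : ℝ) →ᵇ State n m} {M : ℝ}
    (hM : 0 ≤ M) (h : ∀ t : Iic (0 : ℝ), ‖unweight lam w t - unweight lam w' t‖ ≤
      M * Real.exp (lam * t)) : dist w w' ≤ M := by
  refine (BoundedContinuousFunction.dist_le hM).2 fun t => ?_
  have ht := h t
  change ‖Real.exp (lam * t) • w _ - Real.exp (lam * t) • w' _‖ ≤ _ at ht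
  rw [← smul_sub, norm_smul, Real.norm_of_nonneg (Real.exp_nonneg _), mul_comm] at ht
  rw [dist_eq_norm]
  exact le_of_mul_le_mul_right ht (Real.exp_pos _)

lemma unweight_mem (lam : ℝ) (w : Iic (0 : ℝ) →ᵇ State n m) :
    unweight lam w ∈ weightedSpace n m lam := by
  refine mem_weightedSpace_iff.2 ⟨‖w‖, fun s hs => ?_⟩
  rw [IicExtend_of_mem _ (mem_Iic.2 hs)]
  change ‖Real.exp (lam * s) • w _‖ ≤ _
  rw [norm_smul, Real.norm_of_nonneg (Real.exp_nonneg _), mul_comm]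
  gcongr
  exact w.norm_coe_le_norm _

lemma exists_unweight_eq {lam : ℝ} {u : C(Iic (0 : ℝ), State n m)}
    (hu : u ∈ weightedSpace n m lam) : ∃ w, unweight lam w = u := by
  obtain ⟨M, hM⟩ := hu
  refine ⟨BoundedContinuousFunction.ofNormedAddCommGroup
    (fun t : Iic (0 : ℝ) => Real.exp (-lam * t) • u t)
    ((by fun_prop : Continuous fun t : Iic (0 : ℝ) => Real.exp (-lam * t)).smul u.continuous) M
    fun t => ?_, ?_⟩
  · rw [norm_smul, Real.norm_of_nonneg (Real.exp_nonneg _)]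
    exact hM ⟨t, rfl⟩
  · ext1 t
    change Real.exp (lam * t) • Real.exp (-lam * t) • u t = u t
    rw [smul_smul, ← Real.exp_add, neg_mul, add_neg_cancel, Real.exp_zero, one_smul]

variable {A : Eu n →L[ℝ] Eu n} {B : Eu m →L[ℝ] Eu m} {f : Eu n → Eu m → Eu n}
  {g : Eu n → Eu m → Eu m} {α β Lf Lg ε : ℝ}

namespace IsGapSystem

variable (h : IsGapSystem A B f g α β Lf Lg ε) {ζ : ℝ → Eu m} {lam : ℝ}
include h

lemma const_nonneg (hgap : SpectralGap α β Lf Lg ε lam) :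
    0 ≤ Lf / (α - lam) + Lg / (ε * lam - β) :=
  add_nonneg (div_nonneg h.Lf_nonneg (sub_pos.2 hgap.1).le)
    (div_nonneg h.Lg_nonneg (sub_pos.2 hgap.2.1).le)

/-- The fixed point of the Lyapunov-Perron operator, as the limit of its iterates from `0`. -/
lemma exists_fixedPoint (hζ : IsTempered ζ) (hlam : lam < 0)
    (hgap : SpectralGap α β Lf Lg ε lam) (X : Eu n) :
    ∃ u ∈ weightedSpace n m lam, lyapunovPerron A B f g ε ζ X u = u ∧
      ∃ v : ℕ → C(Iic (0 : ℝ), State n m), v 0 = 0 ∧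
        (∀ k, ⇑(v (k + 1)) = lyapunovPerron A B f g ε ζ X (v k)) ∧
        ∀ t, Tendsto (fun k => v k t) atTop (𝓝 (u t)) := by
  have hκ := h.const_nonneg hgap
  have hS : ∀ w : Iic (0 : ℝ) →ᵇ State n m, ∃ w' : Iic (0 : ℝ) →ᵇ State n m,
      ⇑(unweight lam w') = lyapunovPerron A B f g ε ζ X (unweight lam w) := by
    intro w
    obtain ⟨v, hv, hveq⟩ := h.exists_eq_lyapunovPerron hζ hlam hgap (unweight_mem lam w) X
    obtain ⟨w', rfl⟩ := exists_unweight_eq hv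
    exact ⟨w', hveq⟩
  -- `S` is the operator, read on bounded continuous functions.
  choose S hS using hS
  have hcontr : ContractingWith ⟨_, hκ⟩ S := by
    refine ⟨hgap.2.2.2, LipschitzWith.of_dist_le_mul fun w w' => ?_⟩
    refine dist_le_of_norm_unweight_sub_le (lam := lam) (by positivity) fun t => ?_
    rw [hS, hS]
    have := h.norm_lyapunovPerron_sub_le hζ hlam hgap (unweight_mem lam w) (unweight_mem lam w')
      (norm_unweight_sub_le w w') X X t
    rwa [sub_self, norm_zero, zero_add] at this
  set w₀ := hcontr.fixedPoint S with hw₀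
  have hfix : S w₀ = w₀ := hcontr.fixedPoint_isFixedPt
  refine ⟨unweight lam w₀, unweight_mem lam w₀, by rw [← hS, hfix],
    fun k => unweight lam (S^[k] 0), ?_, fun k => ?_, fun t => ?_⟩
  · ext1 t
    change Real.exp (lam * t) • (0 : State n m) = 0
    exact smul_zero _
  · simp only [Function.iterate_succ_apply', hS]
  · have h1 := hcontr.tendsto_iterate_fixedPoint 0
    rw [← hw₀] at h1
    have h2 : Tendsto (fun k => (S^[k] 0) t) atTop (𝓝 (w₀ t)) :=
      tendsto_iff_dist_tendsto_zero.2 (squeeze_zero (fun _ => dist_nonneg)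
        (fun _ => BoundedContinuousFunction.dist_coe_le_dist t)
        (tendsto_iff_dist_tendsto_zero.1 h1))
    exact h2.const_smul (Real.exp (lam * t))

/-- Fixed points depend on `X` in a Lipschitz way, in the weighted norm. -/
lemma norm_fixedPoint_sub_le (hζ : IsTempered ζ) (hlam : lam < 0)
    (hgap : SpectralGap α β Lf Lg ε lam) {X X' : Eu n} {u u' : C(Iic (0 : ℝ), State n m)}
    (hu : u ∈ weightedSpace n m lam) (hu' : u' ∈ weightedSpace n m lam)
    (hfix : lyapunovPerron A B f g ε ζ X u = u) (hfix' : lyapunovPerron A B f g ε ζ X' u' = u')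
    (s : ℝ) (hs : s ≤ 0) : ‖IicExtend u s - IicExtend u' s‖ ≤
      ‖X - X'‖ / (1 - (Lf / (α - lam) + Lg / (ε * lam - β))) * Real.exp (lam * s) := by
  obtain ⟨w, rfl⟩ := exists_unweight_eq hu
  obtain ⟨w', rfl⟩ := exists_unweight_eq hu'
  have hκ := h.const_nonneg hgap
  have hd : dist w w' ≤ ‖X - X'‖ + (Lf / (α - lam) + Lg / (ε * lam - β)) * dist w w' := by
    refine dist_le_of_norm_unweight_sub_le (lam := lam) (by positivity) fun t => ?_
    have := h.norm_lyapunovPerron_sub_le hζ hlam hgap hu hu' (norm_unweight_sub_le w w') X X' t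
    rwa [hfix, hfix'] at this
  refine (norm_unweight_sub_le w w' s hs).trans ?_
  gcongr
  rw [le_div_iff₀ (sub_pos.2 hgap.2.2.2)]
  linarith

lemma fixedPoint_unique (hζ : IsTempered ζ) (hlam : lam < 0)
    (hgap : SpectralGap α β Lf Lg ε lam) {X : Eu n} {u u' : C(Iic (0 : ℝ), State n m)}
    (hu : u ∈ weightedSpace n m lam) (hu' : u' ∈ weightedSpace n m lam)
    (hfix : lyapunovPerron A B f g ε ζ X u = u) (hfix' : lyapunovPerron A B f g ε ζ X u' = u') :
    u = u' := by
  ext1 t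
  have := h.norm_fixedPoint_sub_le hζ hlam hgap hu hu' hfix hfix' t t.2
  rw [sub_self, norm_zero, zero_div, zero_mul, IicExtend_of_mem _ t.2,
    IicExtend_of_mem _ t.2] at this
  exact sub_eq_zero.1 (norm_le_zero_iff.1 this)

/-- The fixed point does not depend on the admissible `λ < 0`, since the weighted spaces are
nested. -/
lemma fixedPoint_eq {l₁ l₂ : ℝ} (hζ : IsTempered ζ) (hl₁ : l₁ < 0) (hl₂ : l₂ < 0)
    (hgap₁ : SpectralGap α β Lf Lg ε l₁) (hgap₂ : SpectralGap α β Lf Lg ε l₂) {X : Eu n}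
    {u₁ u₂ : C(Iic (0 : ℝ), State n m)} (hu₁ : u₁ ∈ weightedSpace n m l₁)
    (hu₂ : u₂ ∈ weightedSpace n m l₂) (hfix₁ : lyapunovPerron A B f g ε ζ X u₁ = u₁)
    (hfix₂ : lyapunovPerron A B f g ε ζ X u₂ = u₂) : u₁ = u₂ := by
  rcases le_total l₁ l₂ with hl | hl
  · exact h.fixedPoint_unique hζ hl₁ hgap₁ hu₁ (weightedSpace_mono hl hu₂) hfix₁ hfix₂
  · exact h.fixedPoint_unique hζ hl₂ hgap₂ (weightedSpace_mono hl hu₁) hu₂ hfix₁ hfix₂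

lemma norm_snd_fixedPoint_sub_le (hζ : IsTempered ζ) (hlam : lam < 0)
    (hgap : SpectralGap α β Lf Lg ε lam) {X X' : Eu n} {u u' : C(Iic (0 : ℝ), State n m)}
    (hu : u ∈ weightedSpace n m lam) (hu' : u' ∈ weightedSpace n m lam)
    (hfix : lyapunovPerron A B f g ε ζ X u = u) (hfix' : lyapunovPerron A B f g ε ζ X' u' = u') :
    ‖(u ⟨0, mem_Iic.2 le_rfl⟩).snd - (u' ⟨0, mem_Iic.2 le_rfl⟩).snd‖ ≤
      Lg / ((ε * lam - β) * (1 - (Lf / (α - lam) + Lg / (ε * lam - β)))) * ‖X - X'‖ := by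
  have := h.norm_snd_lyapunovPerron_sub_le hζ hlam hgap hu hu'
    (h.norm_fixedPoint_sub_le hζ hlam hgap hu hu' hfix hfix') X X' ⟨0, mem_Iic.2 le_rfl⟩
  rw [hfix, hfix'] at this
  refine this.trans (le_of_eq ?_)
  rw [mul_zero, Real.exp_zero, mul_one, div_mul_div_comm, mul_div_right_comm]

end IsGapSystem

variable (A B f g ε) in
/-- The map whose graph is the invariant manifold: the fast component at time `0` of the
Lyapunov-Perron fixed point in the space with weight `lam`, and `0` if there is none. -/
def manifoldMap (lam : ℝ) (ζ : ℝ → Eu m) (X : Eu n) : Eu m :=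
  open scoped Classical in
  if hex : ∃ u ∈ weightedSpace n m lam, lyapunovPerron A B f g ε ζ X u = u then
    (hex.choose ⟨0, mem_Iic.2 le_rfl⟩).snd
  else 0

namespace IsGapSystem

variable (h : IsGapSystem A B f g α β Lf Lg ε) {ζ : ℝ → Eu m} {lam : ℝ}
include h

lemma manifoldMap_eq {lam₀ : ℝ} (hζ : IsTempered ζ) (hlam₀ : lam₀ < 0) (hlam : lam < 0)
    (hgap₀ : SpectralGap α β Lf Lg ε lam₀) (hgap : SpectralGap α β Lf Lg ε lam) {X : Eu n}
    {u : C(Iic (0 : ℝ), State n m)} (hu : u ∈ weightedSpace n m lam)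
    (hfix : lyapunovPerron A B f g ε ζ X u = u) :
    manifoldMap A B f g ε lam₀ ζ X = (u ⟨0, mem_Iic.2 le_rfl⟩).snd := by
  obtain ⟨u₀, hu₀, hfix₀, -⟩ := h.exists_fixedPoint hζ hlam₀ hgap₀ X
  have hex : ∃ u ∈ weightedSpace n m lam₀, lyapunovPerron A B f g ε ζ X u = u :=
    ⟨u₀, hu₀, hfix₀⟩
  rw [manifoldMap, dif_pos hex, h.fixedPoint_eq hζ hlam₀ hlam hgap₀ hgap hex.choose_spec.1 hu
    hex.choose_spec.2 hfix]

lemma norm_manifoldMap_sub_le {lam₀ : ℝ} (hζ : IsTempered ζ) (hlam₀ : lam₀ < 0) (hlam : lam < 0)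
    (hgap₀ : SpectralGap α β Lf Lg ε lam₀) (hgap : SpectralGap α β Lf Lg ε lam) (X X' : Eu n) :
    ‖manifoldMap A B f g ε lam₀ ζ X - manifoldMap A B f g ε lam₀ ζ X'‖ ≤
      Lg / ((ε * lam - β) * (1 - (Lf / (α - lam) + Lg / (ε * lam - β)))) * ‖X - X'‖ := by
  obtain ⟨u, hu, hfix, -⟩ := h.exists_fixedPoint hζ hlam hgap X
  obtain ⟨u', hu', hfix', -⟩ := h.exists_fixedPoint hζ hlam hgap X'
  rw [h.manifoldMap_eq hζ hlam₀ hlam hgap₀ hgap hu hfix,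
    h.manifoldMap_eq hζ hlam₀ hlam hgap₀ hgap hu' hfix']
  exact h.norm_snd_fixedPoint_sub_le hζ hlam hgap hu hu' hfix hfix'

end IsGapSystem

end FixedPoint

/-! ### Measurability of the fixed point -/

section Measurability

variable {n m : ℕ} (A : Eu n →L[ℝ] Eu n) (B : Eu m →L[ℝ] Eu m)
  (f : Eu n → Eu m → Eu n) (g : Eu n → Eu m → Eu m) (ε : ℝ)

/-- The Lyapunov-Perron operator on arbitrary functions of `t`. Both integrals are transformed to
domains not depending on `t`, which makes joint measurability in `t` and a parameter visible. -/
def perronStep (ζ : ℝ → Eu m) (X : Eu n) (U : ℝ → State n m) (t : ℝ) : State n m :=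
  pt (NormedSpace.exp (t • A) X + t • ∫ r in Ioc (0 : ℝ) 1,
      NormedSpace.exp ((t - t * r) • A) (forcing f ζ U (t * r)))
    (∫ s in Iic (0 : ℝ), NormedSpace.exp ((-s) • ε⁻¹ • B) (ε⁻¹ • forcing g ζ U (s + t)))

/-- The iterates of the Lyapunov-Perron operator, starting from `0`. -/
def perronIterate (ζ : ℝ → Eu m) (X : Eu n) : ℕ → ℝ → State n m
  | 0 => 0
  | k + 1 => perronStep A B f g ε ζ X (perronIterate ζ X k)

variable {A B f g ε}

lemma perronStep_IicExtend (ζ : ℝ → Eu m) (X : Eu n) (u : C(Iic (0 : ℝ), State n m))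
    (t : Iic (0 : ℝ)) :
    perronStep A B f g ε ζ X (IicExtend u) t = lyapunovPerron A B f g ε ζ X u t := by
  rw [lyapunovPerron_eq, integral_Iic_exp_sub_smul (D := ε⁻¹ • B)
    (fun s => ε⁻¹ • forcing g ζ (IicExtend u) s)]
  have := intervalIntegral.smul_integral_comp_mul_left (a := 0) (b := 1)
    (fun s => NormedSpace.exp (((t : ℝ) - s) • A) (forcing f ζ (IicExtend u) s)) t
  rw [mul_zero, mul_one, intervalIntegral.integral_of_le zero_le_one] at this
  rw [← this]
  rfl

lemma perronStep_congr {ζ : ℝ → Eu m} {X : Eu n} {U V : ℝ → State n m}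
    (hUV : ∀ s ≤ 0, U s = V s) {t : ℝ} (ht : t ≤ 0) :
    perronStep A B f g ε ζ X U t = perronStep A B f g ε ζ X V t := by
  have hfor : ∀ {p : ℕ} (k : Eu n → Eu m → Eu p), ∀ s ≤ 0,
      forcing k ζ U s = forcing k ζ V s := fun k s hs => by simp only [forcing, hUV s hs]
  have h1 : ∫ r in Ioc (0 : ℝ) 1, NormedSpace.exp ((t - t * r) • A) (forcing f ζ U (t * r)) =
      ∫ r in Ioc (0 : ℝ) 1, NormedSpace.exp ((t - t * r) • A) (forcing f ζ V (t * r)) :=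
    setIntegral_congr_fun measurableSet_Ioc fun r hr => by
      simp only [hfor f (t * r) (mul_nonpos_of_nonpos_of_nonneg ht hr.1.le)]
  have h2 : ∫ s in Iic (0 : ℝ),
        NormedSpace.exp ((-s) • ε⁻¹ • B) (ε⁻¹ • forcing g ζ U (s + t)) =
      ∫ s in Iic (0 : ℝ), NormedSpace.exp ((-s) • ε⁻¹ • B) (ε⁻¹ • forcing g ζ V (s + t)) :=
    setIntegral_congr_fun measurableSet_Iic fun s hs => by
      simp only [hfor g (s + t) (add_nonpos hs ht)]
  rw [perronStep, perronStep, h1, h2]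

variable {Ω : Type*} [MeasurableSpace Ω]

lemma measurable_perronIterate (hf : Continuous fun q : Eu n × Eu m => f q.1 q.2)
    (hg : Continuous fun q : Eu n × Eu m => g q.1 q.2) {ζ : Ω → ℝ → Eu m}
    (hζ : Measurable fun q : Ω × ℝ => ζ q.1 q.2) (X : Eu n) (k : ℕ) :
    Measurable fun q : Ω × ℝ => perronIterate A B f g ε (ζ q.1) X k q.2 := by
  induction k with
  | zero => exact measurable_const
  | succ k ih =>
    have hfor : ∀ {p : ℕ} (k' : Eu n → Eu m → Eu p),
        (Continuous fun q : Eu n × Eu m => k' q.1 q.2) → Measurable fun q : Ω × ℝ =>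
          forcing k' (ζ q.1) (perronIterate A B f g ε (ζ q.1) X k) q.2 := fun k' hk' =>
      hk'.measurable.comp ((continuous_fst_state.measurable.comp ih).prodMk
        ((continuous_snd_state.measurable.comp ih).add hζ))
    have h1 : Measurable fun q : (Ω × ℝ) × ℝ => NormedSpace.exp ((q.1.2 - q.1.2 * q.2) • A)
        (forcing f (ζ q.1.1) (perronIterate A B f g ε (ζ q.1.1) X k) (q.1.2 * q.2)) := by
      refine measurable_exp_smul_apply A (by fun_prop) ?_
      have hm : Measurable fun q : (Ω × ℝ) × ℝ => (q.1.1, q.1.2 * q.2) :=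
        measurable_fst.fst.prodMk (by fun_prop)
      exact (hfor f hf).comp hm
    have h2 : Measurable fun q : (Ω × ℝ) × ℝ => NormedSpace.exp ((-q.2) • ε⁻¹ • B)
        (ε⁻¹ • forcing g (ζ q.1.1) (perronIterate A B f g ε (ζ q.1.1) X k) (q.2 + q.1.2)) := by
      refine measurable_exp_smul_apply (ε⁻¹ • B) (by fun_prop) ?_
      have hm : Measurable fun q : (Ω × ℝ) × ℝ => (q.1.1, q.2 + q.1.2) :=
        measurable_fst.fst.prodMk (by fun_prop)
      exact ((hfor g hg).comp hm).const_smul ε⁻¹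
    have h4 : Measurable fun q : Ω × ℝ => NormedSpace.exp (q.2 • A) X :=
      measurable_exp_smul_apply A measurable_snd measurable_const
    have h5 := (h1.stronglyMeasurable.integral_prod_right'
      (ν := volume.restrict (Ioc (0 : ℝ) 1))).measurable
    have h6 := (h2.stronglyMeasurable.integral_prod_right'
      (ν := volume.restrict (Iic (0 : ℝ)))).measurable
    exact continuous_pt.measurable.comp ((h4.add (measurable_snd.smul h5)).prodMk h6)

variable {α β Lf Lg : ℝ}

/-- The iterates from `0` are jointly measurable and converge to the fixed point. -/
lemma IsGapSystem.measurable_manifoldMap (h : IsGapSystem A B f g α β Lf Lg ε)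
    {ζ : Ω → ℝ → Eu m} (hζm : Measurable fun q : Ω × ℝ => ζ q.1 q.2)
    (hζ : ∀ ω, IsTempered (ζ ω)) {lam : ℝ} (hlam : lam < 0)
    (hgap : SpectralGap α β Lf Lg ε lam) (X : Eu n) :
    Measurable fun ω => manifoldMap A B f g ε lam (ζ ω) X := by
  refine measurable_of_tendsto_metrizable
    (f := fun k ω => (perronIterate A B f g ε (ζ ω) X k 0).snd) (fun k => ?_)
    (tendsto_pi_nhds.2 fun ω => ?_)
  · exact continuous_snd_state.measurable.comp
      ((measurable_perronIterate (continuous_uncurry_of_lipschitz h.lip_f)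
        (continuous_uncurry_of_lipschitz h.lip_g) hζm X k).comp measurable_prodMk_right)
  · obtain ⟨u, hu, hfix, v, hv0, hv, hlim⟩ := h.exists_fixedPoint (hζ ω) hlam hgap X
    rw [h.manifoldMap_eq (hζ ω) hlam hlam hgap hgap hu hfix]
    have hiter : ∀ k, ∀ t : Iic (0 : ℝ), perronIterate A B f g ε (ζ ω) X k t = v k t := by
      intro k
      induction k with
      | zero => intro t; rw [hv0]; rfl
      | succ k ih =>
        intro t
        rw [hv, ← perronStep_IicExtend, perronIterate]
        refine perronStep_congr (fun s hs => ?_) t.2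
        rw [IicExtend_of_mem _ (mem_Iic.2 hs)]
        exact ih ⟨s, hs⟩
    have h0 : ∀ k, perronIterate A B f g ε (ζ ω) X k 0 = v k ⟨0, mem_Iic.2 le_rfl⟩ :=
      fun k => hiter k ⟨0, mem_Iic.2 le_rfl⟩
    simp_rw [h0]
    exact (continuous_snd_state.tendsto _).comp (hlim _)

end Measurability

/-! ### Invariance -/

section Invariance

variable {n m : ℕ} {A : Eu n →L[ℝ] Eu n} {B : Eu m →L[ℝ] Eu m}
  {f : Eu n → Eu m → Eu n} {g : Eu n → Eu m → Eu m} {α β Lf Lg ε lam : ℝ} {ζ : ℝ → Eu m}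

/-- A fixed point on `(-∞, 0]` and the forward solution starting at its endpoint, glued at `0`. The
maximum does not change the values and keeps `v` on `[0, ∞)`, where it is continuous. -/
def glue (u : C(Iic (0 : ℝ), State n m)) (v : ℝ → State n m) (t : ℝ) : State n m :=
  if t ≤ 0 then IicExtend u t else v (max t 0)

lemma glue_of_nonpos (u : C(Iic (0 : ℝ), State n m)) (v : ℝ → State n m) {t : ℝ} (ht : t ≤ 0) :
    glue u v t = IicExtend u t := if_pos ht

lemma glue_of_nonneg {u : C(Iic (0 : ℝ), State n m)} {v : ℝ → State n m}
    (huv : IicExtend u 0 = v 0) {t : ℝ} (ht : 0 ≤ t) : glue u v t = v t := by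
  rcases ht.eq_or_lt with rfl | ht'
  · rw [glue_of_nonpos u v le_rfl, huv]
  · rw [glue, if_neg (not_le.2 ht'), max_eq_left ht]

lemma continuous_glue {u : C(Iic (0 : ℝ), State n m)} {v : ℝ → State n m}
    (huv : IicExtend u 0 = v 0) (hv : ContinuousOn v (Ici 0)) : Continuous (glue u v) := by
  have hv' : Continuous fun t => v (max t 0) :=
    hv.comp_continuous (by fun_prop) fun t => le_max_right t 0
  refine Continuous.if_le (continuous_IicExtend_state u) hv' continuous_id continuous_const ?_
  intro t ht
  have ht' : t = 0 := ht
  rw [ht', max_self, huv]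

lemma continuousOn_state {v : ℝ → State n m} {s : Set ℝ} (h1 : ContinuousOn (fun t => (v t).fst) s)
    (h2 : ContinuousOn (fun t => (v t).snd) s) : ContinuousOn v s :=
  continuous_pt.comp_continuousOn (h1.prodMk h2)

/-- Translating the glued path moves it to another point of the weighted space. -/
lemma exists_translate_glue_mem {u : C(Iic (0 : ℝ), State n m)} (hu : u ∈ weightedSpace n m lam)
    (hlam : lam < 0) {v : ℝ → State n m} (hU : Continuous (glue u v)) {τ : ℝ} (hτ : 0 ≤ τ) :
    ∃ w ∈ weightedSpace n m lam, ∀ s ≤ (0 : ℝ), IicExtend w s = glue u v (s + τ) := by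
  have hc : Continuous fun t : Iic (0 : ℝ) => glue u v (t + τ) :=
    hU.comp (continuous_subtype_val.add continuous_const)
  refine ⟨⟨_, hc⟩, ?_, fun s hs => IicExtend_of_mem _ (mem_Iic.2 hs)⟩
  obtain ⟨M, hM⟩ := mem_weightedSpace_iff.1 hu
  obtain ⟨C, hC⟩ := (isCompact_Icc (a := (0 : ℝ)) (b := τ)).exists_bound_of_continuousOn
    hU.continuousOn
  have hM0 : 0 ≤ M := by simpa using (norm_nonneg _).trans (hM 0 le_rfl)
  have hC0 : 0 ≤ C := (norm_nonneg _).trans (hC 0 ⟨le_rfl, hτ⟩)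
  refine mem_weightedSpace_iff.2 ⟨M * Real.exp (lam * τ) + C, fun s hs => ?_⟩
  rw [IicExtend_of_mem _ (mem_Iic.2 hs)]
  change ‖glue u v (s + τ)‖ ≤ _
  rw [add_mul]
  rcases le_total (s + τ) 0 with h | h
  · rw [glue_of_nonpos u v h]
    have h1 : M * Real.exp (lam * (s + τ)) = M * Real.exp (lam * τ) * Real.exp (lam * s) := by
      rw [mul_assoc, ← Real.exp_add]; congr 2; ring
    have h2 := hM _ h
    rw [h1] at h2
    have : 0 ≤ C * Real.exp (lam * s) := by positivity
    linarith
  · have h1 := hC (s + τ) ⟨h, by linarith⟩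
    have h2 : 1 ≤ Real.exp (lam * s) := Real.one_le_exp (mul_nonneg_of_nonpos_of_nonpos hlam.le hs)
    have h3 : C ≤ C * Real.exp (lam * s) := le_mul_of_one_le_right hC0 h2
    have : 0 ≤ M * Real.exp (lam * τ) * Real.exp (lam * s) := by positivity
    linarith

namespace IsGapSystem

variable (h : IsGapSystem A B f g α β Lf Lg ε)
include h

/-- The glued path is a mild solution on the whole line. -/
lemma glue_eq_mild (hζ : IsTempered ζ) (hlam : lam < 0) (hgap : SpectralGap α β Lf Lg ε lam)
    {X : Eu n} {u : C(Iic (0 : ℝ), State n m)} (hu : u ∈ weightedSpace n m lam)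
    (hfix : lyapunovPerron A B f g ε ζ X u = u) {v : ℝ → State n m}
    (hv : SolvesRandomSystem A B f g ε ζ v) (huv : IicExtend u 0 = v 0)
    (hU : Continuous (glue u v)) :
    IntegrableOn (fun s : ℝ => NormedSpace.exp ((-s) • ε⁻¹ • B)
      (ε⁻¹ • forcing g ζ (glue u v) s)) (Iic 0) ∧
    ∀ t, glue u v t = pt (mild A X (forcing f ζ (glue u v)) t)
      (mild (ε⁻¹ • B) (∫ s in Iic (0 : ℝ), NormedSpace.exp ((-s) • ε⁻¹ • B)
        (ε⁻¹ • forcing g ζ (glue u v) s)) (fun s => ε⁻¹ • forcing g ζ (glue u v) s) t) := by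
  have hfor : ∀ {p : ℕ} (k : Eu n → Eu m → Eu p), ∀ s ≤ 0,
      forcing k ζ (glue u v) s = forcing k ζ (IicExtend u) s := fun k s hs => by
    simp only [forcing, glue_of_nonpos u v hs]
  have hint := h.integrableOn_past hζ hlam hgap hu (t := 0) le_rfl
  simp only [zero_sub] at hint
  have hQ : ∫ s in Iic (0 : ℝ), NormedSpace.exp ((-s) • ε⁻¹ • B)
        (ε⁻¹ • forcing g ζ (glue u v) s) =
      ∫ s in Iic (0 : ℝ), NormedSpace.exp ((-s) • ε⁻¹ • B)
        (ε⁻¹ • forcing g ζ (IicExtend u) s) :=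
    setIntegral_congr_fun measurableSet_Iic fun s hs => by simp only [hfor g s hs]
  -- For `t ≤ 0` this is the fixed point equation; it also gives the value at `0` from which the
  -- variation of constants formula continues to `t ≥ 0`.
  have hneg : ∀ t ≤ 0, glue u v t = pt (mild A X (forcing f ζ (glue u v)) t)
      (mild (ε⁻¹ • B) (∫ s in Iic (0 : ℝ), NormedSpace.exp ((-s) • ε⁻¹ • B)
        (ε⁻¹ • forcing g ζ (glue u v) s)) (fun s => ε⁻¹ • forcing g ζ (glue u v) s) t) := by
    intro t ht
    have hsub : ∀ s ∈ uIcc 0 t, s ≤ 0 := fun s hs => by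
      rw [uIcc_of_ge ht] at hs; exact hs.2
    have h1 := h.lyapunovPerron_eq_mild hζ hlam hgap hu X ⟨t, ht⟩
    rw [hfix] at h1
    rw [glue_of_nonpos u v ht, IicExtend_of_mem _ (mem_Iic.2 ht), h1, hQ,
      mild_congr (p' := forcing f ζ (glue u v)) fun s hs => (hfor f s (hsub s hs)).symm,
      mild_congr (p' := fun s => ε⁻¹ • forcing g ζ (glue u v) s) fun s hs => by
        rw [hfor g s (hsub s hs)]]
  refine ⟨hint.congr_fun (fun s hs => by simp only [hfor g s hs]) measurableSet_Iic, fun t => ?_⟩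
  rcases le_total t 0 with ht | ht
  · exact hneg t ht
  have hF := h.continuous_slow hζ hU
  have hP := h.continuous_fast hζ hU
  have h0 := hneg 0 le_rfl
  rw [mild_zero, mild_zero, glue_of_nonpos u v le_rfl, huv] at h0
  have hx := eq_exp_smul_add_integral A (v := fun t => (v t).fst) hF.continuousOn
    (fun s hs => by
      have := (hv s hs).1
      rwa [← glue_of_nonneg huv hs] at this ⊢) ht
  have hy := eq_exp_smul_add_integral (ε⁻¹ • B) (v := fun t => (v t).snd) hP.continuousOn
    (fun s hs => by
      have := (hv s hs).2
      rw [smul_add] at this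
      have hg : forcing g ζ (glue u v) s = g (v s).fst ((v s).snd + ζ s) := by
        rw [forcing, glue_of_nonneg huv hs]
      rw [hg]
      exact this) ht
  rw [mild_eq hF, mild_eq hP, glue_of_nonneg huv ht]
  refine State.ext ?_ ?_
  · rw [pt_fst, hx, h0, pt_fst]
  · rw [pt_snd, hy, h0, pt_snd]

/-- Solutions of the random system starting on the graph stay on it: the solution, prolonged to the
past by the fixed point, has the right growth, and so it is the fixed point for the shifted
noise. -/
lemma snd_eq_manifoldMap (hζ : IsTempered ζ) (hlam : lam < 0)
    (hgap : SpectralGap α β Lf Lg ε lam) {X : Eu n} {v : ℝ → State n m}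
    (hv : SolvesRandomSystem A B f g ε ζ v) (hv0 : v 0 = pt X (manifoldMap A B f g ε lam ζ X))
    {τ : ℝ} (hτ : 0 ≤ τ) (hζτ : IsTempered fun s => ζ (s + τ)) :
    (v τ).snd = manifoldMap A B f g ε lam (fun s => ζ (s + τ)) (v τ).fst := by
  obtain ⟨u, hu, hfix, -⟩ := h.exists_fixedPoint hζ hlam hgap X
  have huv : IicExtend u 0 = v 0 := by
    rw [IicExtend_of_mem _ (mem_Iic.2 le_rfl), hv0]
    refine State.ext ?_ ?_
    · rw [← hfix, lyapunovPerron_eq]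
      simp
    · rw [pt_snd, h.manifoldMap_eq hζ hlam hlam hgap hgap hu hfix]
  have hU : Continuous (glue u v) := continuous_glue huv
    (continuousOn_state (fun t ht => (hv t ht).1.continuousWithinAt)
      fun t ht => (hv t ht).2.continuousWithinAt)
  obtain ⟨hint, hmild⟩ := h.glue_eq_mild hζ hlam hgap hu hfix hv huv hU
  obtain ⟨w, hw, hwU⟩ := exists_translate_glue_mem hu hlam hU hτ
  have hF := h.continuous_slow hζ hU
  have hP := h.continuous_fast hζ hU
  have hfor : ∀ {p : ℕ} (k : Eu n → Eu m → Eu p), ∀ s ≤ 0,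
      forcing k (fun s => ζ (s + τ)) (IicExtend w) s = forcing k ζ (glue u v) (s + τ) :=
    fun k s hs => by simp only [forcing, hwU s hs]
  have hτ1 : mild A X (forcing f ζ (glue u v)) τ = (v τ).fst := by
    rw [← glue_of_nonneg huv hτ, hmild τ, pt_fst]
  -- Restarting the mild solution at `τ` shows that the translate is a fixed point for the shifted
  -- noise.
  have hfixw : lyapunovPerron A B f g ε (fun s => ζ (s + τ)) (v τ).fst w = w := by
    funext t
    have ht : (t : ℝ) ≤ 0 := t.2
    have hsub : ∀ s ∈ uIcc 0 (t : ℝ), s ≤ 0 := fun s hs => by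
      rw [uIcc_of_ge ht] at hs; exact hs.2
    have hQ : ∫ s in Iic (0 : ℝ), NormedSpace.exp ((-s) • ε⁻¹ • B)
          (ε⁻¹ • forcing g (fun s => ζ (s + τ)) (IicExtend w) s) =
        mild (ε⁻¹ • B) (∫ s in Iic (0 : ℝ), NormedSpace.exp ((-s) • ε⁻¹ • B)
          (ε⁻¹ • forcing g ζ (glue u v) s)) (fun s => ε⁻¹ • forcing g ζ (glue u v) s) τ := by
      rw [← integral_Iic_eq_mild hP hint, integral_Iic_exp_sub_smul (D := ε⁻¹ • B)
        (fun s => ε⁻¹ • forcing g ζ (glue u v) s)]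
      exact setIntegral_congr_fun measurableSet_Iic fun s hs => by simp only [hfor g s hs]
    have hwt : w t = glue u v (t + τ) := by
      rw [← hwU t ht, IicExtend_of_mem _ t.2]
    rw [h.lyapunovPerron_eq_mild hζτ hlam hgap hw, hwt, hmild (t + τ), hQ, mild_shift hF,
      mild_shift hP, hτ1,
      mild_congr (p' := fun s => forcing f ζ (glue u v) (s + τ))
        fun s hs => hfor f s (hsub s hs),
      mild_congr (p' := fun s => ε⁻¹ • forcing g ζ (glue u v) (s + τ))
        fun s hs => by rw [hfor g s (hsub s hs)]]
  rw [h.manifoldMap_eq hζτ hlam hlam hgap hgap hw hfixw]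
  have h0 := hwU 0 le_rfl
  rw [IicExtend_of_mem _ (mem_Iic.2 le_rfl), zero_add, glue_of_nonneg huv hτ] at h0
  rw [h0]

end IsGapSystem

end Invariance

/-! ### Random graphs -/

lemma pt_add_pt_zero {n m : ℕ} (x : Eu n) (y y' : Eu m) : pt x y + pt 0 y' = pt x (y + y') :=
  State.ext (add_zero x) rfl

section RandomGraph

variable {Ω : Type*} [MeasurableSpace Ω] {n m : ℕ}

lemma isClosed_range_graph {ψ : Eu n → Eu m} (hψ : Continuous ψ) :
    IsClosed (range fun x => pt x (ψ x)) := by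
  have : (range fun x => pt x (ψ x)) = {z : State n m | z.snd = ψ z.fst} := by
    ext z
    constructor
    · rintro ⟨x, rfl⟩
      exact rfl
    · intro hz
      exact ⟨z.fst, State.ext rfl (Eq.symm hz)⟩
  rw [this]
  exact isClosed_eq continuous_snd_state (hψ.comp continuous_fst_state)

/-- By continuity the distance to the range is an infimum over countably many of its points. -/
lemma measurable_infDist_range {X Z : Type*} [TopologicalSpace X]
    [TopologicalSpace.SeparableSpace X] [Nonempty X] [PseudoMetricSpace Z]
    {F : Ω → X → Z} (hF : ∀ ω, Continuous (F ω)) (z : Z)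
    (hm : ∀ x, Measurable fun ω => dist z (F ω x)) :
    Measurable fun ω => Metric.infDist z (range (F ω)) := by
  have h : ∀ ω, Metric.infDist z (range (F ω)) =
      ⨅ k, dist z (F ω (TopologicalSpace.denseSeq X k)) := by
    intro ω
    have hcl : closure (range (F ω)) = closure (range (F ω ∘ TopologicalSpace.denseSeq X)) := by
      refine subset_antisymm (closure_minimal ?_ isClosed_closure)
        (closure_mono (range_comp_subset_range _ (F ω)))
      rw [range_comp]
      exact (hF ω).range_subset_closure_image_dense (TopologicalSpace.denseRange_denseSeq X)
    rw [← Metric.infDist_closure, hcl, Metric.infDist_closure, Metric.infDist_eq_iInf,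
      iInf_range' (fun y => dist z y)]
    rfl
  simp_rw [h]
  exact Measurable.iInf fun k => hm _

lemma isRandomSet_graph {ψ : Eu n → Ω → Eu m} (hψ : ∀ x, Measurable (ψ x))
    (hc : ∀ ω, Continuous fun x => ψ x ω) :
    IsRandomSet fun ω => range fun x => pt x (ψ x ω) where
  nonempty ω := range_nonempty _
  isClosed ω := isClosed_range_graph (hc ω)
  measurable z := by
    refine measurable_infDist_range (F := fun ω x => pt x (ψ x ω))
      (fun ω => continuous_pt.comp (continuous_id.prodMk (hc ω))) z fun x => ?_
    have hd : Continuous fun y : Eu m => dist z (pt x y) :=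
      continuous_const.dist (continuous_pt.comp (continuous_const.prodMk continuous_id))
    exact hd.measurable.comp (hψ x)

end RandomGraph

/-! ### The noise and the conjugacy of the two flows -/

section Noise

variable {n m : ℕ} {A : Eu n →L[ℝ] Eu n} {B : Eu m →L[ℝ] Eu m}
  {f : Eu n → Eu m → Eu n} {g : Eu n → Eu m → Eu m} {α β Lf Lg σ ε : ℝ}

/-- The paths for which `eta` is defined by a convergent integral and its translates grow
subexponentially at `-∞` on average. -/
def noiseSet (B : Eu m →L[ℝ] Eu m) (σ ε : ℝ) : Set (PathSpace m) :=
  convergenceSet (ε⁻¹ • B) ∩ temperedSet (eta B σ ε)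

open Classical in
/-- The path `s ↦ eta (shift s ω)`, replaced by `0` off `noiseSet`, so as to be tempered for every
`ω`. This keeps the manifold a Lipschitz graph for every `ω`. -/
def noisePath (B : Eu m →L[ℝ] Eu m) (σ ε : ℝ) (ω : PathSpace m) (s : ℝ) : Eu m :=
  if ω ∈ noiseSet B σ ε then eta B σ ε (shift s ω) else 0

lemma noisePath_of_mem {ω : PathSpace m} (hω : ω ∈ noiseSet B σ ε) :
    noisePath B σ ε ω = fun s => eta B σ ε (shift s ω) :=
  funext fun _ => if_pos hω

lemma measurableSet_noiseSet (B : Eu m →L[ℝ] Eu m) (σ ε : ℝ) : MeasurableSet (noiseSet B σ ε) :=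
  (measurableSet_convergenceSet _).inter (measurableSet_temperedSet B σ ε)

lemma measurable_noisePath (B : Eu m →L[ℝ] Eu m) (σ ε : ℝ) :
    Measurable fun p : PathSpace m × ℝ => noisePath B σ ε p.1 p.2 :=
  Measurable.ite (measurable_fst (measurableSet_noiseSet B σ ε)) (measurable_eta_shift B σ ε)
    measurable_const

lemma IsWienerMeasure.measure_compl_noiseSet {P : Measure (PathSpace m)} (hP : IsWienerMeasure P)
    {γ : ℝ} (hγ : γ < 0) (hD : ∀ t : ℝ, 0 ≤ t → ∀ y,
      ‖NormedSpace.exp (t • ε⁻¹ • B) y‖ ≤ Real.exp (γ * t) * ‖y‖) :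
    P (noiseSet B σ ε)ᶜ = 0 :=
  mem_ae_iff.1 <| by
    filter_upwards [hP.ae_mem_convergenceSet hγ hD, hP.ae_mem_temperedSet (σ := σ) hγ hD]
      with ω h1 h2 using ⟨h1, h2⟩

lemma preimage_shift_noiseSet {γ : ℝ} (hγ : γ < 0) (hD : ∀ t : ℝ, 0 ≤ t → ∀ y,
      ‖NormedSpace.exp (t • ε⁻¹ • B) y‖ ≤ Real.exp (γ * t) * ‖y‖) (t : ℝ) :
    shift t ⁻¹' noiseSet B σ ε = noiseSet B σ ε := by
  have h : ∀ t : ℝ, ∀ ω ∈ noiseSet B σ ε, shift t ω ∈ noiseSet B σ ε := fun t ω hω =>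
    ⟨(shift_mem_convergenceSet hγ hD t ω).2 hω.1,
      shift_mem_temperedSet (continuous_eta_shift hγ hD ω) hω.2 t⟩
  refine subset_antisymm (fun ω hω => ?_) (h t)
  have := h (-t) _ hω
  rwa [shift_shift, neg_add_cancel, shift_zero] at this

lemma isTempered_noisePath {γ : ℝ} (hγ : γ < 0) (hD : ∀ t : ℝ, 0 ≤ t → ∀ y,
      ‖NormedSpace.exp (t • ε⁻¹ • B) y‖ ≤ Real.exp (γ * t) * ‖y‖) (ω : PathSpace m) :
    IsTempered (noisePath B σ ε ω) := by
  by_cases hω : ω ∈ noiseSet B σ ε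
  · rw [noisePath_of_mem hω]
    exact ⟨continuous_eta_shift hγ hD ω, fun lam hlam =>
      integrableOn_exp_smul_of_mem_temperedSet (continuous_eta_shift hγ hD ω) hω.2 hlam⟩
  · have : noisePath B σ ε ω = fun _ => 0 := funext fun _ => if_neg hω
    rw [this]
    refine ⟨continuous_const, fun lam _ => ?_⟩
    simp_rw [norm_zero, mul_zero]
    exact integrableOn_zero

/-- Adding the noise to the fast variable conjugates the random flow to the stochastic one. -/
lemma stochasticFlow_add_eta {γ : ℝ} (hγ : γ < 0) (hD : ∀ t : ℝ, 0 ≤ t → ∀ y,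
      ‖NormedSpace.exp (t • ε⁻¹ • B) y‖ ≤ Real.exp (γ * t) * ‖y‖)
    (hf : Continuous fun q : Eu n × Eu m => f q.1 q.2)
    (hg : Continuous fun q : Eu n × Eu m => g q.1 q.2)
    {K : ℝ≥0} (hK : ∀ y, LipschitzWith K (field A B f g ε y))
    {ω : PathSpace m} (hω : ω ∈ convergenceSet (ε⁻¹ • B)) (t : ℝ≥0) (z : State n m) :
    stochasticFlow A B f g σ ε t ω (z + pt 0 (eta B σ ε ω)) =
      randomFlow A B f g σ ε t ω z + pt 0 (eta B σ ε (shift t ω)) := by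
  have hη := continuous_eta_shift (σ := σ) hγ hD
  obtain ⟨h0, hsol, -⟩ := isSolutionMap_randomFlow (σ := σ) hf hg hK hη ω z
  have hadd := SolvesRandomSystem.add_noise (σ := σ) hf hg (hη ω) (w := fun t => ω t)
    (fun t => by rw [shift_zero]; exact eta_shift_eq_add_integral hγ hD hω t) hsol
  have := (isSolutionMap_stochasticFlow (σ := σ) hf hg hK ω (z + pt 0 (eta B σ ε ω))).2.2 _ hadd
    (by simp only [Real.toNNReal_zero, h0, shift_zero]) t
  simp only [Real.toNNReal_coe] at this
  exact this.symm

/-- The function of the slow variable and the noise whose graph is the slow manifold of the random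
system. -/
def slowManifold (A : Eu n →L[ℝ] Eu n) (B : Eu m →L[ℝ] Eu m) (f : Eu n → Eu m → Eu n)
    (g : Eu n → Eu m → Eu m) (σ ε lam : ℝ) (X : Eu n) (ω : PathSpace m) : Eu m :=
  manifoldMap A B f g ε lam (noisePath B σ ε ω) X

end Noise

/-! ### The slow manifold -/

section SlowManifold

variable {n m : ℕ} {A : Eu n →L[ℝ] Eu n} {B : Eu m →L[ℝ] Eu m}
  {f : Eu n → Eu m → Eu n} {g : Eu n → Eu m → Eu m} {α β Lf Lg σ ε lam lam₀ : ℝ}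

namespace IsGapSystem

variable (h : IsGapSystem A B f g α β Lf Lg ε)
include h

lemma slowManifold_eq_integral (hβ : β < 0) (hlam₀ : lam₀ < 0) (hlam : lam < 0)
    (hgap₀ : SpectralGap α β Lf Lg ε lam₀) (hgap : SpectralGap α β Lf Lg ε lam)
    {ω : PathSpace m} (hω : ω ∈ noiseSet B σ ε) {X : Eu n} {u : C(Iic (0 : ℝ), State n m)}
    (hu : u ∈ weightedSpace n m lam)
    (hfix : lyapunovPerron A B f g ε (fun s => eta B σ ε (shift s ω)) X u = u) :
    slowManifold A B f g σ ε lam₀ X ω = ε⁻¹ • ∫ s in Iic (0 : ℝ),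
      fastIntegrand B g ε (fun s => eta B σ ε (shift s ω)) u 0 s := by
  have hζ := isTempered_noisePath (σ := σ) (div_neg_of_neg_of_pos hβ h.ε_pos) h.exp_smul_B ω
  rw [noisePath_of_mem hω] at hζ
  rw [slowManifold, noisePath_of_mem hω, h.manifoldMap_eq hζ hlam₀ hlam hgap₀ hgap hu hfix, ← hfix]
  rfl

lemma norm_slowManifold_sub_le (hβ : β < 0) (hlam₀ : lam₀ < 0) (hlam : lam < 0)
    (hgap₀ : SpectralGap α β Lf Lg ε lam₀) (hgap : SpectralGap α β Lf Lg ε lam)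
    (ω : PathSpace m) (X X' : Eu n) :
    ‖slowManifold A B f g σ ε lam₀ X ω - slowManifold A B f g σ ε lam₀ X' ω‖ ≤
      Lg / ((ε * lam - β) * (1 - (Lf / (α - lam) + Lg / (ε * lam - β)))) * ‖X - X'‖ :=
  h.norm_manifoldMap_sub_le (isTempered_noisePath (div_neg_of_neg_of_pos hβ h.ε_pos)
    h.exp_smul_B ω) hlam₀ hlam hgap₀ hgap X X'

lemma lipschitzWith_slowManifold (hβ : β < 0) (hlam : lam < 0)
    (hgap : SpectralGap α β Lf Lg ε lam) (ω : PathSpace m) :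
    LipschitzWith (Lg / ((ε * lam - β) * (1 - (Lf / (α - lam) + Lg / (ε * lam - β))))).toNNReal
      fun X => slowManifold A B f g σ ε lam X ω :=
  LipschitzWith.of_dist_le' fun X X' => by
    rw [dist_eq_norm, dist_eq_norm]
    exact h.norm_slowManifold_sub_le hβ hlam hlam hgap hgap ω X X'

lemma measurable_slowManifold (hβ : β < 0) (hlam : lam < 0)
    (hgap : SpectralGap α β Lf Lg ε lam) (X : Eu n) :
    Measurable (slowManifold A B f g σ ε lam X) :=
  h.measurable_manifoldMap (measurable_noisePath B σ ε)
    (isTempered_noisePath (div_neg_of_neg_of_pos hβ h.ε_pos) h.exp_smul_B) hlam hgap X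

lemma isLipschitzInvariantManifold_randomFlow (hβ : β < 0) (hlam : lam < 0)
    (hgap : SpectralGap α β Lf Lg ε lam) :
    IsLipschitzInvariantManifold shift (noiseSet B σ ε) (randomFlow A B f g σ ε)
      (fun ω => range fun X => pt X (slowManifold A B f g σ ε lam X ω))
      (slowManifold A B f g σ ε lam) where
  randomSet := isRandomSet_graph (h.measurable_slowManifold hβ hlam hgap)
    fun ω => (h.lipschitzWith_slowManifold hβ hlam hgap ω).continuous
  graph _ := rfl
  measurable := h.measurable_slowManifold hβ hlam hgap
  lipschitz ω := ⟨_, h.lipschitzWith_slowManifold hβ hlam hgap ω⟩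
  invariant := by
    rintro ω hω t _ ⟨X, rfl⟩
    have hγ := div_neg_of_neg_of_pos hβ h.ε_pos
    have hωt : shift t ω ∈ noiseSet B σ ε := by
      rwa [← mem_preimage, preimage_shift_noiseSet hγ h.exp_smul_B]
    obtain ⟨K, hK⟩ := exists_lipschitzWith_field (A := A) (B := B) (ε := ε) h.Lf_nonneg h.lip_f
      h.Lg_nonneg h.lip_g
    obtain ⟨h0, hsol, -⟩ := isSolutionMap_randomFlow (σ := σ)
      (continuous_uncurry_of_lipschitz h.lip_f) (continuous_uncurry_of_lipschitz h.lip_g) hK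
      (continuous_eta_shift hγ h.exp_smul_B) ω (pt X (slowManifold A B f g σ ε lam X ω))
    have hζ := isTempered_noisePath (σ := σ) hγ h.exp_smul_B ω
    have hζt := isTempered_noisePath (σ := σ) hγ h.exp_smul_B (shift t ω)
    have hpath : noisePath B σ ε (shift t ω) = fun s => noisePath B σ ε ω (s + t) := by
      rw [noisePath_of_mem hω, noisePath_of_mem hωt]
      simp_rw [shift_shift]
    rw [← noisePath_of_mem hω] at hsol
    rw [hpath] at hζt
    have := h.snd_eq_manifoldMap hζ hlam hgap hsol (by rw [Real.toNNReal_zero, h0]; rfl)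
      t.coe_nonneg hζt
    rw [← hpath] at this
    simp only [Real.toNNReal_coe] at this
    exact ⟨_, State.ext rfl this.symm⟩

/-- The invariant manifold is carried to the stochastic system by the conjugacy. -/
lemma isLipschitzInvariantManifold_stochasticFlow (hβ : β < 0) (hlam : lam < 0)
    (hgap : SpectralGap α β Lf Lg ε lam) :
    IsLipschitzInvariantManifold shift (noiseSet B σ ε) (stochasticFlow A B f g σ ε)
      (fun ω => range fun X => pt X (slowManifold A B f g σ ε lam X ω + eta B σ ε ω))
      (fun X ω => slowManifold A B f g σ ε lam X ω + eta B σ ε ω) where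
  randomSet := isRandomSet_graph
    (fun X => (h.measurable_slowManifold hβ hlam hgap X).add (measurable_eta B σ ε))
    fun ω => (h.lipschitzWith_slowManifold hβ hlam hgap ω).continuous.add continuous_const
  graph _ := rfl
  measurable X := (h.measurable_slowManifold hβ hlam hgap X).add (measurable_eta B σ ε)
  lipschitz ω := ⟨_, (h.lipschitzWith_slowManifold hβ hlam hgap ω).add (LipschitzWith.const _)⟩
  invariant := by
    rintro ω hω t _ ⟨X, rfl⟩
    obtain ⟨K, hK⟩ := exists_lipschitzWith_field (A := A) (B := B) (ε := ε) h.Lf_nonneg h.lip_f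
      h.Lg_nonneg h.lip_g
    have hconj := stochasticFlow_add_eta (σ := σ) (div_neg_of_neg_of_pos hβ h.ε_pos) h.exp_smul_B
      (continuous_uncurry_of_lipschitz h.lip_f) (continuous_uncurry_of_lipschitz h.lip_g) hK hω.1 t
      (pt X (slowManifold A B f g σ ε lam X ω))
    rw [pt_add_pt_zero] at hconj
    obtain ⟨X', hX'⟩ := (h.isLipschitzInvariantManifold_randomFlow hβ hlam hgap).invariant ω hω t
      ⟨X, rfl⟩
    exact ⟨X', by rw [hconj, ← hX', pt_add_pt_zero]⟩

end IsGapSystem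

end SlowManifold

end SlowFast

end

theorem mainTheorem4 (n m : ℕ) (A : Eu n →L[ℝ] Eu n) (B : Eu m →L[ℝ] Eu m)
    (f : Eu n → Eu m → Eu n) (g : Eu n → Eu m → Eu m) (σ α β Lf Lg : ℝ)
    (hLf : 0 ≤ Lf)
    (hf : ∀ x x' y y', ‖f x y - f x' y'‖ ≤ Lf * (‖x - x'‖ + ‖y - y'‖))
    (hLg : 0 ≤ Lg)
    (hg : ∀ x x' y y', ‖g x y - g x' y'‖ ≤ Lg * (‖x - x'‖ + ‖y - y'‖))
    (hα : 0 ≤ α) (hβ : β < 0)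
    (hA : ∀ t : ℝ, t ≤ 0 → ∀ x, ‖NormedSpace.exp (t • A) x‖ ≤ Real.exp (α * t) * ‖x‖)
    (hB : ∀ t : ℝ, 0 ≤ t → ∀ y, ‖NormedSpace.exp (t • B) y‖ ≤ Real.exp (β * t) * ‖y‖)
    (hgap : ∀ ε : ℝ, 0 < ε → ε ≤ 1 → ∃ lam, SpectralGap α β Lf Lg ε lam)
    (hLgβ : Lg + β < 0)
    (P : Measure (PathSpace m)) (hP : IsWienerMeasure P)
    (ε : ℝ) (hε : 0 < ε) (hε1 : ε ≤ 1) :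
    (∃ lam < 0, SpectralGap α β Lf Lg ε lam) ∧
    ∃ Ω₀ : Set (PathSpace m), MeasurableSet Ω₀ ∧ P Ω₀ᶜ = 0 ∧ (∀ t, shift t ⁻¹' Ω₀ = Ω₀) ∧
      SolvesLinearSDE B σ ε Ω₀ (eta B σ ε) ∧
      ∃ (Φ φ : ℝ≥0 → PathSpace m → State n m → State n m) (h : Eu n → PathSpace m → Eu m),
        -- the random system and the original stochastic system generate continuous RDSs
        IsContinuousRDS P shift Φ ∧
        IsSolutionMap (fun ω => SolvesRandomSystem A B f g ε fun t => eta B σ ε (shift t ω)) Φ ∧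
        IsContinuousRDS P shift φ ∧
        IsSolutionMap (fun ω => SolvesStochasticSystem A B f g σ ε fun t => ω t) φ ∧
        (∀ ω ∈ Ω₀, ∀ (t : ℝ≥0) (z : State n m),
          φ t ω (z + pt 0 (eta B σ ε ω)) = Φ t ω z + pt 0 (eta B σ ε (shift t ω))) ∧
        -- `h` is given by the Lyapunov-Perron fixed point
        (∀ lam < 0, SpectralGap α β Lf Lg ε lam → ∀ ω ∈ Ω₀, ∀ X₀ : Eu n,
          (∀ u ∈ weightedSpace n m lam,
            (∀ t ≤ 0, IntegrableOn
              (fastIntegrand B g ε (fun s => eta B σ ε (shift s ω)) u t) (Iic t)) ∧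
            ∃ v ∈ weightedSpace n m lam,
              ⇑v = lyapunovPerron A B f g ε (fun s => eta B σ ε (shift s ω)) X₀ u) ∧
          ∃ u ∈ weightedSpace n m lam,
            lyapunovPerron A B f g ε (fun s => eta B σ ε (shift s ω)) X₀ u = u ∧
            (∀ v ∈ weightedSpace n m lam,
              lyapunovPerron A B f g ε (fun s => eta B σ ε (shift s ω)) X₀ v = v → v = u) ∧
            h X₀ ω = ε⁻¹ • ∫ s in Iic (0 : ℝ),
              fastIntegrand B g ε (fun s => eta B σ ε (shift s ω)) u 0 s) ∧
        -- deterministic Lipschitz constant of `h`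
        (∀ lam < 0, SpectralGap α β Lf Lg ε lam → ∀ ω X X',
          ‖h X ω - h X' ω‖ ≤
            Lg / ((ε * lam - β) * (1 - (Lf / (α - lam) + Lg / (ε * lam - β)))) * ‖X - X'‖) ∧
        -- the random invariant manifolds of the random and of the stochastic system
        IsLipschitzInvariantManifold shift Ω₀ Φ (fun ω => {z | ∃ X, z = pt X (h X ω)}) h ∧
        IsLipschitzInvariantManifold shift Ω₀ φ
          (fun ω => (fun z => z + pt 0 (eta B σ ε ω)) '' {z | ∃ X, z = pt X (h X ω)})
          (fun X ω => h X ω + eta B σ ε ω) := by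
  obtain ⟨lam₀, hlam₀, hgap₀⟩ := exists_neg_spectralGap hLf hLg hα hβ hgap hLgβ hε hε1
  have h : IsGapSystem A B f g α β Lf Lg ε := ⟨hLf, hf, hLg, hg, hA, hB, hε⟩
  have hγ : β / ε < 0 := div_neg_of_neg_of_pos hβ hε
  have hD := h.exp_smul_B
  have hη := continuous_eta_shift (σ := σ) hγ hD
  have hcf := continuous_uncurry_of_lipschitz hf
  have hcg := continuous_uncurry_of_lipschitz hg
  obtain ⟨K, hK⟩ := exists_lipschitzWith_field (A := A) (B := B) (ε := ε) hLf hf hLg hg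
  have hgraph : ∀ ω, {z | ∃ X, z = pt X (slowManifold A B f g σ ε lam₀ X ω)} =
      range fun X => pt X (slowManifold A B f g σ ε lam₀ X ω) := fun ω => by
    ext z
    exact exists_congr fun X => eq_comm
  refine ⟨⟨lam₀, hlam₀, hgap₀⟩, noiseSet B σ ε, measurableSet_noiseSet B σ ε,
    hP.measure_compl_noiseSet hγ hD, preimage_shift_noiseSet hγ hD,
    ⟨measurable_eta B σ ε, fun ω hω => ⟨hη ω, eta_shift_eq_add_integral hγ hD hω.1⟩⟩,
    randomFlow A B f g σ ε, stochasticFlow A B f g σ ε, slowManifold A B f g σ ε lam₀,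
    isContinuousRDS_randomFlow hP hcf hcg hK hη, isSolutionMap_randomFlow hcf hcg hK hη,
    isContinuousRDS_stochasticFlow hP hcf hcg hK, isSolutionMap_stochasticFlow hcf hcg hK,
    fun ω hω t z => stochasticFlow_add_eta hγ hD hcf hcg hK hω.1 t z,
    fun lam hlam hgap ω hω X₀ => ?_,
    fun lam hlam hgap ω X X' => h.norm_slowManifold_sub_le hβ hlam₀ hlam hgap₀ hgap ω X X', ?_, ?_⟩
  · have hζ := isTempered_noisePath (σ := σ) hγ hD ω
    rw [noisePath_of_mem hω] at hζ
    refine ⟨fun u hu => ⟨fun t ht => ?_, h.exists_eq_lyapunovPerron hζ hlam hgap hu X₀⟩, ?_⟩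
    · have hint := h.integrableOn_past hζ hlam hgap hu ht
      simp_rw [← smul_fastIntegrand] at hint
      exact (integrable_fun_smul_iff (inv_ne_zero hε.ne') _).1 hint
    · obtain ⟨u, hu, hfix, -⟩ := h.exists_fixedPoint hζ hlam hgap X₀
      exact ⟨u, hu, hfix, fun v hv hfixv => h.fixedPoint_unique hζ hlam hgap hv hu hfixv hfix,
        h.slowManifold_eq_integral hβ hlam₀ hlam hgap₀ hgap hω hu hfix⟩
  · simp_rw [hgraph]
    exact h.isLipschitzInvariantManifold_randomFlow hβ hlam₀ hgap₀
  · simp_rw [hgraph, ← range_comp, Function.comp_def, pt_add_pt_zero]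
    exact h.isLipschitzInvariantManifold_stochasticFlow hβ hlam₀ hgap₀
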